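/- **Conventions.** Let $\mathbb K$ be an evenly graded commutative ring containing $\mathbb Q$, and let $V$ be a free graded $\mathbb K$-module with homogeneous basis $\{v_i\}_{i\in I}$. Put $(\Sigma V)^n=V^{n+1}$ and $W=(\Sigma V)^*$, a profinite graded module with topological basis $\{t_i\}$ dual to $\{\Sigma v_i\}$, so that $|t_i|=1-|v_i|$, and let $\widehat TW=\mathbb K\langle\langle t_i\rangle\rangle=\prod_{n\ge0}W^{\hat\otimes n}$. Let $\widehat LW\subset\widehat TW$ be the Lie subalgebra of convergent linear combinations of Lie monomials. A $C_\infty$-structure on $V$ is a continuous derivation $m$ of $\widehat LW$ of degree $1$ with $m^2=0$; it extends uniquely to a continuous derivation $m$ of $\widehat TW$ with $m^2=0$. It is unital if there is $1\in V^0$, part of a basis $1,\{x_i\}$ of $V$ with dual topological basis $\tau,\{t_i\}$ of $W$, such that $m=A(t)\partial_\tau+\sum_i B_i(t)\partial_{t_i}+\mathrm{ad}\,\tau-\tau^2\partial_\tau$ where $A,B_i$ do not involve $\tau$. **Complexes.** Let $C=\prod_{n\ge1}W^{\hat\otimes n}$. Let $z$ act on $W^{\hat\otimes n}$ by $z(x_1x_2\cdots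 x_n)=(-1)^{|x_1|(|x_2|+\dots+|x_n|)}x_2\cdots x_nx_1$ and let $N=1+z+\dots+z^{n-1}$ on $W^{\hat\otimes n}$. Let $b'=m|_C$ and let $b=\Theta^{-1}L_m\Theta$, where $\Theta:C=W\hat\otimes\widehat TW\to DR^1(\widehat TW)$, $\Theta(x\otimes y)=dx\cdot y$, is the identification with noncommutative $1$-forms and $L_m$ is the Lie derivative; explicitly $b(xy)=-\Theta^{-1}(dm(x)\cdot y)-(-1)^{|x|}x\,m(y)$ for $x\in W$, $y\in\widehat TW$. Then * $HH^n(V,V^*)$ is the cohomology of $(\Sigma C,b)$; * $HC^n(V)$ is the cohomology of the complex $\bigl(\Sigma(C/(1-z)C),b'\bigr)$ of noncommutative $0$-forms (elements of $\widehat TW/[\widehat TW,\widehat TW]$) vanishing at zero. The map $N$ into the leftmost column identifies it with the cohomology of the direct-sum total complex of the Tsygan bicomplex $$(\Sigma C,b)\xrightarrow{1-z}(\Sigma C,b')\xrightarrow{N}(\Sigma C,b)\xrightarrow{1-z}\cdots .$$ For unital $V$ the shift of the Tsygan bicomplex by two columns, its quotient formed by the first two columns, and the quasi-isomorphic projection of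 this quotient onto the leftmost column give the Connes periodicity long exact sequence $$\cdots\to HC^{n-2}(V)\xrightarrow{S}HC^n(V)\xrightarrow{I}HH^n(V,V^*)\xrightarrow{B}HC^{n-1}(V)\to\cdots .$$ **Hodge decomposition.** Let $\mu$ be the product of $\widehat TW$, $\Delta$ the coproduct for which the elements of $W$ are primitive, and $s=\mu\Delta$. On $W^{\hat\otimes n}$ put $e(j)=\prod_{0\le r\le n,\,r\ne j}\frac{s-2^r}{2^j-2^r}$ for $j\le n$ and $e(j)=0$ for $j>n$, and let $\tilde e(j)=1\hat\otimes e(j)$ on $C=W\hat\otimes\widehat TW$. For $j\ge0$ let $HH^n_{(j)}(V,V^*)$ and $HC^n_{(j)}(V)$ be the cohomologies of the subcomplexes $(\Sigma\,\tilde e(j)[C],b)$ and $(\Sigma\,e(j+1)[C/(1-z)C],b')$. The $\tilde e(j)$, respectively the $e(j+1)$, for $j\ge0$ induce decompositions $HH^n(V,V^*)=\prod_{j\ge0}HH^n_{(j)}(V,V^*)$ and $HC^n(V)=\prod_{j\ge0}HC^n_{(j)}(V)$. **Proposition.** Let $V$ be a unital $C_\infty$-algebra. The Connes periodicity long exact sequence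 respects the Hodge decomposition: for every $j\ge0$ the maps $S,I,B$ restrict to maps, compatible with the inclusions of the components and with the projections onto them, which form a long exact sequence $$\cdots\to HC^{n-2}_{(j)}(V)\xrightarrow{S}HC^{n}_{(j+1)}(V)\xrightarrow{I}HH^n_{(j+1)}(V,V^*)\xrightarrow{B}HC^{n-1}_{(j)}(V)\xrightarrow{S}HC^{n+1}_{(j+1)}(V)\to\cdots .$$ -/

import Mathlib

/-!
Conventions.  `K` is an evenly graded commutative ring containing `ℚ`, with graded pieces `𝒦 n`.
A free graded `K`-module `V` is given by a homogeneous basis `(v_i)`, `i : I`, with `v_i` of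
degree `deg i`.  The suspension is `(ΣV)^n = V^{n+1}`, so the topological basis `(t_i)` of the
profinite module `W = (ΣV)^*` dual to `(Σ v_i)` has `|t_i| = 1 - deg i`.  The completed tensor
algebra of `W` is the algebra `K⟨⟨t⟩⟩` of noncommutative formal power series in the `t_i`; a series
is recorded by its coefficients, a function on the set `List I` of words.
-/

namespace CInfHodge

/-! ### Noncommutative power series -/

/-- The completed tensor algebra `T̂(ΣV^*) = K⟨⟨t⟩⟩`: the series `∑_w f(w) t_w`. -/
abbrev Series (K I : Type*) := List I → K

/-- The degree `|t_w|` of the monomial `t_w`. -/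
def wdeg {I : Type*} (deg : I → ℤ) (w : List I) : ℤ := (w.map fun i => 1 - deg i).sum

/-- The sign `(-1)^n`. -/
def sgn (n : ℤ) : ℤ := (n.negOnePow : ℤ)

section Algebra

variable {K I : Type*} [CommRing K]

/-- The variable `t_i`. -/
def var [DecidableEq I] (i : I) : Series K I := Pi.single [i] 1

/-- The (concatenation) product of noncommutative power series. -/
def cmul (f g : Series K I) : Series K I := fun w =>
  ∑ k ∈ Finset.range (w.length + 1), f (w.take k) * g (w.drop k)

/-- `[f, g] = f g - (-1)^{pq} g f` for `f`, `g` of degrees `p`, `q`. -/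
def bracket (p q : ℤ) (f g : Series K I) : Series K I := cmul f g - sgn (p * q) • cmul g f

/-- The left quotient `f_i` of `f`, so that `f = f(∅) + ∑_i t_i f_i`. -/
def lquot (i : I) : Series K I →ₗ[K] Series K I where
  toFun f := fun w => f (i :: w)
  map_add' _ _ := rfl
  map_smul' _ _ := rfl

/-- The closure of a submodule of `K⟨⟨t⟩⟩` in the inverse limit topology (the product topology, with
`K` discrete): all convergent infinite linear combinations of elements of `P`. -/
def clos (P : Submodule K (Series K I)) : Submodule K (Series K I) where
  carrier := {f | ∀ F : Finset (List I), ∃ g ∈ P, ∀ w ∈ F, f w = g w}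
  zero_mem' := fun _ => ⟨0, P.zero_mem, fun _ _ => rfl⟩
  add_mem' := by
    intro a b ha hb F
    obtain ⟨g, hg, hga⟩ := ha F
    obtain ⟨h, hh, hhb⟩ := hb F
    exact ⟨g + h, P.add_mem hg hh, fun w hw => by simp [hga w hw, hhb w hw]⟩
  smul_mem' := by
    intro c a ha F
    obtain ⟨g, hg, hga⟩ := ha F
    exact ⟨c • g, P.smul_mem c hg, fun w hw => by simp [hga w hw]⟩

end Algebra

section Graded

variable {K I : Type*} [CommRing K] [Algebra ℚ K]
variable (𝒦 : ℤ → Submodule ℚ K) [GradedAlgebra 𝒦] (deg : I → ℤ)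

/-- The series of degree `n`: the coefficient of `t_w` has degree `n - |t_w|` in `K`. -/
def homog (n : ℤ) : Submodule (𝒦 0) (Series K I) where
  carrier := {f | ∀ w, f w ∈ 𝒦 (n - wdeg deg w)}
  zero_mem' := fun _ => Submodule.zero_mem _
  add_mem' := fun ha hb w => Submodule.add_mem _ (ha w) (hb w)
  smul_mem' := by
    intro c a ha w
    have h := SetLike.mul_mem_graded c.2 (ha w)
    rw [zero_add] at h
    exact h

/-- The part of degree `n` of `∏_{i ≥ 1} (ΣV^*)^{⊗̂ i}`, the series without constant term. -/
def col (n : ℤ) : Submodule (𝒦 0) (Series K I) where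
  carrier := {f | f ∈ homog 𝒦 deg n ∧ f [] = 0}
  zero_mem' := ⟨Submodule.zero_mem _, rfl⟩
  add_mem' := fun ha hb => ⟨Submodule.add_mem _ ha.1 hb.1, by simp [ha.2, hb.2]⟩
  smul_mem' := fun c _ ha => ⟨Submodule.smul_mem _ c ha.1, by simp [ha.2]⟩

/-- Lie monomials in the `t_i`, with their degrees. -/
inductive IsLieMonomial [DecidableEq I] : ℤ → Series K I → Prop
  | var (i : I) : IsLieMonomial (1 - deg i) (var i)
  | bracket {p q : ℤ} {f g : Series K I} (hf : IsLieMonomial p f) (hg : IsLieMonomial q g) :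
      IsLieMonomial (p + q) (bracket p q f g)

/-- The pro-free Lie algebra `L̂(ΣV^*)`: convergent linear combinations of Lie monomials. -/
def lieSeries [DecidableEq I] : Submodule K (Series K I) :=
  clos (Submodule.span K {f | ∃ p, IsLieMonomial deg p f})

/-- The span of the commutators in `K⟨⟨t⟩⟩`. -/
def commSpan : Submodule K (Series K I) :=
  Submodule.span K {h | ∃ p q f g, f ∈ homog 𝒦 deg p ∧ g ∈ homog 𝒦 deg q ∧ h = bracket p q f g}

/-- The module of commutators `[T̂, T̂]`: convergent linear combinations of commutators. -/
def commutators : Submodule K (Series K I) := clos (commSpan 𝒦 deg)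

/-- The noncommutative `0`-forms `DR^0 = T̂ / [T̂, T̂]`. -/
abbrev ZeroForms := Series K I ⧸ commutators (K := K) 𝒦 deg

/-! ### `A_∞`- and `C_∞`-structures -/

/-- An `A_∞`-structure on `V`: a continuous derivation `m` of `T̂(ΣV^*)` of degree one which
vanishes at zero and satisfies `m² = 0`. -/
structure AInfStructure [DecidableEq I] where
  /-- the vector field -/
  m : Series K I →ₗ[K] Series K I
  continuous : ∀ w, ∃ F : Finset (List I), ∀ f : Series K I, (∀ u ∈ F, f u = 0) → m f w = 0
  degree_one : ∀ n, ∀ f ∈ homog 𝒦 deg n, m f ∈ homog 𝒦 deg (n + 1)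
  leibniz : ∀ p q, ∀ f ∈ homog 𝒦 deg p, ∀ g ∈ homog 𝒦 deg q,
    m (cmul f g) = cmul (m f) g + sgn p • cmul f (m g)
  vanishes : ∀ i, m (var i) [] = 0
  sq_zero : ∀ f, m (m f) = 0

variable {𝒦 deg} [DecidableEq I]

/-- `A` is a `C_∞`-structure.  A `C_∞`-structure on `V` is a continuous derivation of degree one and
square zero of the Lie algebra `L̂(ΣV^*)`.  It extends uniquely to a continuous derivation of
`T̂(ΣV^*)`, its associated `A_∞`-structure; the `A_∞`-structures so obtained are those that map
`L̂(ΣV^*)` to itself. -/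
def AInfStructure.IsCInf (A : AInfStructure 𝒦 deg) : Prop :=
  ∀ f ∈ lieSeries (K := K) deg, A.m f ∈ lieSeries deg

/-- `m` is unital with unit the basis element `1 = v_e`: with `τ = t_e`,
`m = A(t) ∂_τ + ∑_{i ≠ e} B_i(t) ∂_{t_i} + ad τ - τ² ∂_τ`, where `A` and the `B_i` are power series
in the `t_i` with `i ≠ e`. -/
def AInfStructure.IsUnital (A : AInfStructure 𝒦 deg) (e : I) : Prop :=
  deg e = 0 ∧
  (∃ a : Series K I, (∀ w, e ∈ w → a w = 0) ∧
    A.m (var e) = a + bracket 1 1 (var e) (var e) - cmul (var e) (var e)) ∧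
  ∀ i, i ≠ e → ∃ b : Series K I, (∀ w, e ∈ w → b w = 0) ∧
    A.m (var i) = b + bracket 1 (1 - deg i) (var e) (var i)

theorem AInfStructure.m_commSpan (A : AInfStructure 𝒦 deg) {f : Series K I}
    (hf : f ∈ commSpan 𝒦 deg) : A.m f ∈ commSpan 𝒦 deg := by
  induction hf using Submodule.span_induction with
  | mem x hx =>
    obtain ⟨p, q, f, g, hf, hg, rfl⟩ := hx
    have key : A.m (bracket p q f g)
        = bracket (p + 1) q (A.m f) g + sgn p • bracket p (q + 1) f (A.m g) := by
      have h1 : sgn ((p + 1) * q) = sgn (p * q) * sgn q := by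
        simp only [sgn]
        rw [add_mul, one_mul, Int.negOnePow_add]
        push_cast
        rfl
      have h2 : sgn p * sgn (p * (q + 1)) = sgn (p * q) := by
        simp only [sgn]
        rw [mul_add, mul_one, Int.negOnePow_add]
        rcases Int.units_eq_one_or p.negOnePow with h | h <;> simp [h]
      simp only [bracket, map_sub, map_zsmul, A.leibniz p q f hf g hg, A.leibniz q p g hg f hf,
        smul_sub, smul_add, smul_smul, h1, h2]
      abel
    rw [key]
    have h3 : bracket p (q + 1) f (A.m g) ∈ commSpan 𝒦 deg :=
      Submodule.subset_span ⟨p, q + 1, _, _, hf, A.degree_one q g hg, rfl⟩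
    have h4 : bracket (p + 1) q (A.m f) g ∈ commSpan 𝒦 deg :=
      Submodule.subset_span ⟨p + 1, q, _, _, A.degree_one p f hf, hg, rfl⟩
    exact Submodule.add_mem _ h4 (zsmul_mem h3 _)
  | zero => simp
  | add x y _ _ hx hy => rw [map_add]; exact Submodule.add_mem _ hx hy
  | smul a x _ hx => rw [map_smul]; exact Submodule.smul_mem _ a hx

theorem AInfStructure.m_commutators (A : AInfStructure 𝒦 deg) :
    commutators 𝒦 deg ≤ (commutators 𝒦 deg).comap A.m := by
  classical
  intro f hf F
  choose G hG using A.continuous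
  obtain ⟨g, hg, hfg⟩ := hf (F.biUnion G)
  refine ⟨A.m g, A.m_commSpan hg, fun w hw => ?_⟩
  have h := hG w (f - g) fun u hu => by
    simp [hfg u (Finset.mem_biUnion.2 ⟨w, hw, hu⟩)]
  rw [map_sub, Pi.sub_apply, sub_eq_zero] at h
  exact h

/-- The Lie derivative `L_m` on `DR^0`, induced by `m`. -/
def AInfStructure.lieDer (A : AInfStructure 𝒦 deg) : ZeroForms 𝒦 deg →ₗ[K] ZeroForms 𝒦 deg :=
  Submodule.mapQ _ _ A.m A.m_commutators

/-! ### One-forms and the Hochschild differential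

The one-forms `DR^1` are identified with `W ⊗̂ T̂W = ∏_{i ≥ 1} W^{⊗̂ i}` by `Θ(x ⊗ y) = dx · y`. -/

variable (deg) in
/-- `Θ⁻¹(du · y)`.  Modulo commutators, `d(t_q t_a t_r) · t_y` has the term
`(-1)^{|q|(|a| + |r| + |y|)} dt_a · t_r t_y t_q` for each factorisation into a word `q`, a letter `a`
and a word `r`. -/
def dmul (u y : Series K I) : Series K I
  | [] => 0
  | a :: w => ∑ k ∈ Finset.range (w.length + 1), ∑ l ∈ Finset.range (w.length - k + 1),
      let r := w.take k
      let v := (w.drop k).take l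
      let q := (w.drop k).drop l
      sgn (wdeg deg q * (wdeg deg (a :: r) + wdeg deg v)) • (u (q ++ a :: r) * y v)

/-- For every word only finitely many of the series `m(t_i)` have a nonzero coefficient there. -/
theorem AInfStructure.finite_coeff (A : AInfStructure 𝒦 deg) (v : List I) :
    {i | A.m (var i) v ≠ 0}.Finite := by
  obtain ⟨F, hF⟩ := A.continuous v
  refine Set.Finite.subset (F.finite_toSet.preimage (f := fun i : I => [i])
    (by intro a _ b _ h; simpa using h)) fun i hi => ?_
  by_contra hc
  refine hi (hF _ fun u hu => ?_)
  have hne : u ≠ [i] := fun h => hc (by simpa [h] using hu)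
  simp [var, hne]

theorem AInfStructure.finite_dmul (A : AInfStructure 𝒦 deg) (f : I → Series K I) (w : List I) :
    (Function.support fun i => dmul deg (A.m (var i)) (f i) w).Finite := by
  cases w with
  | nil => simp [dmul, Function.support]
  | cons a w =>
    refine Set.Finite.subset (Set.Finite.biUnion (Finset.finite_toSet
      (Finset.range (w.length + 1))) fun k _ => Set.Finite.biUnion (Finset.finite_toSet
      (Finset.range (w.length - k + 1))) fun l _ =>
        A.finite_coeff ((w.drop k).drop l ++ a :: w.take k)) fun i hi => ?_
    obtain ⟨k, hk, h⟩ := Finset.exists_ne_zero_of_sum_ne_zero hi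
    obtain ⟨l, hl, h⟩ := Finset.exists_ne_zero_of_sum_ne_zero h
    refine Set.mem_biUnion hk (Set.mem_biUnion hl ?_)
    intro h0
    exact h (by simp only [h0, zero_mul, smul_zero])

/-- The Hochschild differential `b = Θ⁻¹ L_m Θ`.  Since `L_m(dx · y) = - dm(x) · y
- (-1)^{|x|} dx · m(y)`, one has `b f = - ∑_i (Θ⁻¹(dm(t_i) · f_i) + (-1)^{|t_i|} t_i m(f_i))` for
`f = ∑_i t_i f_i`. -/
noncomputable def AInfStructure.b (A : AInfStructure 𝒦 deg) : Series K I →ₗ[K] Series K I where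
  toFun f
    | [] => 0
    | a :: w => -(∑ᶠ i, dmul deg (A.m (var i)) (lquot i f) (a :: w))
        - sgn (1 - deg a) • A.m (lquot a f) w
  map_add' f g := by
    funext w
    cases w with
    | nil => simp
    | cons a w =>
      have h : ∀ i, dmul deg (A.m (var i)) (lquot i (f + g)) (a :: w) =
          dmul deg (A.m (var i)) (lquot i f) (a :: w)
            + dmul deg (A.m (var i)) (lquot i g) (a :: w) := fun i => by
        simp [dmul, mul_add, Finset.sum_add_distrib]
      simp only [h]
      simp only [Pi.add_apply, map_add]
      rw [finsum_add_distrib (A.finite_dmul (fun i => lquot i f) _)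
        (A.finite_dmul (fun i => lquot i g) _), smul_add]
      abel
  map_smul' c f := by
    funext w
    cases w with
    | nil => simp
    | cons a w =>
      have h : ∀ i, dmul deg (A.m (var i)) (lquot i (c • f)) (a :: w) =
          c • dmul deg (A.m (var i)) (lquot i f) (a :: w) := fun i => by
        simp only [dmul, map_smul, Pi.smul_apply, Finset.mul_sum, smul_eq_mul]
        refine Finset.sum_congr rfl fun k _ => Finset.sum_congr rfl fun l _ => ?_
        rw [mul_smul_comm, mul_left_comm]
      simp only [h]
      simp only [Pi.smul_apply, map_smul, RingHom.id_apply]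
      rw [← smul_finsum' c (A.finite_dmul (fun i => lquot i f) _), smul_sub, smul_neg,
        smul_comm c (sgn (1 - deg a))]

end Graded

/-! ### The cyclic operators -/

section Cyclic

variable (K : Type*) {I : Type*} [CommRing K] (deg : I → ℤ)

/-- The generator `z` of the cyclic group actions:
`z(t_a t_u) = (-1)^{|t_a||t_u|} t_u t_a`. -/
def zOp : Series K I →ₗ[K] Series K I where
  toFun f w := if h : w = [] then f [] else
    sgn ((1 - deg (w.getLast h)) * wdeg deg w.dropLast) • f (w.getLast h :: w.dropLast)
  map_add' f g := by
    funext w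
    by_cases h : w = [] <;> simp [h]
  map_smul' c f := by
    funext w
    by_cases h : w = []
    · simp [h]
    · simp only [h, dite_false, Pi.smul_apply, RingHom.id_apply]
      exact smul_comm _ _ _

/-- The norm operator `N`, equal to `1 + z + ⋯ + z^{n-1}` on series homogeneous of order `n`. -/
def normOp : Series K I →ₗ[K] Series K I where
  toFun f w := ∑ k ∈ Finset.range w.length, (zOp K deg ^ k) f w
  map_add' f g := by funext w; simp [Finset.sum_add_distrib]
  map_smul' c f := by funext w; simp [Finset.mul_sum]

/-! ### The Hodge idempotents -/

/-- The signed shuffle product of two words; `shuffle u v p` is the coefficient of `t_u ⊗ t_v` in the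
shuffle coproduct `Δ(t_p)`, where `Δ` is the continuous algebra homomorphism with
`Δ(t_i) = t_i ⊗ 1 + 1 ⊗ t_i`. -/
noncomputable def shuffle : List I → List I → (List I →₀ ℤ)
  | [], v => Finsupp.single v 1
  | a :: u, [] => Finsupp.single (a :: u) 1
  | a :: u, b :: v => Finsupp.mapDomain (List.cons a) (shuffle u (b :: v))
      + sgn ((1 - deg b) * wdeg deg (a :: u)) • Finsupp.mapDomain (List.cons b) (shuffle (a :: u) v)
termination_by u v => u.length + v.length

/-- The modified shuffle operator `s = μ Δ`. -/
noncomputable def shuffleOp : Series K I →ₗ[K] Series K I where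
  toFun f w := ∑ k ∈ Finset.range (w.length + 1),
    (shuffle deg (w.take k) (w.drop k)).sum fun p c => c • f p
  map_add' f g := by
    funext w
    simp [Finsupp.sum, Finset.sum_add_distrib]
  map_smul' c f := by
    funext w
    simp only [Finsupp.sum, Pi.smul_apply, RingHom.id_apply, Finset.smul_sum]
    refine Finset.sum_congr rfl fun k _ => Finset.sum_congr rfl fun p _ => ?_
    exact smul_comm _ _ _

variable [Algebra ℚ K]

/-- The operator `e(j)`, on series homogeneous of order `n ≥ j` the Lagrange interpolation polynomial
`∏_{0 ≤ r ≤ n, r ≠ j} (s - 2^r) / (2^j - 2^r)` of `s`, and `0` for `n < j`. -/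
noncomputable def eOp (j : ℕ) : Series K I →ₗ[K] Series K I where
  toFun f w := if j ≤ w.length then
    (Polynomial.aeval (shuffleOp K deg)
      (Lagrange.basis (Finset.range (w.length + 1)) (fun r : ℕ => (2 : ℚ) ^ r) j)) f w else 0
  map_add' f g := by
    funext w
    by_cases h : j ≤ w.length <;> simp [h]
  map_smul' c f := by
    funext w
    by_cases h : j ≤ w.length <;> simp [h]

/-- The operator `ẽ(j) = 1 ⊗̂ e(j)` on `W ⊗̂ T̂W = ∏_{i ≥ 1} W^{⊗̂ i}`. -/
noncomputable def eTilde (j : ℕ) : Series K I →ₗ[K] Series K I where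
  toFun f
    | [] => 0
    | a :: w => eOp K deg j (lquot a f) w
  map_add' f g := by
    funext w
    cases w <;> simp
  map_smul' c f := by
    funext w
    cases w <;> simp

end Cyclic

/-! ### Cochain complexes and their cohomology -/

/-- Graded pieces `X n` inside an ambient module, with a differential. -/
structure Cx (R M : Type*) [Ring R] [AddCommGroup M] [Module R M] where
  /-- the cochains of degree `n` -/
  X : ℤ → Submodule R M
  /-- the differential -/
  d : M →ₗ[R] M

namespace Cx

variable {R M M' : Type*} [Ring R] [AddCommGroup M] [Module R M] [AddCommGroup M'] [Module R M']

/-- `X` is a cochain complex: `d` has degree one and square zero. -/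
def IsComplex (C : Cx R M) : Prop := ∀ n, ∀ x ∈ C.X n, C.d x ∈ C.X (n + 1) ∧ C.d (C.d x) = 0

/-- The cocycles of degree `n`. -/
def cocycles (C : Cx R M) (n : ℤ) : Submodule R M := C.X n ⊓ LinearMap.ker C.d

/-- The cohomology in degree `n`. -/
abbrev H (C : Cx R M) (n : ℤ) :=
  C.cocycles n ⧸ ((C.X (n - 1)).map C.d).comap (C.cocycles n).subtype

/-- `x` is a cocycle of degree `n` and represents the class `ξ`. -/
def Represents (C : Cx R M) (n : ℤ) (x : M) (ξ : C.H n) : Prop :=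
  ∃ hx : x ∈ C.cocycles n, ξ = Submodule.Quotient.mk ⟨x, hx⟩

/-- `F` is the map induced in cohomology by the map `φ` on cochains. -/
def Induces (C : Cx R M) (C' : Cx R M') (φ : M → M') {n n' : ℤ} (F : C.H n →ₗ[R] C'.H n') : Prop :=
  ∀ x ξ, C.Represents n x ξ → C'.Represents n' (φ x) (F ξ)

end Cx

/-- Exactness of `⋯ → H^{n-2}(C) → H^n(C') → H^n(E) → H^{n-1}(C) → H^{n+1}(C') → ⋯`. -/
def IsLongExact {R M M' M'' : Type*} [Ring R] [AddCommGroup M] [Module R M] [AddCommGroup M']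
    [Module R M'] [AddCommGroup M''] [Module R M''] {C : Cx R M} {C' : Cx R M'} {E : Cx R M''}
    (S : ∀ n, C.H n →ₗ[R] C'.H (n + 2)) (T : ∀ n, C'.H n →ₗ[R] E.H n)
    (B : ∀ n, E.H (n + 1) →ₗ[R] C.H n) : Prop :=
  ∀ n, Function.Exact (S n) (T (n + 2)) ∧ Function.Exact (T (n + 1)) (B n) ∧
    Function.Exact (B n) (S n)

section Complexes

variable {K I : Type*} [CommRing K] [Algebra ℚ K] {𝒦 : ℤ → Submodule ℚ K} [GradedAlgebra 𝒦]
variable {deg : I → ℤ} [DecidableEq I]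

/-- The cyclic Hochschild complex: the suspension of the module of `0`-forms vanishing at zero, with
the differential `L_m`. -/
def cyclicCx (A : AInfStructure 𝒦 deg) : Cx (𝒦 0) (ZeroForms 𝒦 deg) where
  X n := (col 𝒦 deg (n + 1)).map ((commutators 𝒦 deg).mkQ.restrictScalars (𝒦 0))
  d := A.lieDer.restrictScalars (𝒦 0)

/-- The Hochschild complex with coefficients in `V^*`, suspended one-forms with the differential
`L_m`, transported along `Θ`. -/
noncomputable def hochCx (A : AInfStructure 𝒦 deg) : Cx (𝒦 0) (Series K I) where
  X n := col 𝒦 deg (n + 1)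
  d := A.b.restrictScalars (𝒦 0)

/-- The component `e(j+1)[⋯]` of index `j` of the cyclic Hochschild complex. -/
noncomputable def cyclicHodge (A : AInfStructure 𝒦 deg) (j : ℕ) : Cx (𝒦 0) (ZeroForms 𝒦 deg) where
  X n := ((col 𝒦 deg (n + 1)).map ((eOp K deg (j + 1)).restrictScalars (𝒦 0))).map
    ((commutators 𝒦 deg).mkQ.restrictScalars (𝒦 0))
  d := A.lieDer.restrictScalars (𝒦 0)

/-- The component `ẽ(j)[⋯]` of index `j` of the Hochschild complex. -/
noncomputable def hochHodge (A : AInfStructure 𝒦 deg) (j : ℕ) : Cx (𝒦 0) (Series K I) where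
  X n := (col 𝒦 deg (n + 1)).map ((eTilde K deg j).restrictScalars (𝒦 0))
  d := A.b.restrictScalars (𝒦 0)

/-- The differential of the total complex of the Tsygan bicomplex: the columns carry `b`, `b'`, `b`,
`b'`, … (`b'` is `m`) and the horizontal maps are `1 - z`, `N`, `1 - z`, `N`, …. -/
noncomputable def tsyganD (A : AInfStructure 𝒦 deg) :
    (ℕ →₀ Series K I) →ₗ[K] (ℕ →₀ Series K I) :=
  Finsupp.lsum K fun i =>
    Finsupp.lsingle i ∘ₗ (if Even i then A.b else A.m) +
    Finsupp.lsingle (i + 1) ∘ₗ (if Even i then LinearMap.id - zOp K deg else normOp K deg)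

/-- The total complex, formed with direct sums, of the Tsygan bicomplex. -/
noncomputable def tsyganCx (A : AInfStructure 𝒦 deg) : Cx (𝒦 0) (ℕ →₀ Series K I) where
  X n := ⨅ i : ℕ, (col 𝒦 deg (n - i + 1)).comap
    ((Finsupp.lapply i : (ℕ →₀ Series K I) →ₗ[K] Series K I).restrictScalars (𝒦 0))
  d := (tsyganD A).restrictScalars (𝒦 0)

/-- The inclusion of the Tsygan complex into itself, shifting by two columns to the right. -/
noncomputable def shift2 (x : ℕ →₀ Series K I) : ℕ →₀ Series K I := x.mapDomain (· + 2)

/-- `S`, `T` (usually written `I`) and `B` are the maps of the Connes periodicity sequence, where `q`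
is the identification of cyclic Hochschild cohomology with the cohomology of the Tsygan complex. -/
structure IsPeriodicity (A : AInfStructure 𝒦 deg)
    (q : ∀ n, (cyclicCx A).H n ≃ₗ[𝒦 0] (tsyganCx A).H n)
    (S : ∀ n, (cyclicCx A).H n →ₗ[𝒦 0] (cyclicCx A).H (n + 2))
    (T : ∀ n, (cyclicCx A).H n →ₗ[𝒦 0] (hochCx A).H n)
    (B : ∀ n, (hochCx A).H (n + 1) →ₗ[𝒦 0] (cyclicCx A).H n) : Prop where
  /-- `q` is induced by the map `N` into the leftmost column. -/
  q_eq : ∀ n x ξ, (cyclicCx A).Represents n ((commutators 𝒦 deg).mkQ x) ξ →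
    (tsyganCx A).Represents n (Finsupp.single 0 (normOp K deg x)) (q n ξ)
  /-- `S` is induced by the shift by two columns. -/
  S_eq : ∀ n x ξ, (tsyganCx A).Represents n x (q n ξ) →
    (tsyganCx A).Represents (n + 2) (shift2 x) (q (n + 2) (S n ξ))
  /-- `I` is induced by the projection to the first two columns, followed by the
  quasi-isomorphism that projects these to the leftmost column. -/
  T_eq : ∀ n x ξ, (tsyganCx A).Represents n x (q n ξ) → (hochCx A).Represents n (x 0) (T n ξ)
  /-- `B` is the connecting map: a Hochschild class is represented by the leftmost component of a
  cochain `x` whose first two columns form a cocycle, that is, whose differential is the shift of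
  some `y`; and then `y` represents the image of the class under `B`. -/
  B_lift : ∀ n ξ, ∃ x ∈ (tsyganCx A).X (n + 1), ∃ y,
    (hochCx A).Represents (n + 1) (x 0) ξ ∧ (tsyganCx A).d x = shift2 y
  B_eq : ∀ n ξ, ∀ x ∈ (tsyganCx A).X (n + 1), ∀ y,
    (hochCx A).Represents (n + 1) (x 0) ξ → (tsyganCx A).d x = shift2 y →
    (tsyganCx A).Represents n y (q n (B n ξ))

/-- `ι j`, `π j` exhibit `H^n(C)` as the direct product over `j ≥ 0` of the `H^n(D j)`. -/
structure IsProductDecomp {R M : Type*} [Ring R] [AddCommGroup M] [Module R M] (C : Cx R M)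
    (D : ℕ → Cx R M) (ι : ∀ j n, (D j).H n →ₗ[R] C.H n) (π : ∀ j n, C.H n →ₗ[R] (D j).H n) :
    Prop where
  bijective : ∀ n, Function.Bijective fun (ξ : C.H n) (j : ℕ) => π j n ξ
  π_ι_self : ∀ j n ξ, π j n (ι j n ξ) = ξ
  π_ι_ne : ∀ i j n ξ, i ≠ j → π i n (ι j n ξ) = 0

/-- `ι` and `π` are the inclusions and projections of the Hodge decomposition of cyclic Hochschild
cohomology: they are induced by the inclusions of the components and by the `e(j+1)`. -/
structure IsCyclicHodgeDecomp (A : AInfStructure 𝒦 deg)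
    (ι : ∀ j n, (cyclicHodge A j).H n →ₗ[𝒦 0] (cyclicCx A).H n)
    (π : ∀ j n, (cyclicCx A).H n →ₗ[𝒦 0] (cyclicHodge A j).H n) : Prop
    extends IsProductDecomp (cyclicCx A) (cyclicHodge A) ι π where
  ι_eq : ∀ j n, Cx.Induces (cyclicHodge A j) (cyclicCx A) id (ι j n)
  π_eq : ∀ j n x ξ, (cyclicCx A).Represents n ((commutators 𝒦 deg).mkQ x) ξ →
    (cyclicHodge A j).Represents n ((commutators 𝒦 deg).mkQ (eOp K deg (j + 1) x)) (π j n ξ)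

/-- `ι` and `π` are the inclusions and projections of the Hodge decomposition of Hochschild
cohomology: they are induced by the inclusions of the components and by the `ẽ(j)`. -/
structure IsHochHodgeDecomp (A : AInfStructure 𝒦 deg)
    (ι : ∀ j n, (hochHodge A j).H n →ₗ[𝒦 0] (hochCx A).H n)
    (π : ∀ j n, (hochCx A).H n →ₗ[𝒦 0] (hochHodge A j).H n) : Prop
    extends IsProductDecomp (hochCx A) (hochHodge A) ι π where
  ι_eq : ∀ j n, Cx.Induces (hochHodge A j) (hochCx A) id (ι j n)
  π_eq : ∀ j n, Cx.Induces (hochCx A) (hochHodge A j) (eTilde K deg j) (π j n)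

end Complexes

end CInfHodge

open CInfHodge

/-!
The proof works throughout with power series recorded by their coefficients: `K` is given the
discrete topology and `Series K I` the product topology, so that two continuous `K`-linear maps
agree as soon as they agree on the monomials `mon K w` (`IsCL.ext`).  Every identity between the
operators `m`, `b`, `z`, `N`, `e(j)`, `ẽ(j)` is obtained in this way.

*The bicomplex.*  All identities for `b` come from a single formula,
`b (Θ⁻¹(du · y)) = -Θ⁻¹(dm(u) · y) ∓ Θ⁻¹(du · m(y))` (`AInfStructure.b_dmul`), together with
`N f = Θ⁻¹(df · 1)` and the fact that `1 - z` sends `Θ⁻¹(du · y)` to the commutator of `u` and `y`.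
They give `b² = 0`, `b N = -N m` and `(1 - z) b = -m (1 - z)`.  Since `K` contains `ℚ`, the rows of
the Tsygan bicomplex are exact and the module of commutators is the kernel of `N` on series without
constant term (`mem_commutators_iff`); hence `N` identifies the cohomology of `0`-forms with that
of the Tsygan complex (`toTsygan_bijective`).

*Periodicity.*  For a unit `t_e`, the left quotient by `t_e` is a contraction `h` of the columns
carrying `m` (`AInfStructure.IsUnital.m_unitHtpy`).  So the first two columns compute Hochschild
cohomology (`exists_sub_eq_shift2`), the connecting map is induced by `-h (1 - z)`, and the long
exact sequence is that of the shift by two columns (`IsPeriodicity.isLongExact`).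

*The Hodge idempotents.*  The shuffle coproduct is an algebra map, so Lie series are primitive and a
derivation preserving them commutes with `s = μ Δ` (`IsCInf.m_shuffleOp`).  The same property gives
`b s̃ = s̃ b` for `s̃ = 1 ⊗ s` (`IsCInf.b_shuffleTilde`).  The key relation with the cyclic operators
is `N s = 2 s̃ N` (`normOp_shuffleOp`): it turns the eigenvalue `2^{j+1}` of `s` into the eigenvalue
`2^j` of `s̃`.  Filtering words by the number of primitive factors shows that
`∏_{r ≤ n} (s - 2^r)` vanishes on words of length `n`, so the `e(j)` are orthogonal idempotents with
sum `1`, and `N e(j+1) = ẽ(j) N`, `N e(0) = 0`, `(1 - z) ẽ(j) = e(j) (1 - z)`.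

*Compatibility.*  Consequently the maps `ẽ(j - k)` on column `2k` and `e(j - k)` on column `2k + 1`
form an endomorphism of the Tsygan complex (`tsyganProj`), which induces the `j`-th Hodge projection
of cyclic cohomology, restricts to `ẽ(j)` in the leftmost column, and for `j + 1` is carried by the
shift by two columns to the one for `j`.  Therefore `S`, `I`, `B` intertwine the Hodge projections
with the stated change of index, and a direct summand of an exact sequence is exact.
-/


set_option linter.unusedSectionVars false

namespace CInfHodge

/-! ### Continuous linear maps between spaces of series -/

/-- `φ` is a continuous `K`-linear map.  Being a property of functions rather than a bundled map, it
can be checked by `fun_prop` for expressions built from the operators below. -/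
@[fun_prop]
structure IsCL (K : Type*) {M N : Type*} [CommRing K] [AddCommGroup M] [Module K M]
    [AddCommGroup N] [Module K N] [TopologicalSpace M] [TopologicalSpace N] (φ : M → N) : Prop where
  add : ∀ x y, φ (x + y) = φ x + φ y
  smul : ∀ (c : K) x, φ (c • x) = c • φ x
  cont : Continuous φ

namespace IsCL

variable {K M N P : Type*} [CommRing K] [AddCommGroup M] [Module K M] [AddCommGroup N] [Module K N]
  [TopologicalSpace M] [TopologicalSpace N] [AddCommGroup P] [Module K P] [TopologicalSpace P]

@[fun_prop] theorem id' : IsCL K (fun x : M => x) := ⟨fun _ _ => rfl, fun _ _ => rfl, continuous_id⟩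

@[fun_prop] theorem comp' {φ : N → P} {ψ : M → N} (h : IsCL K φ) (h' : IsCL K ψ) :
    IsCL K (fun x => φ (ψ x)) :=
  ⟨fun _ _ => by simp [h'.add, h.add], fun _ _ => by simp [h'.smul, h.smul], h.cont.comp h'.cont⟩

@[fun_prop] theorem zero' : IsCL K (fun _ : M => (0 : N)) :=
  ⟨by simp, by simp, continuous_const⟩

@[fun_prop] theorem add' [ContinuousAdd N] {φ ψ : M → N} (h : IsCL K φ) (h' : IsCL K ψ) :
    IsCL K (fun x => φ x + ψ x) :=
  ⟨fun _ _ => by simp [h'.add, h.add]; abel, fun _ _ => by simp [h'.smul, h.smul],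
    h.cont.add h'.cont⟩

@[fun_prop] theorem neg' [ContinuousNeg N] {φ : M → N} (h : IsCL K φ) :
    IsCL K (fun x => - φ x) :=
  ⟨fun _ _ => by simp [h.add]; abel, fun _ _ => by simp [h.smul], h.cont.neg⟩

@[fun_prop] theorem sub' [IsTopologicalAddGroup N] {φ ψ : M → N} (h : IsCL K φ) (h' : IsCL K ψ) :
    IsCL K (fun x => φ x - ψ x) :=
  ⟨fun _ _ => by simp [h'.add, h.add]; abel, fun _ _ => by simp [h'.smul, h.smul, smul_sub],
    h.cont.sub h'.cont⟩

@[fun_prop] theorem zsmul' [IsTopologicalAddGroup N] (n : ℤ) {φ : M → N} (h : IsCL K φ) :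
    IsCL K (fun x => n • φ x) :=
  ⟨fun _ _ => by simp [h.add], fun _ _ => by simp [h.smul, smul_comm n], h.cont.zsmul n⟩

@[fun_prop] theorem sum' [ContinuousAdd N] {ι : Type*} (s : Finset ι) {φ : ι → M → N}
    (h : ∀ i, IsCL K (φ i)) : IsCL K (fun x => ∑ i ∈ s, φ i x) :=
  ⟨fun _ _ => by simp [(h _).add, Finset.sum_add_distrib],
    fun _ _ => by simp [(h _).smul, Finset.smul_sum],
    continuous_finsetSum _ fun i _ => (h i).cont⟩

theorem zero {φ : M → N} (h : IsCL K φ) : φ 0 = 0 := by simpa using h.smul 0 0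

theorem neg {φ : M → N} (h : IsCL K φ) (x : M) : φ (-x) = - φ x := by simpa using h.smul (-1) x

theorem sub {φ : M → N} (h : IsCL K φ) (x y : M) : φ (x - y) = φ x - φ y := by
  rw [sub_eq_add_neg, h.add, h.neg, sub_eq_add_neg]

theorem zsmul {φ : M → N} (h : IsCL K φ) (n : ℤ) (x : M) : φ (n • x) = n • φ x := by
  simpa [Int.cast_smul_eq_zsmul] using h.smul (n : K) x

theorem of_pi {Y : Type*} [TopologicalSpace K] {φ : M → Y → K} (h : ∀ y, IsCL K fun x => φ x y) :
    IsCL K φ :=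
  ⟨fun a b => funext fun y => (h y).add a b, fun a b => funext fun y => (h y).smul a b,
    continuous_pi fun y => (h y).cont⟩

theorem linear {φ : M →ₗ[K] N} (h : Continuous φ) : IsCL K φ :=
  ⟨map_add φ, map_smul φ, h⟩

end IsCL

section Words

variable {K X : Type*} [CommRing K] [DecidableEq X]

/-- The monomial attached to a word, or to a pair of words. -/
def mon (K : Type*) [CommRing K] {X : Type*} [DecidableEq X] (x : X) : X → K := Pi.single x 1

theorem mon_apply (x y : X) : mon K x y = if y = x then 1 else 0 := by
  simp [mon, Pi.single_apply]

variable [TopologicalSpace K] [DiscreteTopology K]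

/-- A continuous linear map on series is determined by its values on monomials. -/
theorem IsCL.ext {N : Type*} [AddCommGroup N] [Module K N] [TopologicalSpace N] [T2Space N]
    {φ ψ : (X → K) → N} (hφ : IsCL K φ) (hψ : IsCL K ψ) (h : ∀ x, φ (mon K x) = ψ (mon K x))
    (f : X → K) : φ f = ψ f := by
  have h1 : HasSum (fun x => f x • (mon K x : X → K)) f := by
    refine Pi.hasSum.2 fun y => ?_
    have := hasSum_single (f := fun x => (f x • (mon K x : X → K)) y) y
      (fun x hx => by simp [mon_apply, hx.symm])
    simpa [mon_apply] using this
  have h2 := h1.map (AddMonoidHom.mk' φ hφ.add) hφ.cont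
  have h3 := h1.map (AddMonoidHom.mk' ψ hψ.add) hψ.cont
  have h4 : (φ ∘ fun x => f x • (mon K x : X → K)) = ψ ∘ fun x => f x • (mon K x : X → K) := by
    funext x
    simp [hφ.smul, hψ.smul, h]
  change HasSum (φ ∘ _) (φ f) at h2
  change HasSum (ψ ∘ _) (ψ f) at h3
  rw [h4] at h2
  exact h2.unique h3

/-- Continuity in the form used for vector fields. -/
theorem continuous_of_finite {Y : Type*} (φ : (X → K) →ₗ[K] (Y → K))
    (h : ∀ y, ∃ F : Finset X, ∀ f : X → K, (∀ x ∈ F, f x = 0) → φ f y = 0) : Continuous φ := by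
  refine continuous_pi fun y => ?_
  obtain ⟨F, hF⟩ := h y
  have : (fun f => φ f y) = fun f => ∑ x ∈ F, f x • φ (mon K x) y := by
    funext f
    have := hF (f - ∑ x ∈ F, f x • mon K x) fun x hx => by
      simp [mon_apply, Finset.sum_apply, hx]
    rw [map_sub, Pi.sub_apply, sub_eq_zero] at this
    simpa [map_sum] using this
  rw [this]
  fun_prop

/-- A continuous map of series depends, in each coefficient, on finitely many coefficients. -/
theorem IsCL.exists_finite {Y : Type*} {φ : (X → K) → Y → K} (h : IsCL K φ) (y : Y) :
    ∃ F : Finset X, ∀ f : X → K, (∀ x ∈ F, f x = 0) → φ f y = 0 := by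
  have h1 : IsOpen {f : X → K | φ f y = 0} :=
    (isOpen_discrete ({0} : Set K)).preimage ((continuous_apply y).comp h.cont)
  obtain ⟨F, u, hu, hF⟩ := isOpen_pi_iff.1 h1 0 (by simp [h.zero])
  refine ⟨F, fun f hf => hF fun x hx => ?_⟩
  rw [hf x hx]
  exact (hu x hx).2

end Words

/-! ### Signs -/

theorem sgn_zero : sgn 0 = 1 := by simp [sgn]

theorem sgn_one : sgn 1 = -1 := by simp [sgn]

theorem sgn_add (a b : ℤ) : sgn (a + b) = sgn a * sgn b := by
  simp [sgn, Int.negOnePow_add]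

theorem sgn_neg (a : ℤ) : sgn (-a) = sgn a := by simp [sgn]

theorem sgn_sub (a b : ℤ) : sgn (a - b) = sgn a * sgn b := by
  rw [sub_eq_add_neg, sgn_add, sgn_neg]

theorem sgn_eq_or (a : ℤ) : sgn a = 1 ∨ sgn a = -1 := by
  rcases Int.units_eq_one_or a.negOnePow with h | h <;> simp [sgn, h]

theorem sgn_mul_self (a : ℤ) : sgn a * sgn a = 1 := by
  rcases sgn_eq_or a with h | h <;> simp [h]

theorem sgn_eq_one_iff (a : ℤ) : sgn a = 1 ↔ Even a := by
  rcases Int.even_or_odd a with h | h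
  · simp [sgn, Int.negOnePow_even _ h, h]
  · simp [sgn, Int.negOnePow_odd _ h, Int.not_even_iff_odd.2 h]

theorem sgn_eq_neg_one_iff (a : ℤ) : sgn a = -1 ↔ Odd a := by
  rw [← Int.not_even_iff_odd, ← sgn_eq_one_iff]
  rcases sgn_eq_or a with h | h <;> simp [h]

theorem sgn_congr {a b : ℤ} (h : sgn a = sgn b) (x : ℤ) : sgn (a * x) = sgn (b * x) := by
  have h1 : sgn (a - b) = 1 := by rw [sgn_sub, h, sgn_mul_self]
  have h2 : sgn ((a - b) * x) = 1 := (sgn_eq_one_iff _).2 (((sgn_eq_one_iff _).1 h1).mul_right x)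
  have h3 : a * x = (a - b) * x + b * x := by ring
  rw [h3, sgn_add, h2, one_mul]

theorem sgn_congr' {a b : ℤ} (h : sgn a = sgn b) (x : ℤ) : sgn (x * a) = sgn (x * b) := by
  rw [mul_comm x, mul_comm x, sgn_congr h]

section Degree

variable {I : Type*} (deg : I → ℤ)

theorem wdeg_nil : wdeg deg [] = 0 := rfl

theorem wdeg_cons (a : I) (w : List I) : wdeg deg (a :: w) = wdeg deg [a] + wdeg deg w := by
  simp [wdeg]

theorem wdeg_singleton (a : I) : wdeg deg [a] = 1 - deg a := by simp [wdeg]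

theorem wdeg_append (u v : List I) : wdeg deg (u ++ v) = wdeg deg u + wdeg deg v := by
  simp [wdeg]

end Degree

/-! ### The product of series -/

section Product

variable {K I : Type*} [CommRing K]

theorem cmul_nil (f g : Series K I) : cmul f g [] = f [] * g [] := by simp [cmul]

theorem cmul_cons (f g : Series K I) (a : I) (w : List I) :
    cmul f g (a :: w) = f [] * g (a :: w) + cmul (lquot a f) g w := by
  simp only [cmul, List.length_cons, lquot, LinearMap.coe_mk, AddHom.coe_mk]
  rw [Finset.sum_range_succ' _ (w.length + 1), add_comm]
  simp

variable [TopologicalSpace K] [DiscreteTopology K]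
variable {M : Type*} [TopologicalSpace M]

@[fun_prop] theorem continuous_cmul {f g : M → Series K I} (hf : Continuous f)
    (hg : Continuous g) : Continuous fun x => cmul (f x) (g x) := by
  unfold cmul
  fun_prop

variable [AddCommGroup M] [Module K M]

@[fun_prop] theorem isCL_cmul_left {f : M → Series K I} (hf : IsCL K f) (g : Series K I) :
    IsCL K fun x => cmul (f x) g :=
  ⟨fun x y => by funext w; simp [cmul, hf.add, add_mul, Finset.sum_add_distrib],
    fun c x => by funext w; simp [cmul, hf.smul, Finset.mul_sum, mul_assoc],
    by have := hf.cont; fun_prop⟩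

@[fun_prop] theorem isCL_cmul_right {f : M → Series K I} (hf : IsCL K f) (g : Series K I) :
    IsCL K fun x => cmul g (f x) :=
  ⟨fun x y => by funext w; simp [cmul, hf.add, mul_add, Finset.sum_add_distrib],
    fun c x => by funext w; simp [cmul, hf.smul, Finset.mul_sum, mul_left_comm],
    by have := hf.cont; fun_prop⟩

end Product

section Product

variable {K I : Type*} [CommRing K]

theorem cmul_add (f g h : Series K I) : cmul f (g + h) = cmul f g + cmul f h := by
  funext w; simp [cmul, mul_add, Finset.sum_add_distrib]

theorem add_cmul (f g h : Series K I) : cmul (f + g) h = cmul f h + cmul g h := by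
  funext w; simp [cmul, add_mul, Finset.sum_add_distrib]

theorem zsmul_cmul (n : ℤ) (f g : Series K I) : cmul (n • f) g = n • cmul f g := by
  funext w; simp [cmul, Finset.mul_sum, mul_assoc]

theorem cmul_zsmul (n : ℤ) (f g : Series K I) : cmul f (n • g) = n • cmul f g := by
  funext w; simp [cmul, Finset.mul_sum, mul_left_comm]

theorem zero_cmul (g : Series K I) : cmul 0 g = 0 := by funext w; simp [cmul]

theorem cmul_zero (g : Series K I) : cmul g 0 = 0 := by funext w; simp [cmul]

theorem sub_cmul (f g h : Series K I) : cmul (f - g) h = cmul f h - cmul g h := by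
  funext w; simp [cmul, sub_mul]

theorem cmul_sub (f g h : Series K I) : cmul f (g - h) = cmul f g - cmul f h := by
  funext w; simp [cmul, mul_sub]

variable [DecidableEq I]

theorem var_eq_mon (i : I) : (var i : Series K I) = mon K [i] := rfl

theorem lquot_mon_nil (i : I) : lquot i (mon K ([] : List I)) = 0 := by
  funext w; simp [lquot, mon_apply]

theorem lquot_mon_cons (i a : I) (w : List I) :
    lquot i (mon K (a :: w)) = if i = a then mon K w else 0 := by
  funext v; by_cases h : i = a <;> simp [lquot, mon_apply, h]

theorem mon_nil_cmul (g : Series K I) : cmul (mon K []) g = g := by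
  funext w
  cases w with
  | nil => simp [cmul_nil, mon_apply]
  | cons a w => simp [cmul_cons, mon_apply, lquot_mon_nil, zero_cmul]

theorem cmul_mon (u v : List I) : cmul (mon K u) (mon K v) = mon K (u ++ v) := by
  funext w
  induction u generalizing w with
  | nil => rw [mon_nil_cmul, List.nil_append]
  | cons a u ih =>
    cases w with
    | nil => simp [cmul_nil, mon_apply]
    | cons b w =>
      rw [cmul_cons, lquot_mon_cons]
      by_cases h : b = a
      · subst h
        simp [ih, mon_apply]
      · simp [h, mon_apply, zero_cmul]

theorem cmul_var_cons (i a : I) (g : Series K I) (w : List I) :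
    cmul (var i) g (a :: w) = if a = i then g w else 0 := by
  rw [cmul_cons, var_eq_mon, lquot_mon_cons]
  by_cases h : a = i <;> simp [h, mon_apply, mon_nil_cmul, zero_cmul]

theorem lquot_cmul_var (i a : I) (g : Series K I) :
    lquot a (cmul (var i) g) = if a = i then g else 0 := by
  funext w
  have := cmul_var_cons i a g w
  by_cases h : a = i <;> simpa [lquot, h] using this

variable [TopologicalSpace K] [DiscreteTopology K]

theorem cmul_mon_nil (g : Series K I) : cmul g (mon K []) = g :=
  IsCL.ext (φ := fun g => cmul g (mon K [])) (ψ := fun g => g) (by fun_prop) (by fun_prop)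
    (fun w => by simp [cmul_mon]) g

theorem cmul_assoc (f g h : Series K I) : cmul (cmul f g) h = cmul f (cmul g h) := by
  refine IsCL.ext (φ := fun f => cmul (cmul f g) h) (ψ := fun f => cmul f (cmul g h))
    (by fun_prop) (by fun_prop) (fun u => ?_) f
  refine IsCL.ext (φ := fun g => cmul (cmul (mon K u) g) h)
    (ψ := fun g => cmul (mon K u) (cmul g h)) (by fun_prop) (by fun_prop) (fun v => ?_) g
  refine IsCL.ext (φ := fun h => cmul (cmul (mon K u) (mon K v)) h)
    (ψ := fun h => cmul (mon K u) (cmul (mon K v) h)) (by fun_prop) (by fun_prop) (fun w => ?_) h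
  simp [cmul_mon]

end Product

/-! ### Parity -/

section Parity

variable {K I : Type*} [CommRing K] (deg : I → ℤ)

/-- The series `f` is homogeneous of the parity of `p`. -/
def Par (p : ℤ) (f : Series K I) : Prop := ∀ w, f w ≠ 0 → sgn (wdeg deg w) = sgn p

/-- The `p`-th power of the parity automorphism: multiplication by `(-1)^{p|w|}` on `t_w`. -/
def eps (p : ℤ) (f : Series K I) : Series K I := fun w => sgn (p * wdeg deg w) • f w

variable {deg}

theorem eps_eq_of_par {p q : ℤ} {f : Series K I} (h : Par deg p f) :
    eps deg q f = sgn (q * p) • f := by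
  funext w
  by_cases hw : f w = 0
  · simp [eps, hw]
  · simp [eps, sgn_congr' (h w hw) q]

theorem eps_eps (p q : ℤ) (f : Series K I) : eps deg p (eps deg q f) = eps deg (p + q) f := by
  funext w
  simp [eps, add_mul, sgn_add, mul_assoc]

theorem eps_of_even {p : ℤ} (hp : sgn p = 1) (f : Series K I) : eps deg p f = f := by
  funext w
  have : sgn (p * wdeg deg w) = sgn (0 * wdeg deg w) := sgn_congr (by rw [hp, sgn_zero]) _
  simp [eps, this, sgn_zero]

theorem eps_nil (p : ℤ) (f : Series K I) : eps deg p f [] = f [] := by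
  simp [eps, wdeg_nil, sgn_zero]

variable [DecidableEq I]

theorem eps_mon (p : ℤ) (w : List I) :
    eps deg p (mon K w) = sgn (p * wdeg deg w) • mon K w := by
  funext v
  by_cases h : v = w <;> simp [eps, mon_apply, h]

theorem par_mon (w : List I) : Par deg (wdeg deg w) (mon K w) := by
  intro v hv
  by_cases h : v = w
  · rw [h]
  · simp [mon_apply, h] at hv

theorem par_of_homog [Algebra ℚ K] {𝒦 : ℤ → Submodule ℚ K} [GradedAlgebra 𝒦]
    (heven : ∀ n, Odd n → 𝒦 n = ⊥) {p : ℤ} {f : Series K I} (hf : f ∈ homog 𝒦 deg p) :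
    Par deg p f := by
  intro w hw
  by_contra hc
  have h1 : Odd (p - wdeg deg w) := by
    rw [← sgn_eq_neg_one_iff, sgn_sub]
    rcases sgn_eq_or p with h | h <;> rcases sgn_eq_or (wdeg deg w) with h' | h' <;>
      simp_all
  have h2 := hf w
  rw [heven _ h1] at h2
  exact hw (by simpa using h2)

variable [TopologicalSpace K] [DiscreteTopology K]

/-- A continuous linear map on series of a given parity is determined by its values on the monomials
of that parity. -/
theorem Par.ext {N : Type*} [AddCommGroup N] [Module K N] [TopologicalSpace N] [T2Space N]
    {φ ψ : Series K I → N} (hφ : IsCL K φ) (hψ : IsCL K ψ) {p : ℤ}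
    (h : ∀ w, sgn (wdeg deg w) = sgn p → φ (mon K w) = ψ (mon K w))
    {f : Series K I} (hf : Par deg p f) : φ f = ψ f := by
  classical
  let r : Series K I → Series K I := fun f w => if sgn (wdeg deg w) = sgn p then f w else 0
  have hr : IsCL K r := by
    refine ⟨fun a b => ?_, fun a b => ?_, continuous_pi fun w => ?_⟩
    · funext w; by_cases h : sgn (wdeg deg w) = sgn p <;> simp [r, h]
    · funext w; by_cases h : sgn (wdeg deg w) = sgn p <;> simp [r, h]
    · by_cases h : sgn (wdeg deg w) = sgn p
      · simpa [r, h] using continuous_apply w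
      · simpa [r, h] using continuous_const
  have hrf : r f = f := by
    funext w
    by_cases h : sgn (wdeg deg w) = sgn p
    · simp [r, h]
    · have : f w = 0 := by
        by_contra hc
        exact h (hf w hc)
      simp [r, h, this]
  rw [← hrf]
  refine IsCL.ext (φ := fun f => φ (r f)) (ψ := fun f => ψ (r f)) (by fun_prop) (by fun_prop)
    (fun w => ?_) f
  by_cases hw : sgn (wdeg deg w) = sgn p
  · have : r (mon K w) = mon K w := by
      funext v
      by_cases hv : v = w
      · subst hv; simp [r, hw]
      · simp [r, mon_apply, hv]
    simp only [this, h w hw]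
  · have : r (mon K w) = 0 := by
      funext v
      by_cases hv : v = w
      · subst hv; simp [r, hw]
      · simp [r, mon_apply, hv]
    simp only [this, hφ.zero, hψ.zero]

variable {M : Type*} [TopologicalSpace M] [AddCommGroup M] [Module K M]

@[fun_prop] theorem isCL_eps (p : ℤ) {f : M → Series K I} (hf : IsCL K f) :
    IsCL K fun x => eps deg p (f x) := by
  have h : IsCL K (eps (K := K) deg p) := by
    refine ⟨fun a b => by funext w; simp [eps], fun a b => by
      funext w; simp only [eps, Pi.smul_apply]; exact smul_comm _ _ _, ?_⟩
    unfold eps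
    fun_prop
  fun_prop

theorem eps_cmul (p : ℤ) (f g : Series K I) :
    eps deg p (cmul f g) = cmul (eps deg p f) (eps deg p g) := by
  refine IsCL.ext (φ := fun f => eps deg p (cmul f g))
    (ψ := fun f => cmul (eps deg p f) (eps deg p g)) (by fun_prop) (by fun_prop) (fun u => ?_) f
  refine IsCL.ext (φ := fun g => eps deg p (cmul (mon K u) g))
    (ψ := fun g => cmul (eps deg p (mon K u)) (eps deg p g)) (by fun_prop) (by fun_prop)
    (fun v => ?_) g
  simp [cmul_mon, eps_mon, zsmul_cmul, cmul_zsmul, smul_smul, wdeg_append, mul_add, sgn_add,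
    mul_comm, -zsmul_eq_mul]

end Parity

/-! ### Cyclic permutations and noncommutative one-forms -/

section Cyc

variable {K I : Type*} [CommRing K] [TopologicalSpace K] [DiscreteTopology K] (deg : I → ℤ)
  {M : Type*} [TopologicalSpace M] [AddCommGroup M] [Module K M]

@[fun_prop] theorem isCL_zOp {f : M → Series K I} (hf : IsCL K f) :
    IsCL K fun x => zOp K deg (f x) := by
  have h : IsCL K (zOp K deg : Series K I → Series K I) := by
    refine IsCL.linear (continuous_pi fun w => ?_)
    by_cases h : w = []
    · simpa [zOp, h] using continuous_apply _
    · simp only [zOp, LinearMap.coe_mk, AddHom.coe_mk, h, dite_false]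
      fun_prop
  fun_prop

@[fun_prop] theorem isCL_zOp_pow (k : ℕ) {f : M → Series K I} (hf : IsCL K f) :
    IsCL K fun x => (zOp K deg ^ k) (f x) := by
  induction k with
  | zero => simpa using hf
  | succ k ih =>
    simp only [pow_succ', Module.End.mul_apply]
    fun_prop

@[fun_prop] theorem isCL_normOp {f : M → Series K I} (hf : IsCL K f) :
    IsCL K fun x => normOp K deg (f x) := by
  have h : IsCL K (normOp K deg : Series K I → Series K I) := by
    refine IsCL.linear (continuous_pi fun w => ?_)
    simp only [normOp, LinearMap.coe_mk, AddHom.coe_mk]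
    refine continuous_finsetSum _ fun k _ => ?_
    exact (continuous_apply w).comp (isCL_zOp_pow deg k IsCL.id').cont
  fun_prop

@[fun_prop] theorem isCL_dmul_left {f : M → Series K I} (hf : IsCL K f) (g : Series K I) :
    IsCL K fun x => dmul deg (f x) g := by
  refine ⟨fun x y => ?_, fun c x => ?_, continuous_pi fun w => ?_⟩
  · funext w
    cases w <;> simp [dmul, hf.add, add_mul, mul_add, Finset.sum_add_distrib]
  · funext w
    cases w <;> simp [dmul, hf.smul, Finset.mul_sum, mul_assoc, mul_left_comm]
  · have := hf.cont
    cases w with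
    | nil => simpa [dmul] using continuous_const
    | cons a w => simp only [dmul]; fun_prop

@[fun_prop] theorem isCL_dmul_right {f : M → Series K I} (hf : IsCL K f) (g : Series K I) :
    IsCL K fun x => dmul deg g (f x) := by
  refine ⟨fun x y => ?_, fun c x => ?_, continuous_pi fun w => ?_⟩
  · funext w
    cases w <;> simp [dmul, hf.add, mul_add, Finset.sum_add_distrib]
  · funext w
    cases w <;> simp [dmul, hf.smul, Finset.mul_sum, mul_left_comm]
  · have := hf.cont
    cases w with
    | nil => simpa [dmul] using continuous_const
    | cons a w => simp only [dmul]; fun_prop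

@[fun_prop] theorem isCL_lquot (i : I) {f : M → Series K I} (hf : IsCL K f) :
    IsCL K fun x => lquot i (f x) := by
  have h : IsCL K (lquot i : Series K I → Series K I) := by
    refine IsCL.linear (continuous_pi fun w => ?_)
    simp only [lquot, LinearMap.coe_mk, AddHom.coe_mk]
    fun_prop
  fun_prop

theorem isCL_eval {X : Type*} (y : X) {f : M → X → K} (hf : IsCL K f) :
    IsCL K fun x => f x y :=
  ⟨fun _ _ => by simp [hf.add], fun _ _ => by simp [hf.smul],
    (continuous_apply y).comp hf.cont⟩

variable [DecidableEq I]

theorem cmul_var_nil (g : Series K I) (a : I) : cmul g (var a) [] = 0 := by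
  simp [cmul_nil, var]

theorem cmul_var_concat (g : Series K I) (a b : I) (v : List I) :
    cmul g (var a) (v ++ [b]) = if b = a then g v else 0 := by
  refine IsCL.ext (φ := fun g => cmul g (var a) (v ++ [b]))
    (ψ := fun g => if b = a then g v else 0) (isCL_eval _ (by fun_prop)) ?_ (fun w => ?_) g
  · by_cases h : b = a
    · simpa only [h, if_true] using isCL_eval v IsCL.id'
    · simp only [h, if_false]; fun_prop
  · have h1 : v ++ [b] = w ++ [a] ↔ b = a ∧ v = w :=
      ⟨fun h => by
        obtain ⟨h2, h3⟩ := List.append_inj' h rfl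
        exact ⟨by simpa using h3, h2⟩, fun h => by rw [h.1, h.2]⟩
    by_cases h : b = a <;> simp [var_eq_mon, cmul_mon, mon_apply, h1, h]

/-- The Leibniz rule `d(t_a u) · y = dt_a · u y ± du · y t_a` of one-forms modulo commutators. -/
theorem dmul_var_cmul (a : I) (u y : Series K I) :
    dmul deg (cmul (var a) u) y = cmul (var a) (cmul u y) +
      dmul deg (eps deg (wdeg deg [a]) u) (cmul (eps deg (wdeg deg [a]) y) (var a)) := by
  funext w
  cases w with
  | nil => simp [dmul, cmul_nil, var]
  | cons c w =>
    rw [Pi.add_apply, cmul_var_cons]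
    have h1 : (if c = a then cmul u y w else 0) = ∑ k ∈ Finset.range (w.length + 1),
        if c = a then u (w.take k) * y (w.drop k) else 0 := by
      by_cases h : c = a <;> simp [h, cmul]
    rw [h1]
    simp only [dmul, ← Finset.sum_add_distrib]
    refine Finset.sum_congr rfl fun k hk => ?_
    have hlen : w.length - k = (w.drop k).length := by simp
    rw [hlen]
    generalize w.drop k = w'
    generalize w.take k = r
    rw [Finset.sum_range_succ, Finset.sum_range_succ', List.drop_length, List.take_length]
    simp only [List.take_zero, cmul_var_nil, mul_zero, smul_zero, add_zero, wdeg_nil, zero_mul,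
      sgn_zero, one_smul, List.nil_append, cmul_var_cons]
    rw [add_comm]
    congr 1
    · by_cases h : c = a <;> simp [h]
    · refine Finset.sum_congr rfl fun l hl => ?_
      have hl' : l < w'.length := Finset.mem_range.1 hl
      rw [List.drop_eq_getElem_cons hl', ← List.take_append_getElem hl', cmul_var_concat,
        List.cons_append, cmul_var_cons]
      by_cases h : w'[l] = a
      · rw [h, wdeg_cons deg a (w'.drop (l + 1))]
        simp only [if_true, eps, wdeg_append, mul_add, add_mul, sgn_add]
        rw [mul_comm (wdeg deg (List.drop (l + 1) w')) (wdeg deg [a])]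
        rcases sgn_eq_or (wdeg deg [a] * wdeg deg (List.drop (l+1) w')) with h1 | h1 <;>
        rcases sgn_eq_or (wdeg deg [a] * wdeg deg (c :: r)) with h2 | h2 <;>
        rcases sgn_eq_or (wdeg deg [a] * wdeg deg (List.take l w')) with h4 | h4 <;>
        simp [h1, h2, h4]
      · simp [h]

theorem dmul_mon_nil (y : Series K I) : dmul deg (mon K []) y = 0 := by
  funext w
  cases w <;> simp [dmul, mon_apply]

theorem dmul_var (a : I) (y : Series K I) : dmul deg (var a) y = cmul (var a) y := by
  have h := dmul_var_cmul deg a (mon K []) y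
  rw [cmul_mon_nil, mon_nil_cmul, eps_mon] at h
  rw [h, wdeg_nil]
  simp [sgn_zero, dmul_mon_nil]

theorem dmul_zsmul_left (n : ℤ) (u y : Series K I) : dmul deg (n • u) y = n • dmul deg u y :=
  (isCL_dmul_left (K := K) deg IsCL.id' y).zsmul n u

theorem dmul_zsmul_right (n : ℤ) (u y : Series K I) : dmul deg u (n • y) = n • dmul deg u y :=
  (isCL_dmul_right (K := K) deg IsCL.id' u).zsmul n y

theorem dmul_mon_cons (a : I) (u y : List I) :
    dmul deg (mon K (a :: u)) (mon K y) = mon K (a :: (u ++ y)) +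
      sgn (wdeg deg [a] * (wdeg deg u + wdeg deg y)) •
        dmul deg (mon K u) (mon K (y ++ [a])) := by
  have h := dmul_var_cmul deg a (mon K u) (mon K y)
  rw [var_eq_mon, cmul_mon, cmul_mon, cmul_mon, eps_mon, eps_mon, zsmul_cmul, cmul_mon,
    dmul_zsmul_left, dmul_zsmul_right, smul_smul, ← sgn_add, ← mul_add] at h
  simpa using h

theorem zOp_mon_nil : zOp K deg (mon K ([] : List I)) = mon K [] := by
  funext w
  by_cases h : w = [] <;> simp [zOp, h, mon_apply]

theorem zOp_mon_cons (a : I) (u : List I) : zOp K deg (mon K (a :: u)) =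
    sgn (wdeg deg [a] * wdeg deg u) • mon K (u ++ [a]) := by
  funext w
  rcases List.eq_nil_or_concat w with rfl | ⟨v, b, rfl⟩
  · simp [zOp, mon_apply]
  · by_cases h : b = a ∧ v = u
    · obtain ⟨rfl, rfl⟩ := h
      simp [zOp, mon_apply, wdeg_singleton]
    · have h1 : ¬ (v ++ [b] = u ++ [a]) := by
        intro hc
        obtain ⟨h2, h3⟩ := List.append_inj' hc rfl
        exact h ⟨by simpa using h3, h2⟩
      simp [zOp, mon_apply, h, h1]

theorem zOp_pow_mon_append (u v : List I) : (zOp K deg ^ u.length) (mon K (u ++ v)) =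
    sgn (wdeg deg u * wdeg deg v) • mon K (v ++ u) := by
  induction u generalizing v with
  | nil => simp [wdeg_nil, sgn_zero]
  | cons a u ih =>
    rw [List.length_cons, pow_succ, Module.End.mul_apply, List.cons_append, zOp_mon_cons,
      map_zsmul, List.append_assoc, ih, smul_smul, ← sgn_add, List.append_assoc]
    congr 1
    rw [wdeg_append, wdeg_append, wdeg_cons deg a u]
    rw [show wdeg deg [a] * (wdeg deg u + wdeg deg v) + wdeg deg u * (wdeg deg v + wdeg deg [a])
      = (wdeg deg [a] + wdeg deg u) * wdeg deg v + 2 * (wdeg deg [a] * wdeg deg u) by ring, sgn_add,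
      (sgn_eq_one_iff (2 * _)).2 (even_two_mul _), mul_one]

theorem dmul_mon (u y : List I) : dmul deg (mon K u) (mon K y) =
    ∑ k ∈ Finset.range u.length, (zOp K deg ^ k) (mon K (u ++ y)) := by
  induction u generalizing y with
  | nil => simp [dmul_mon_nil]
  | cons a u ih =>
    rw [dmul_mon_cons, ih, List.length_cons, Finset.sum_range_succ', add_comm, Finset.smul_sum]
    congr 1
    refine Finset.sum_congr rfl fun k _ => ?_
    rw [pow_succ, Module.End.mul_apply, List.cons_append, zOp_mon_cons, map_zsmul, wdeg_append,
      List.append_assoc]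

/-- Every power of `z` maps a word to a word of the same length, up to sign. -/
theorem exists_zOp_pow_mon (k : ℕ) (u : List I) : ∃ (n : ℤ) (v : List I),
    v.length = u.length ∧ (zOp K deg ^ k) (mon K u) = sgn n • mon K v := by
  induction k with
  | zero => exact ⟨0, u, rfl, by simp [sgn_zero]⟩
  | succ k ih =>
    obtain ⟨n, v, hv, h⟩ := ih
    rw [pow_succ', Module.End.mul_apply, h, map_zsmul]
    cases v with
    | nil => exact ⟨n, [], hv, by rw [zOp_mon_nil]⟩
    | cons a v =>
      refine ⟨n + wdeg deg [a] * wdeg deg v, v ++ [a], by simpa using hv, ?_⟩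
      rw [zOp_mon_cons, smul_smul, sgn_add]

theorem normOp_mon (u : List I) : normOp K deg (mon K u) =
    ∑ k ∈ Finset.range u.length, (zOp K deg ^ k) (mon K u) := by
  funext w
  simp only [normOp, LinearMap.coe_mk, AddHom.coe_mk, Finset.sum_apply]
  by_cases hw : w.length = u.length
  · rw [hw]
  · have h : ∀ k, (zOp K deg ^ k) (mon K u) w = 0 := by
      intro k
      obtain ⟨n, v, hv, h⟩ := exists_zOp_pow_mon (K := K) deg k u
      rw [h]
      have : w ≠ v := by rintro rfl; exact hw hv
      simp [mon_apply, this]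
    simp [h]

/-- The norm operator is the de Rham differential from zero-forms to one-forms. -/
theorem normOp_eq_dmul (f : Series K I) : normOp K deg f = dmul deg f (mon K []) :=
  IsCL.ext (φ := fun f => normOp K deg f) (ψ := fun f => dmul deg f (mon K [])) (by fun_prop)
    (by fun_prop) (fun u => by rw [normOp_mon, dmul_mon, List.append_nil]) f

/-- The supercommutator `[f, g]` of a series `f` of parity `p` with any series `g`. -/
def br (p : ℤ) (f g : Series K I) : Series K I := cmul f g - cmul (eps deg p g) f

@[fun_prop] theorem isCL_br_left (p : ℤ) {f : M → Series K I} (hf : IsCL K f) (g : Series K I) :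
    IsCL K fun x => br deg p (f x) g := by
  unfold br; fun_prop

@[fun_prop] theorem isCL_br_right (p : ℤ) {f : M → Series K I} (hf : IsCL K f) (g : Series K I) :
    IsCL K fun x => br deg p g (f x) := by
  unfold br; fun_prop

theorem br_eq_bracket {p q : ℤ} {f g : Series K I} (hg : Par deg q g) :
    br deg p f g = bracket p q f g := by
  rw [br, bracket, eps_eq_of_par hg, zsmul_cmul]

/-- `1 - z` corresponds under `Θ` to the map `du · y ↦ [u, y]` from one-forms to series. -/
theorem dmul_sub_zOp_dmul {p : ℤ} {u : Series K I} (hu : Par deg p u) (y : Series K I) :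
    dmul deg u y - zOp K deg (dmul deg u y) = br deg p u y := by
  refine Par.ext (φ := fun u => dmul deg u y - zOp K deg (dmul deg u y))
    (ψ := fun u => br deg p u y) (by fun_prop) (by fun_prop) (fun u hu => ?_) hu
  refine IsCL.ext (φ := fun y => dmul deg (mon K u) y - zOp K deg (dmul deg (mon K u) y))
    (ψ := fun y => br deg p (mon K u) y) (by fun_prop) (by fun_prop) (fun y => ?_) y
  have h := Finset.sum_range_succ' (fun k => (zOp K deg ^ k) (mon K (u ++ y))) u.length
  rw [Finset.sum_range_succ, zOp_pow_mon_append] at h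
  simp only [dmul_mon, map_sum, br, eps_mon, zsmul_cmul, cmul_mon, ← Module.End.mul_apply,
    ← pow_succ']
  rw [sgn_congr hu.symm, sub_eq_sub_iff_add_eq_add, h, add_comm]
  simp

/-- The Leibniz rule `d(u v) · y = du · v y + (-1)^{|u| (|v| + |y|)} dv · y u`. -/
theorem dmul_cmul {p : ℤ} {u : Series K I} (hu : Par deg p u) (v y : Series K I) :
    dmul deg (cmul u v) y = dmul deg u (cmul v y) +
      dmul deg (eps deg p v) (cmul (eps deg p y) u) := by
  refine Par.ext (φ := fun u => dmul deg (cmul u v) y) (ψ := fun u => dmul deg u (cmul v y) +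
      dmul deg (eps deg p v) (cmul (eps deg p y) u)) (by fun_prop) (by fun_prop) (fun u hu => ?_) hu
  refine IsCL.ext (φ := fun v => dmul deg (cmul (mon K u) v) y)
    (ψ := fun v => dmul deg (mon K u) (cmul v y) +
      dmul deg (eps deg p v) (cmul (eps deg p y) (mon K u))) (by fun_prop) (by fun_prop)
      (fun v => ?_) v
  refine IsCL.ext (φ := fun y => dmul deg (cmul (mon K u) (mon K v)) y)
    (ψ := fun y => dmul deg (mon K u) (cmul (mon K v) y) +
      dmul deg (eps deg p (mon K v)) (cmul (eps deg p y) (mon K u))) (by fun_prop) (by fun_prop)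
      (fun y => ?_) y
  simp only [eps_mon, zsmul_cmul, cmul_mon, dmul_zsmul_left, dmul_zsmul_right, dmul_mon,
    List.length_append, Finset.sum_range_add, smul_smul, sgn_congr hu.symm]
  rw [List.append_assoc]
  congr 1
  rw [Finset.smul_sum]
  refine Finset.sum_congr rfl fun k _ => ?_
  rw [add_comm u.length, pow_add, Module.End.mul_apply, zOp_pow_mon_append, map_zsmul,
    wdeg_append, mul_add, sgn_add, List.append_assoc,
    mul_comm (sgn (wdeg deg u * wdeg deg v))]

/-- Since every monomial is either `1` or of the form `Θ⁻¹(dt_a · t_w)`, a continuous linear map on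
series is determined by its values on these. -/
theorem ext_dmul_var {deg : I → ℤ} {N : Type*} [AddCommGroup N] [Module K N]
    [TopologicalSpace N] [T2Space N]
    {φ ψ : Series K I → N} (hφ : IsCL K φ) (hψ : IsCL K ψ) (h0 : φ (mon K []) = ψ (mon K []))
    (h : ∀ a w, φ (dmul deg (var a) (mon K w)) = ψ (dmul deg (var a) (mon K w)))
    (f : Series K I) : φ f = ψ f := by
  refine hφ.ext hψ (fun w => ?_) f
  cases w with
  | nil => exact h0
  | cons a w =>
    have := h a w
    rwa [dmul_var, var_eq_mon, cmul_mon] at this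

end Cyc

/-! ### The vector field and the Hochschild differential -/

section VectorField

variable {K I : Type*} [CommRing K] [Algebra ℚ K] {𝒦 : ℤ → Submodule ℚ K} [GradedAlgebra 𝒦]
  {deg : I → ℤ} [DecidableEq I]

theorem mon_mem_homog (w : List I) : (mon K w : Series K I) ∈ homog 𝒦 deg (wdeg deg w) := by
  intro v
  by_cases h : v = w
  · subst h
    simpa [mon_apply] using SetLike.GradedOne.one_mem (A := 𝒦)
  · simp [mon_apply, h]

namespace AInfStructure

variable (A : AInfStructure 𝒦 deg)

theorem m_mon_nil : A.m (mon K []) = 0 := by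
  have h := A.leibniz 0 0 (mon K []) (mon_mem_homog (𝒦 := 𝒦) (deg := deg) [])
    (mon K []) (mon_mem_homog (𝒦 := 𝒦) (deg := deg) [])
  rw [mon_nil_cmul, mon_nil_cmul, sgn_zero, one_smul] at h
  have h' : cmul (A.m (mon K [])) (mon K []) = A.m (mon K []) := by
    let _ : TopologicalSpace K := ⊥
    have : DiscreteTopology K := ⟨rfl⟩
    exact cmul_mon_nil _
  rw [h'] at h
  simpa using h

theorem par_m_mon (heven : ∀ n, Odd n → 𝒦 n = ⊥) (w : List I) :
    Par deg (wdeg deg w + 1) (A.m (mon K w)) :=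
  par_of_homog heven (A.degree_one _ _ (mon_mem_homog w))

theorem m_zsmul (n : ℤ) (f : Series K I) : A.m (n • f) = n • A.m f := map_zsmul _ _ _

variable [TopologicalSpace K] [DiscreteTopology K]
  {M : Type*} [TopologicalSpace M] [AddCommGroup M] [Module K M]

@[fun_prop] theorem isCL_m {f : M → Series K I} (hf : IsCL K f) : IsCL K fun x => A.m (f x) := by
  have h : IsCL K (A.m : Series K I → Series K I) :=
    IsCL.linear (continuous_of_finite _ A.continuous)
  fun_prop

/-- The Leibniz rule, for series which need not be homogeneous. -/
theorem m_cmul (f g : Series K I) :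
    A.m (cmul f g) = cmul (A.m f) g + cmul (eps deg 1 f) (A.m g) := by
  refine IsCL.ext (φ := fun f => A.m (cmul f g))
    (ψ := fun f => cmul (A.m f) g + cmul (eps deg 1 f) (A.m g)) (by fun_prop) (by fun_prop)
    (fun u => ?_) f
  refine IsCL.ext (φ := fun g => A.m (cmul (mon K u) g))
    (ψ := fun g => cmul (A.m (mon K u)) g + cmul (eps deg 1 (mon K u)) (A.m g)) (by fun_prop)
    (by fun_prop) (fun v => ?_) g
  simp only [eps_mon, one_mul, zsmul_cmul]
  exact A.leibniz _ _ _ (mon_mem_homog u) _ (mon_mem_homog v)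

/-- `m` preserves the series without constant term, since it vanishes at zero. -/
theorem m_apply_nil {f : Series K I} (hf : f [] = 0) : A.m f [] = 0 := by
  have h : A.m f [] = A.m (f [] • mon K []) [] := by
    refine IsCL.ext (φ := fun f => A.m f []) (ψ := fun f => A.m (f [] • mon K []) [])
      (isCL_eval _ (by fun_prop)) ?_ (fun w => ?_) f
    · refine isCL_eval _ (isCL_m A ⟨fun a b => by simp [add_smul], fun a b => by simp [mul_smul],
        by fun_prop⟩)
    · cases w with
      | nil => simp [mon_apply]
      | cons a w =>
        rw [show mon K (a :: w) = cmul (var a) (mon K w) by rw [var_eq_mon, cmul_mon]; rfl, m_cmul,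
          Pi.add_apply, cmul_nil, cmul_nil, A.vanishes, eps_nil]
        simp [var, cmul_nil]
  rw [h, hf]
  simp

variable (heven : ∀ n, Odd n → 𝒦 n = ⊥)

include heven

theorem eps_m (p : ℤ) (f : Series K I) : eps deg p (A.m f) = sgn p • A.m (eps deg p f) := by
  refine IsCL.ext (φ := fun f => eps deg p (A.m f)) (ψ := fun f => sgn p • A.m (eps deg p f))
    (by fun_prop) (by fun_prop) (fun u => ?_) f
  simp only [eps_mon, m_zsmul, smul_smul, eps_eq_of_par (A.par_m_mon heven u)]
  rw [mul_add, sgn_add, mul_one, mul_comm]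

end AInfStructure

end VectorField

section Hochschild

variable {K I : Type*} [CommRing K] [Algebra ℚ K] {𝒦 : ℤ → Submodule ℚ K} [GradedAlgebra 𝒦]
  {deg : I → ℤ} [DecidableEq I] [TopologicalSpace K] [DiscreteTopology K]
  {M : Type*} [TopologicalSpace M] [AddCommGroup M] [Module K M] (A : AInfStructure 𝒦 deg)

namespace AInfStructure

theorem b_nil (f : Series K I) : A.b f [] = 0 := rfl

theorem b_cons (f : Series K I) (a : I) (w : List I) :
    A.b f (a :: w) = -(∑ᶠ i, dmul deg (A.m (var i)) (lquot i f) (a :: w))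
        - sgn (1 - deg a) • A.m (lquot a f) w := rfl

/-- In a given coefficient of `b f` only finitely many variables contribute, uniformly in `f`. -/
theorem exists_b_support (a : I) (w : List I) : ∃ S : Finset I, ∀ f : I → Series K I,
    (Function.support fun i => dmul deg (A.m (var i)) (f i) (a :: w)) ⊆ S := by
  have hfin := Set.Finite.biUnion (Finset.finite_toSet
      (Finset.range (w.length + 1))) fun k _ => Set.Finite.biUnion (Finset.finite_toSet
      (Finset.range (w.length - k + 1))) fun l _ =>
        A.finite_coeff ((w.drop k).drop l ++ a :: w.take k)
  refine ⟨hfin.toFinset, fun f i hi => ?_⟩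
  rw [Set.Finite.coe_toFinset]
  obtain ⟨k, hk, h⟩ := Finset.exists_ne_zero_of_sum_ne_zero hi
  obtain ⟨l, hl, h⟩ := Finset.exists_ne_zero_of_sum_ne_zero h
  refine Set.mem_biUnion hk (Set.mem_biUnion hl ?_)
  intro h0
  exact h (by simp only [h0, zero_mul, smul_zero])

@[fun_prop] theorem isCL_b {f : M → Series K I} (hf : IsCL K f) : IsCL K fun x => A.b (f x) := by
  have h : IsCL K (A.b : Series K I → Series K I) := by
    refine IsCL.of_pi fun w => ?_
    cases w with
    | nil => simp only [b_nil]; fun_prop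
    | cons a w =>
      obtain ⟨S, hS⟩ := A.exists_b_support a w
      simp only [b_cons]
      have : ∀ f : Series K I, (∑ᶠ i, dmul deg (A.m (var i)) (lquot i f) (a :: w)) =
          ∑ i ∈ S, dmul deg (A.m (var i)) (lquot i f) (a :: w) := fun f =>
        finsum_eq_sum_of_support_subset _ (hS fun i => lquot i f)
      simp only [this]
      refine IsCL.sub' (IsCL.neg' (IsCL.sum' _ fun i => isCL_eval _ (by fun_prop)))
        (IsCL.zsmul' _ (isCL_eval _ (by fun_prop)))
  fun_prop

theorem b_mon_nil : A.b (mon K []) = 0 := by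
  funext w
  cases w with
  | nil => rfl
  | cons a w =>
    rw [b_cons]
    simp only [lquot_mon_nil, map_zero]
    have : ∀ i, dmul deg (A.m (var i)) 0 (a :: w) = 0 := fun i => by simp [dmul]
    simp [this]

theorem b_cmul_var (i : I) (y : Series K I) : A.b (cmul (var i) y) =
    -dmul deg (A.m (var i)) y - sgn (wdeg deg [i]) • cmul (var i) (A.m y) := by
  funext w
  cases w with
  | nil => simp [b_nil, dmul, cmul_nil, var]
  | cons a w =>
    rw [b_cons, finsum_eq_single _ i]
    · rw [lquot_cmul_var, lquot_cmul_var, if_pos rfl, Pi.sub_apply, Pi.neg_apply, Pi.smul_apply,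
        cmul_var_cons]
      by_cases h : a = i
      · subst h; simp [wdeg_singleton]
      · simp [h]
    · intro j hj
      rw [lquot_cmul_var, if_neg hj]
      simp [dmul]

variable (heven : ∀ n, Odd n → 𝒦 n = ⊥)

include heven

/-- `L_m (du · y) = - dm(u) · y - (-1)^{|u|} du · m(y)` for every series `u`. -/
theorem b_dmul (u y : Series K I) :
    A.b (dmul deg u y) = -dmul deg (A.m u) y - dmul deg (eps deg 1 u) (A.m y) := by
  refine IsCL.ext (φ := fun u => A.b (dmul deg u y))
    (ψ := fun u => -dmul deg (A.m u) y - dmul deg (eps deg 1 u) (A.m y)) (by fun_prop)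
    (by fun_prop) (fun u => ?_) u
  induction u generalizing y with
  | nil =>
    have h0 : ∀ z : Series K I, dmul deg 0 z = 0 := fun z =>
      (isCL_dmul_left (K := K) deg IsCL.id' z).zero
    simp [dmul_mon_nil, m_mon_nil, eps_mon, wdeg_nil, sgn_zero, h0]
  | cons a u ih =>
    have hua : (mon K (a :: u) : Series K I) = cmul (var a) (mon K u) := by
      rw [var_eq_mon, cmul_mon]; rfl
    have hpa : Par deg (wdeg deg [a]) (var a : Series K I) := par_mon [a]
    have hma : Par deg (wdeg deg [a] + 1) (A.m (var a)) := A.par_m_mon heven [a]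
    have haddl : ∀ x y z : Series K I, dmul deg (x + y) z = dmul deg x z + dmul deg y z :=
      fun x y z => (isCL_dmul_left (K := K) deg IsCL.id' z).add x y
    have haddr : ∀ x y z : Series K I, dmul deg x (y + z) = dmul deg x y + dmul deg x z :=
      fun x y z => (isCL_dmul_right (K := K) deg IsCL.id' x).add y z
    generalize hp : wdeg deg [a] = p at hpa hma
    -- both sides are expanded by the Leibniz rules for `d` and `m`; the formula for `du` is applied
    -- to `u · y t_a`, and the formula for `dt_a` holds by the definition of `b`
    have e1 : dmul deg (mon K (a :: u)) y = cmul (var a) (cmul (mon K u) y) +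
        sgn (p * wdeg deg u) • dmul deg (mon K u) (cmul (eps deg p y) (var a)) := by
      rw [hua, dmul_cmul deg hpa, dmul_var, eps_mon, dmul_zsmul_left]
    have e2 : A.m (mon K (a :: u)) = cmul (A.m (var a)) (mon K u) +
        sgn p • cmul (var a) (A.m (mon K u)) := by
      rw [hua, m_cmul, var_eq_mon, eps_mon, zsmul_cmul, hp, one_mul]
    have e3 : eps deg 1 (mon K (a :: u)) = (sgn p * sgn (wdeg deg u)) •
        cmul (var a) (mon K u) := by
      rw [eps_mon, hua, one_mul, wdeg_cons, hp, sgn_add]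
    have e4 : dmul deg (cmul (A.m (var a)) (mon K u)) y =
        dmul deg (A.m (var a)) (cmul (mon K u) y) + (sgn (p * wdeg deg u) * sgn (wdeg deg u)) •
          dmul deg (mon K u) (cmul (eps deg (p + 1) y) (A.m (var a))) := by
      rw [dmul_cmul deg hma, eps_mon, dmul_zsmul_left, add_mul, one_mul, sgn_add]
    have e5 : dmul deg (cmul (var a) (A.m (mon K u))) y = cmul (var a) (cmul (A.m (mon K u)) y) +
        (sgn p * sgn (p * wdeg deg u)) •
          dmul deg (A.m (mon K u)) (cmul (eps deg p y) (var a)) := by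
      rw [dmul_cmul deg hpa, dmul_var, eps_m A heven, eps_mon, m_zsmul, smul_smul, dmul_zsmul_left]
    have e6 : dmul deg (cmul (var a) (mon K u)) (A.m y) =
        cmul (var a) (cmul (mon K u) (A.m y)) + (sgn (p * wdeg deg u) * sgn p) •
          dmul deg (mon K u) (cmul (A.m (eps deg p y)) (var a)) := by
      rw [dmul_cmul deg hpa, dmul_var, eps_mon, eps_m A heven, zsmul_cmul, dmul_zsmul_left,
        dmul_zsmul_right, smul_smul]
    rw [e1, e2, e3, haddl, e4, dmul_zsmul_left, e5, dmul_zsmul_left, e6, map_add, map_zsmul, ih,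
      b_cmul_var, m_cmul, m_cmul, eps_mon, eps_eps, one_mul, haddr, hp, zsmul_cmul, cmul_add,
      cmul_zsmul, dmul_zsmul_left, dmul_zsmul_left, add_comm 1 p]
    rcases sgn_eq_or p with h1 | h1 <;> rcases sgn_eq_or (wdeg deg u) with h2 | h2 <;>
      rcases sgn_eq_or (p * wdeg deg u) with h3 | h3 <;>
      simp only [h1, h2, h3, one_smul, neg_smul, mul_one, mul_neg, neg_neg, smul_add, neg_add_rev] <;>
      abel

theorem b_normOp (f : Series K I) : A.b (normOp K deg f) = -normOp K deg (A.m f) := by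
  rw [normOp_eq_dmul, normOp_eq_dmul, b_dmul A heven, m_mon_nil,
    (isCL_dmul_right (K := K) deg IsCL.id' _).zero, sub_zero]

/-- `b² = 0`, since `L_m` maps `dt_a · t_w` to terms in which `m` is applied to each factor. -/
theorem b_b (f : Series K I) : A.b (A.b f) = 0 := by
  refine ext_dmul_var (deg := deg) (φ := fun f => A.b (A.b f)) (ψ := fun _ => 0)
    (by fun_prop) (by fun_prop) ?_ (fun a w => ?_) f
  · simp [b_mon_nil]
  · simp only [b_dmul A heven, map_sub, map_neg, A.sq_zero, eps_m A heven, eps_eps, dmul_zsmul_left]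
    have h0 : ∀ z : Series K I, dmul deg 0 z = 0 := fun z =>
      (isCL_dmul_left (K := K) deg IsCL.id' z).zero
    have h0' : ∀ z : Series K I, dmul deg z 0 = 0 := fun z =>
      (isCL_dmul_right (K := K) deg IsCL.id' z).zero
    simp [h0, h0', sgn_one]

theorem b_sub_zOp (f : Series K I) :
    A.b f - zOp K deg (A.b f) = -A.m (f - zOp K deg f) := by
  refine ext_dmul_var (deg := deg) (φ := fun f => A.b f - zOp K deg (A.b f))
    (ψ := fun f => -A.m (f - zOp K deg f))
    (by fun_prop) (by fun_prop) ?_ (fun a w => ?_) f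
  · simp [b_mon_nil, zOp_mon_nil]
  · have hpa : Par deg (wdeg deg [a]) (var a : Series K I) := par_mon [a]
    have hma : Par deg (wdeg deg [a] + 1) (A.m (var a)) := A.par_m_mon heven [a]
    have e1 := dmul_sub_zOp_dmul deg hma (mon K w)
    have e2 := dmul_sub_zOp_dmul deg hpa (A.m (mon K w))
    simp only [dmul_sub_zOp_dmul deg hpa, b_dmul A heven, map_sub, map_neg]
    have e3 : eps deg 1 (var a : Series K I) = sgn (wdeg deg [a]) • var a := by
      rw [var_eq_mon, eps_mon, one_mul]
    rw [e3, dmul_zsmul_left, map_zsmul]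
    rw [sub_eq_iff_eq_add', ← sub_eq_iff_eq_add] at e1 e2
    rw [← e1, ← e2]
    have e4 : eps deg 1 (eps deg (wdeg deg [a]) (mon K w : Series K I)) =
        eps deg (wdeg deg [a] + 1) (mon K w) := by rw [eps_eps, add_comm]
    simp only [br, map_sub, m_cmul, e3, zsmul_cmul, e4, eps_m A heven, smul_sub]
    rw [smul_smul, sgn_mul_self, one_smul]
    abel

end AInfStructure
end Hochschild

/-! ### Exactness of the rows of the Tsygan bicomplex -/

section Rows

variable {K I : Type*} [CommRing K] [TopologicalSpace K] [DiscreteTopology K] (deg : I → ℤ)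
  [DecidableEq I]

theorem normOp_zOp (f : Series K I) : normOp K deg (zOp K deg f) = normOp K deg f := by
  refine IsCL.ext (φ := fun f => normOp K deg (zOp K deg f)) (ψ := fun f => normOp K deg f)
    (by fun_prop) (by fun_prop) (fun u => ?_) f
  cases u with
  | nil => simp only [zOp_mon_nil]
  | cons a u =>
    have h1 : normOp K deg (zOp K deg (mon K (a :: u))) = ∑ k ∈ Finset.range (a :: u).length,
        (zOp K deg ^ (k + 1)) (mon K (a :: u)) := by
      simp only [pow_succ, Module.End.mul_apply, zOp_mon_cons, map_zsmul, normOp_mon,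
        List.length_append, List.length_cons, List.length_nil, Finset.smul_sum, zero_add]
    have h2 := zOp_pow_mon_append (K := K) deg (a :: u) []
    rw [List.append_nil, List.nil_append, wdeg_nil, mul_zero, sgn_zero, one_smul] at h2
    have h3 := Finset.sum_range_succ' (fun k => (zOp K deg ^ k) (mon K (a :: u))) (a :: u).length
    rw [Finset.sum_range_succ, h2] at h3
    simp only [h1, normOp_mon]
    simpa using h3.symm

theorem zOp_normOp (f : Series K I) : zOp K deg (normOp K deg f) = normOp K deg f := by
  refine IsCL.ext (φ := fun f => zOp K deg (normOp K deg f)) (ψ := fun f => normOp K deg f)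
    (by fun_prop) (by fun_prop) (fun u => ?_) f
  have h := dmul_sub_zOp_dmul deg (par_mon (deg := deg) u) (mon K [])
  rw [← normOp_eq_dmul, br, eps_mon, wdeg_nil, mul_zero, sgn_zero, one_smul, cmul_mon, cmul_mon,
    List.append_nil, List.nil_append, sub_self, sub_eq_zero] at h
  exact h.symm

variable [Algebra ℚ K]

/-- Division of the coefficient of each word by its length. -/
def divLength (f : Series K I) : Series K I := fun w => (w.length : ℚ)⁻¹ • f w

/-- The contracting homotopy for the rows of the Tsygan bicomplex: on words of length `n` it is
`n⁻¹ ∑_{l < k < n} z^l`, so that `1 = n⁻¹ N + (1 - z) h`. -/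
def rowHtpy (f : Series K I) : Series K I := fun w =>
  (w.length : ℚ)⁻¹ • ∑ k ∈ Finset.range w.length, ∑ l ∈ Finset.range k, (zOp K deg ^ l) f w

variable {M : Type*} [TopologicalSpace M] [AddCommGroup M] [Module K M]

theorem isCL_qsmul (c : ℚ) {f : M → K} (hf : IsCL K f) : IsCL K fun x => c • f x := by
  refine ⟨fun a b => by rw [hf.add, smul_add], fun a b => by rw [hf.smul, smul_comm],
    (continuous_of_discreteTopology (f := fun y : K => c • y)).comp hf.cont⟩

@[fun_prop] theorem isCL_divLength {f : M → Series K I} (hf : IsCL K f) :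
    IsCL K fun x => divLength (f x) :=
  IsCL.of_pi fun w => isCL_qsmul _ (isCL_eval w hf)

@[fun_prop] theorem isCL_rowHtpy {f : M → Series K I} (hf : IsCL K f) :
    IsCL K fun x => rowHtpy deg (f x) :=
  IsCL.of_pi fun w => isCL_qsmul _ (IsCL.sum' _ fun k => IsCL.sum' _ fun l =>
    isCL_eval w (by fun_prop))

theorem divLength_mon (w : List I) : divLength (mon K w) = (w.length : ℚ)⁻¹ • mon K w := by
  funext v
  by_cases h : v = w <;> simp [divLength, mon_apply, h]

theorem rowHtpy_mon (u : List I) : rowHtpy deg (mon K u) =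
    (u.length : ℚ)⁻¹ • ∑ k ∈ Finset.range u.length, ∑ l ∈ Finset.range k,
      (zOp K deg ^ l) (mon K u) := by
  funext w
  simp only [rowHtpy, Finset.sum_apply, Pi.smul_apply]
  by_cases hw : w.length = u.length
  · rw [hw]
  · have h : ∀ k, (zOp K deg ^ k) (mon K u) w = 0 := by
      intro k
      obtain ⟨n, v, hv, h⟩ := exists_zOp_pow_mon (K := K) deg k u
      rw [h]
      have : w ≠ v := by rintro rfl; exact hw hv
      simp [mon_apply, this]
    simp [h]

theorem qsmul_map {N : Type*} [AddCommGroup N] [Module K N] [Module ℚ N] {P : Type*}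
    [AddCommGroup P] [Module K P] [Module ℚ P] (φ : P →ₗ[K] N) (c : ℚ) (x : P) :
    φ (c • x) = c • φ x := map_rat_smul φ.toAddMonoidHom c x

theorem row_decomposition (f : Series K I) (hf : f [] = 0) :
    f = normOp K deg (divLength f) + (rowHtpy deg f - zOp K deg (rowHtpy deg f)) := by
  have key : f - f [] • mon K [] =
      normOp K deg (divLength f) + (rowHtpy deg f - zOp K deg (rowHtpy deg f)) := by
    refine IsCL.ext (φ := fun f => f - f [] • mon K []) (ψ := fun f =>
      normOp K deg (divLength f) + (rowHtpy deg f - zOp K deg (rowHtpy deg f)))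
      (IsCL.sub' IsCL.id' ⟨fun a b => by simp [add_smul], fun a b => by simp [mul_smul],
        by fun_prop⟩) (by fun_prop) (fun u => ?_) f
    cases u with
    | nil => simp [divLength_mon, rowHtpy_mon, mon_apply]
    | cons a u =>
      generalize hn : (a :: u).length = n
      have hn0 : (n : ℚ) ≠ 0 := by rw [← hn]; simp; positivity
      have h1 : ∑ k ∈ Finset.range n, (mon K (a :: u) - (zOp K deg ^ k) (mon K (a :: u))) =
          ∑ k ∈ Finset.range n, ∑ l ∈ Finset.range k, (zOp K deg ^ l) (mon K (a :: u)) -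
            zOp K deg (∑ k ∈ Finset.range n, ∑ l ∈ Finset.range k,
              (zOp K deg ^ l) (mon K (a :: u))) := by
        rw [map_sum, ← Finset.sum_sub_distrib]
        refine Finset.sum_congr rfl fun k _ => ?_
        have := Finset.sum_range_succ' (fun l => (zOp K deg ^ l) (mon K (a :: u))) k
        rw [Finset.sum_range_succ] at this
        rw [map_sum]
        simp only [← Module.End.mul_apply, ← pow_succ']
        rw [sub_eq_sub_iff_add_eq_add, this, add_comm]
        simp
      simp only [divLength_mon, rowHtpy_mon, qsmul_map, normOp_mon, hn, ← smul_sub, ← smul_add]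
      rw [← h1, Finset.sum_sub_distrib, add_sub_cancel, Finset.sum_const, Finset.card_range,
        ← Nat.cast_smul_eq_nsmul ℚ, smul_smul, inv_mul_cancel₀ hn0, one_smul]
      simp [mon_apply]
  rw [← key, hf]
  simp

theorem zOp_divLength (f : Series K I) :
    zOp K deg (divLength f) = divLength (zOp K deg f) := by
  refine IsCL.ext (φ := fun f => zOp K deg (divLength f)) (ψ := fun f => divLength (zOp K deg f))
    (by fun_prop) (by fun_prop) (fun u => ?_) f
  cases u with
  | nil => simp [divLength_mon, zOp_mon_nil]
  | cons a u =>
    simp only [divLength_mon, qsmul_map, zOp_mon_cons]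
    have := (isCL_divLength (K := K) (I := I) IsCL.id').zsmul (sgn (wdeg deg [a] * wdeg deg u))
      (mon K (u ++ [a]))
    rw [this, divLength_mon, smul_comm]
    simp

theorem normOp_divLength (f : Series K I) :
    normOp K deg (divLength f) = divLength (normOp K deg f) := by
  have h : ∀ k, (zOp K deg ^ k) (divLength f) = divLength ((zOp K deg ^ k) f) := by
    intro k
    induction k with
    | zero => rfl
    | succ k ih => rw [pow_succ', Module.End.mul_apply, ih, zOp_divLength, Module.End.mul_apply]
  funext w
  simp only [normOp, LinearMap.coe_mk, AddHom.coe_mk, h, divLength, Finset.smul_sum]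

theorem zOp_rowHtpy (f : Series K I) :
    zOp K deg (rowHtpy deg f) = rowHtpy deg (zOp K deg f) := by
  refine IsCL.ext (φ := fun f => zOp K deg (rowHtpy deg f))
    (ψ := fun f => rowHtpy deg (zOp K deg f)) (by fun_prop) (by fun_prop) (fun u => ?_) f
  cases u with
  | nil => simp [rowHtpy_mon, zOp_mon_nil]
  | cons a u =>
    have := (isCL_rowHtpy (K := K) (I := I) deg IsCL.id').zsmul (sgn (wdeg deg [a] * wdeg deg u))
      (mon K (u ++ [a]))
    simp only [zOp_mon_cons, this]
    rw [rowHtpy_mon, rowHtpy_mon, qsmul_map, smul_comm, map_sum]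
    congr 1
    · simp
    · simp only [map_sum, ← map_zsmul, Finset.smul_sum, ← zOp_mon_cons, List.length_append,
        List.length_cons, List.length_nil, zero_add]
      refine Finset.sum_congr rfl fun k _ => Finset.sum_congr rfl fun l _ => ?_
      rw [← Module.End.mul_apply, ← Module.End.mul_apply, ← pow_succ', pow_succ]

/-- Exactness of the rows at the columns with `N` outgoing. -/
theorem eq_sub_zOp_of_normOp_eq_zero {f : Series K I} (hf : f [] = 0) (h : normOp K deg f = 0) :
    f = rowHtpy deg f - zOp K deg (rowHtpy deg f) := by
  have h1 := row_decomposition deg f hf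
  rwa [normOp_divLength, h, (isCL_divLength (K := K) (I := I) IsCL.id').zero, zero_add] at h1

/-- Exactness of the rows at the columns with `1 - z` outgoing. -/
theorem eq_normOp_of_zOp_eq {f : Series K I} (hf : f [] = 0) (h : zOp K deg f = f) :
    f = normOp K deg (divLength f) := by
  have h1 := row_decomposition deg f hf
  rwa [zOp_rowHtpy, h, sub_self, add_zero] at h1

end Rows

/-! ### Commutators -/

section Commutators

variable {K I : Type*} [CommRing K] [Algebra ℚ K] {𝒦 : ℤ → Submodule ℚ K} [GradedAlgebra 𝒦]
  {deg : I → ℤ} [DecidableEq I] [TopologicalSpace K] [DiscreteTopology K]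

theorem zOp_apply_nil (f : Series K I) : zOp K deg f [] = f [] := by simp [zOp]

theorem mon_sub_zOp_mem_commSpan (w : List I) :
    (mon K w - zOp K deg (mon K w) : Series K I) ∈ commSpan 𝒦 deg := by
  cases w with
  | nil => simp [zOp_mon_nil]
  | cons a w =>
    have h := dmul_sub_zOp_dmul deg (par_mon (K := K) (deg := deg) [a]) (mon K w)
    have h1 : dmul deg (mon K [a]) (mon K w : Series K I) = mon K (a :: w) := by
      rw [← var_eq_mon, dmul_var, var_eq_mon, cmul_mon]; rfl
    rw [h1, br_eq_bracket deg (par_mon w)] at h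
    rw [h]
    exact Submodule.subset_span ⟨_, _, _, _, mon_mem_homog _, mon_mem_homog _, rfl⟩

theorem sub_zOp_mem_commutators (f : Series K I) :
    (f - zOp K deg f : Series K I) ∈ commutators 𝒦 deg := by
  classical
  intro F
  have hc : IsCL K fun f : Series K I => f - zOp K deg f := by fun_prop
  choose G hG using hc.exists_finite
  let H := F.biUnion G
  refine ⟨∑ w ∈ H, f w • (mon K w - zOp K deg (mon K w)), Submodule.sum_mem _ fun w _ =>
    Submodule.smul_mem _ _ (mon_sub_zOp_mem_commSpan w), fun w hw => ?_⟩
  have h := hG w (f - ∑ u ∈ H, f u • mon K u) fun u hu => by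
    have : u ∈ H := Finset.mem_biUnion.2 ⟨w, hw, hu⟩
    simp [mon_apply, Finset.sum_apply, this]
  have h2 : ∑ w ∈ H, f w • (mon K w - zOp K deg (mon K w)) =
      (∑ u ∈ H, f u • mon K u) - zOp K deg (∑ u ∈ H, f u • mon K u) := by
    simp [map_sum, Finset.sum_sub_distrib, smul_sub]
  have h3 := hc.sub f (∑ u ∈ H, f u • mon K u)
  rw [h3, Pi.sub_apply, sub_eq_zero] at h
  rw [h2]
  exact h

/-- The commutators are the image of `1 - z` on series without constant term, which by the exactness
of the rows is the kernel of `N`. -/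
theorem mem_commutators_iff (heven : ∀ n, Odd n → 𝒦 n = ⊥) (f : Series K I) :
    f ∈ commutators 𝒦 deg ↔ normOp K deg f = 0 ∧ f [] = 0 := by
  constructor
  · intro hf
    have h1 : ∀ g ∈ commSpan 𝒦 deg, normOp K deg g = 0 ∧ g [] = 0 := by
      intro g hg
      induction hg using Submodule.span_induction with
      | mem x hx =>
        obtain ⟨p, q, f, g, hf, hg, rfl⟩ := hx
        rw [← br_eq_bracket deg (par_of_homog heven hg),
          ← dmul_sub_zOp_dmul deg (par_of_homog heven hf)]
        rw [map_sub, normOp_zOp, sub_self, Pi.sub_apply, zOp_apply_nil, sub_self]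
        exact ⟨rfl, rfl⟩
      | zero => simp
      | add x y _ _ hx hy => simp [hx.1, hx.2, hy.1, hy.2]
      | smul a x _ hx => simp [hx.1, hx.2]
    constructor
    · funext w
      obtain ⟨F, hF⟩ := (isCL_normOp (K := K) (I := I) deg IsCL.id').exists_finite w
      obtain ⟨g, hg, h⟩ := hf F
      have := hF (f - g) fun u hu => by simp [h u hu]
      rw [map_sub, (h1 g hg).1, sub_zero] at this
      exact this
    · obtain ⟨g, hg, h⟩ := hf {[]}
      rw [h [] (by simp), (h1 g hg).2]
  · rintro ⟨h1, h2⟩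
    rw [eq_sub_zOp_of_normOp_eq_zero deg h2 h1]
    exact sub_zOp_mem_commutators _

end Commutators

/-! ### Degrees -/

section Degrees

variable {K I : Type*} [CommRing K] [Algebra ℚ K] {𝒦 : ℤ → Submodule ℚ K} [GradedAlgebra 𝒦]
  {deg : I → ℤ}

theorem qsmul_mem_homog {n : ℤ} (c : ℚ) {f : Series K I} (hf : f ∈ homog 𝒦 deg n) :
    c • f ∈ homog 𝒦 deg n := fun w => Submodule.smul_mem _ c (hf w)

theorem zOp_mem_homog {n : ℤ} {f : Series K I} (hf : f ∈ homog 𝒦 deg n) :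
    zOp K deg f ∈ homog 𝒦 deg n := by
  intro w
  rcases List.eq_nil_or_concat w with rfl | ⟨v, b, rfl⟩
  · simpa [zOp] using hf []
  · have := hf (b :: v)
    rw [wdeg_cons, add_comm, ← wdeg_append] at this
    have := zsmul_mem this (sgn ((1 - deg b) * wdeg deg v))
    simpa [zOp] using this

theorem zOp_pow_mem_homog {n : ℤ} (k : ℕ) {f : Series K I} (hf : f ∈ homog 𝒦 deg n) :
    (zOp K deg ^ k) f ∈ homog 𝒦 deg n := by
  induction k with
  | zero => exact hf
  | succ k ih => rw [pow_succ']; exact zOp_mem_homog ih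

theorem normOp_mem_homog {n : ℤ} {f : Series K I} (hf : f ∈ homog 𝒦 deg n) :
    normOp K deg f ∈ homog 𝒦 deg n := by
  intro w
  simp only [normOp, LinearMap.coe_mk, AddHom.coe_mk]
  exact Submodule.sum_mem _ fun k _ => zOp_pow_mem_homog k hf w

theorem dmul_mem_homog {p q : ℤ} {u y : Series K I} (hu : u ∈ homog 𝒦 deg p)
    (hy : y ∈ homog 𝒦 deg q) : dmul deg u y ∈ homog 𝒦 deg (p + q) := by
  intro w
  cases w with
  | nil => exact Submodule.zero_mem _
  | cons a w =>
    refine Submodule.sum_mem _ fun k _ => Submodule.sum_mem _ fun l _ => zsmul_mem ?_ _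
    have h := SetLike.mul_mem_graded (hu ((w.drop k).drop l ++ a :: w.take k))
      (hy ((w.drop k).take l))
    have h1 : wdeg deg w = wdeg deg (w.take k) + (wdeg deg ((w.drop k).take l) +
        wdeg deg ((w.drop k).drop l)) := by
      rw [← wdeg_append, ← wdeg_append, List.take_append_drop, List.take_append_drop]
    convert h using 2
    rw [wdeg_append, wdeg_cons, wdeg_cons deg a (w.take k), h1]
    ring

theorem lquot_mem_homog {n : ℤ} (a : I) {f : Series K I} (hf : f ∈ homog 𝒦 deg n) :
    lquot a f ∈ homog 𝒦 deg (n - wdeg deg [a]) := by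
  intro w
  have h := hf (a :: w)
  rw [wdeg_cons, ← sub_sub] at h
  exact h

theorem normOp_mem_col {n : ℤ} {f : Series K I} (hf : f ∈ col 𝒦 deg n) :
    normOp K deg f ∈ col 𝒦 deg n :=
  ⟨normOp_mem_homog hf.1, by simp [normOp]⟩

theorem zOp_mem_col {n : ℤ} {f : Series K I} (hf : f ∈ col 𝒦 deg n) :
    zOp K deg f ∈ col 𝒦 deg n :=
  ⟨zOp_mem_homog hf.1, by simp [zOp, hf.2]⟩

theorem divLength_mem_col {n : ℤ} {f : Series K I} (hf : f ∈ col 𝒦 deg n) :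
    divLength f ∈ col 𝒦 deg n :=
  ⟨fun w => Submodule.smul_mem _ _ (hf.1 w), by simp [divLength]⟩

theorem rowHtpy_mem_col {n : ℤ} {f : Series K I} (hf : f ∈ col 𝒦 deg n) :
    rowHtpy deg f ∈ col 𝒦 deg n :=
  ⟨fun w => Submodule.smul_mem _ _ (Submodule.sum_mem _ fun _ _ => Submodule.sum_mem _ fun l _ =>
    zOp_pow_mem_homog l hf.1 w), by simp [rowHtpy]⟩

variable [DecidableEq I] (A : AInfStructure 𝒦 deg)

theorem AInfStructure.m_mem_col {n : ℤ} {f : Series K I} (hf : f ∈ col 𝒦 deg n) :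
    A.m f ∈ col 𝒦 deg (n + 1) := by
  let _ : TopologicalSpace K := ⊥
  have : DiscreteTopology K := ⟨rfl⟩
  exact ⟨A.degree_one _ _ hf.1, A.m_apply_nil hf.2⟩

theorem AInfStructure.b_mem_col {n : ℤ} {f : Series K I} (hf : f ∈ col 𝒦 deg n) :
    A.b f ∈ col 𝒦 deg (n + 1) := by
  refine ⟨fun w => ?_, rfl⟩
  cases w with
  | nil => exact Submodule.zero_mem _
  | cons a w =>
    let _ : TopologicalSpace K := ⊥
    have : DiscreteTopology K := ⟨rfl⟩
    rw [AInfStructure.b_cons]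
    refine Submodule.sub_mem _ (Submodule.neg_mem _ ?_) (zsmul_mem ?_ _)
    · refine finsum_induction (fun x => x ∈ 𝒦 (n + 1 - wdeg deg (a :: w)))
        (Submodule.zero_mem _) (fun x y hx hy => Submodule.add_mem _ hx hy) fun i => ?_
      have h := dmul_mem_homog (A.degree_one _ _ (mon_mem_homog [i])) (lquot_mem_homog i hf.1)
        (a :: w)
      rw [show wdeg deg [i] + 1 + (n - wdeg deg [i]) = n + 1 by ring] at h
      exact h
    · have h := A.degree_one _ _ (lquot_mem_homog a hf.1) w
      rw [wdeg_cons]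
      convert h using 2
      ring

end Degrees

/-! ### The contraction given by the unit -/

section Unit

variable {K I : Type*} [CommRing K] [Algebra ℚ K] {𝒦 : ℤ → Submodule ℚ K} [GradedAlgebra 𝒦]
  {deg : I → ℤ} [DecidableEq I] (A : AInfStructure 𝒦 deg) (e : I)

/-- The contraction `∑_w f(w) t_w ↦ ∑_{w ≠ ∅} f(e w) t_w` defined by a unit `v_e`. -/
def unitHtpy : Series K I →ₗ[K] Series K I where
  toFun f w := if w = [] then 0 else f (e :: w)
  map_add' f g := by funext w; by_cases h : w = [] <;> simp [h]
  map_smul' c f := by funext w; by_cases h : w = [] <;> simp [h]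

theorem unitHtpy_eq (f : Series K I) : unitHtpy e f = lquot e f - f [e] • mon K [] := by
  funext w
  by_cases h : w = [] <;> simp [unitHtpy, lquot, h, mon_apply]

theorem unitHtpy_mem_col (he : deg e = 0) {n : ℤ} {f : Series K I} (hf : f ∈ col 𝒦 deg (n + 1)) :
    unitHtpy e f ∈ col 𝒦 deg n := by
  refine ⟨fun w => ?_, by simp [unitHtpy]⟩
  by_cases h : w = []
  · simp [unitHtpy, h]
  · have h1 := lquot_mem_homog e hf.1 w
    rw [wdeg_singleton, he] at h1
    simpa [unitHtpy, h, lquot] using h1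

theorem lquot_cmul (a : I) (f g : Series K I) :
    lquot a (cmul f g) = f [] • lquot a g + cmul (lquot a f) g := by
  funext w
  exact cmul_cons f g a w

variable {A e} (hunit : A.IsUnital e)
include hunit

namespace AInfStructure

/-- The terms of `m(t_i)` beginning with `τ` come from `ad τ - τ² ∂_τ` and add up to `τ t_i`. -/
theorem IsUnital.lquot_m_var (i : I) : lquot e (A.m (var i)) = var i := by
  let _ : TopologicalSpace K := ⊥
  have : DiscreteTopology K := ⟨rfl⟩
  obtain ⟨he, ⟨a, ha, h1⟩, h2⟩ := hunit
  have hz : ∀ a : Series K I, (∀ w, e ∈ w → a w = 0) → lquot e a = 0 := fun a ha => by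
    funext w
    exact ha _ (by simp)
  by_cases hi : i = e
  · subst hi
    rw [h1, map_sub, map_add, hz a ha, bracket, map_sub, map_zsmul, lquot_cmul_var, if_pos rfl]
    simp [sgn_one]
  · obtain ⟨b, hb, h3⟩ := h2 i hi
    rw [h3, map_add, hz b hb, bracket, map_sub, map_zsmul, lquot_cmul_var, lquot_cmul_var,
      if_pos rfl, if_neg (Ne.symm hi)]
    simp

variable [TopologicalSpace K] [DiscreteTopology K]

theorem IsUnital.m_lquot (f : Series K I) :
    A.m (lquot e f) + lquot e (A.m f) = f - f [] • mon K [] := by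
  refine IsCL.ext (φ := fun f => A.m (lquot e f) + lquot e (A.m f))
    (ψ := fun f => f - f [] • mon K []) (by fun_prop)
    (IsCL.sub' IsCL.id' ⟨fun a b => by simp [add_smul], fun a b => by simp [mul_smul],
      by fun_prop⟩) (fun w => ?_) f
  cases w with
  | nil => simp [lquot_mon_nil, m_mon_nil, mon_apply]
  | cons a w =>
    have h1 : (mon K (a :: w) : Series K I) = cmul (var a) (mon K w) := by
      rw [var_eq_mon, cmul_mon]; rfl
    have h2 : eps deg 1 (var a : Series K I) = sgn (wdeg deg [a]) • var a := by
      rw [var_eq_mon, eps_mon, one_mul]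
    simp only [h1, m_cmul, h2, lquot_cmul_var, map_add, map_zsmul, zsmul_cmul]
    rw [lquot_cmul, A.vanishes, zero_smul, zero_add, hunit.lquot_m_var]
    by_cases ha : e = a
    · subst ha
      simp [wdeg_singleton, hunit.1, sgn_one, cmul_nil, var]
    · simp [ha, cmul_nil, var]

/-- The unit contracts the columns of the Tsygan bicomplex with differential `b'`. -/
theorem IsUnital.m_unitHtpy {f : Series K I} (hf : f [] = 0) :
    A.m (unitHtpy e f) + unitHtpy e (A.m f) = f := by
  have h := hunit.m_lquot f
  rw [hf, zero_smul, sub_zero] at h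
  have h1 : A.m (unitHtpy e f) = A.m (lquot e f) := by
    rw [unitHtpy_eq, map_sub, map_smul, m_mon_nil, smul_zero, sub_zero]
  have h2 : A.m (lquot e f) [] = 0 := by
    rw [← h1]
    exact A.m_apply_nil (by simp [unitHtpy])
  have h3 : A.m f [e] = 0 := by
    have := congrFun h []
    rw [Pi.add_apply, h2, hf, zero_add] at this
    exact this
  rw [h1, unitHtpy_eq, h3, zero_smul, sub_zero, h]

end AInfStructure

end Unit

/-! ### The shuffle coproduct -/

section Coproduct

variable {K I : Type*} [CommRing K]

/-- The completed tensor square of the algebra of series; `f` is recorded by the coefficients of the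
`t_u ⊗ t_v`. -/
abbrev Series2 (K I : Type*) := List I × List I → K

/-- The element `f ⊗ g`. -/
def tens (f g : Series K I) : Series2 K I := fun x => f x.1 * g x.2

/-- Multiplication `t_u ⊗ t_v ↦ t_u t_v`. -/
def mulMap (G : Series2 K I) : Series K I := fun w =>
  ∑ k ∈ Finset.range (w.length + 1), G (w.take k, w.drop k)

variable (deg : I → ℤ)

/-- The product of the tensor square, with the Koszul sign:
`(p ⊗ q)(p' ⊗ q') = (-1)^{|q||p'|} p p' ⊗ q q'`. -/
def cmul2 (F G : Series2 K I) : Series2 K I := fun x =>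
  ∑ k ∈ Finset.range (x.1.length + 1), ∑ l ∈ Finset.range (x.2.length + 1),
    sgn (wdeg deg (x.2.take l) * wdeg deg (x.1.drop k)) •
      (F (x.1.take k, x.2.take l) * G (x.1.drop k, x.2.drop l))

/-- The coproduct `Δ` with primitive generators. -/
noncomputable def copr (f : Series K I) : Series2 K I := fun x =>
  (shuffle deg x.1 x.2).sum fun p c => c • f p

/-- The interchange of the factors, with the Koszul sign. -/
def swap (G : Series2 K I) : Series2 K I := fun x =>
  sgn (wdeg deg x.1 * wdeg deg x.2) • G (x.2, x.1)

/-- The `p`-th power of the parity automorphism of the tensor square. -/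
def eps2 (p : ℤ) (G : Series2 K I) : Series2 K I := fun x =>
  sgn (p * (wdeg deg x.1 + wdeg deg x.2)) • G x

/-- The extension to the tensor square of `p ⊗ q ↦ dp · q`. -/
def dmul2 (G : Series2 K I) : Series K I
  | [] => 0
  | a :: w => ∑ k ∈ Finset.range (w.length + 1), ∑ l ∈ Finset.range (w.length - k + 1),
      sgn (wdeg deg ((w.drop k).drop l) *
        (wdeg deg (a :: w.take k) + wdeg deg ((w.drop k).take l))) •
        G ((w.drop k).drop l ++ a :: w.take k, (w.drop k).take l)

theorem dmul2_tens (u y : Series K I) : dmul2 deg (tens u y) = dmul deg u y := by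
  funext w
  cases w <;> rfl

theorem mulMap_tens (f g : Series K I) : mulMap (tens f g) = cmul f g := rfl

theorem shuffleOp_eq (f : Series K I) : shuffleOp K deg f = mulMap (copr deg f) := rfl

theorem perm_of_mem_shuffle (u v p : List I) (hp : p ∈ (shuffle deg u v).support) :
    p.Perm (u ++ v) := by
  classical
  induction h : u.length + v.length generalizing u v p with
  | zero =>
    obtain rfl : u = [] := List.length_eq_zero_iff.1 (by omega)
    obtain rfl : v = [] := List.length_eq_zero_iff.1 (by omega)
    rw [shuffle] at hp
    have := Finsupp.support_single_subset hp
    simp_all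
  | succ n ih =>
    match u, v with
    | [], v =>
      rw [shuffle] at hp
      have := Finsupp.support_single_subset hp
      simp_all
    | a :: u, [] =>
      rw [shuffle] at hp
      have := Finsupp.support_single_subset hp
      simp_all
    | a :: u, b :: v =>
      rw [shuffle] at hp
      rcases Finset.mem_union.1 (Finsupp.support_add hp) with h1 | h1
      · obtain ⟨q, hq, rfl⟩ := Finset.mem_image.1 (Finsupp.mapDomain_support h1)
        simp only [List.length_cons] at h
        exact (ih u (b :: v) q hq (by simp only [List.length_cons]; omega)).cons a
      · obtain ⟨q, hq, rfl⟩ := Finset.mem_image.1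
          (Finsupp.mapDomain_support (Finsupp.support_smul h1))
        simp only [List.length_cons] at h
        refine ((ih (a :: u) v q hq (by simp only [List.length_cons]; omega)).cons b).trans ?_
        exact List.perm_middle.symm

theorem wdeg_of_mem_shuffle {u v p : List I} (hp : p ∈ (shuffle deg u v).support) :
    wdeg deg p = wdeg deg u + wdeg deg v := by
  rw [← wdeg_append, wdeg, wdeg, ((perm_of_mem_shuffle deg u v p hp).map _).sum_eq]

theorem eps2_copr (p : ℤ) (f : Series K I) : eps2 deg p (copr deg f) = copr deg (eps deg p f) := by
  funext x
  simp only [eps2, copr, Finsupp.sum, Finset.smul_sum, eps]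
  refine Finset.sum_congr rfl fun w hw => ?_
  rw [wdeg_of_mem_shuffle deg hw, smul_comm]

variable [TopologicalSpace K] [DiscreteTopology K]
variable {M : Type*} [TopologicalSpace M] [AddCommGroup M] [Module K M]

@[fun_prop] theorem isCL_tens_left {f : M → Series K I} (hf : IsCL K f) (g : Series K I) :
    IsCL K fun x => tens (f x) g :=
  ⟨fun x y => by funext w; simp [tens, hf.add, add_mul],
    fun c x => by funext w; simp [tens, hf.smul, mul_assoc],
    by have := hf.cont; unfold tens; fun_prop⟩

@[fun_prop] theorem isCL_tens_right {f : M → Series K I} (hf : IsCL K f) (g : Series K I) :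
    IsCL K fun x => tens g (f x) :=
  ⟨fun x y => by funext w; simp [tens, hf.add, mul_add],
    fun c x => by funext w; simp [tens, hf.smul, mul_left_comm],
    by have := hf.cont; unfold tens; fun_prop⟩

@[fun_prop] theorem isCL_mulMap {f : M → Series2 K I} (hf : IsCL K f) :
    IsCL K fun x => mulMap (f x) :=
  IsCL.of_pi fun _ => IsCL.sum' _ fun _ => isCL_eval _ hf

@[fun_prop] theorem isCL_cmul2_left {f : M → Series2 K I} (hf : IsCL K f) (G : Series2 K I) :
    IsCL K fun x => cmul2 deg (f x) G :=
  ⟨fun x y => by funext w; simp [cmul2, hf.add, add_mul, Finset.sum_add_distrib],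
    fun c x => by funext w; simp [cmul2, hf.smul, Finset.mul_sum, mul_assoc, mul_left_comm],
    by have := hf.cont; unfold cmul2; fun_prop⟩

@[fun_prop] theorem isCL_cmul2_right {f : M → Series2 K I} (hf : IsCL K f) (G : Series2 K I) :
    IsCL K fun x => cmul2 deg G (f x) :=
  ⟨fun x y => by funext w; simp [cmul2, hf.add, mul_add, Finset.sum_add_distrib],
    fun c x => by funext w; simp [cmul2, hf.smul, Finset.mul_sum, mul_left_comm],
    by have := hf.cont; unfold cmul2; fun_prop⟩

@[fun_prop] theorem isCL_copr {f : M → Series K I} (hf : IsCL K f) :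
    IsCL K fun x => copr deg (f x) :=
  IsCL.of_pi fun _ => IsCL.sum' _ fun _ => IsCL.zsmul' _ (isCL_eval _ hf)

@[fun_prop] theorem isCL_shuffleOp {f : M → Series K I} (hf : IsCL K f) :
    IsCL K fun x => shuffleOp K deg (f x) := by
  simp only [shuffleOp_eq]
  fun_prop

@[fun_prop] theorem isCL_swap {f : M → Series2 K I} (hf : IsCL K f) :
    IsCL K fun x => swap deg (f x) :=
  IsCL.of_pi fun _ => IsCL.zsmul' _ (isCL_eval _ hf)

@[fun_prop] theorem isCL_eps2 (p : ℤ) {f : M → Series2 K I} (hf : IsCL K f) :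
    IsCL K fun x => eps2 deg p (f x) :=
  IsCL.of_pi fun _ => IsCL.zsmul' _ (isCL_eval _ hf)

@[fun_prop] theorem isCL_dmul2 {f : M → Series2 K I} (hf : IsCL K f) :
    IsCL K fun x => dmul2 deg (f x) := by
  refine IsCL.of_pi fun w => ?_
  cases w with
  | nil => simp only [dmul2]; fun_prop
  | cons a w => exact IsCL.sum' _ fun _ => IsCL.sum' _ fun _ => IsCL.zsmul' _ (isCL_eval _ hf)

theorem cmul2_zsmul (n : ℤ) (F G : Series2 K I) : cmul2 deg F (n • G) = n • cmul2 deg F G :=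
  (isCL_cmul2_right (K := K) deg IsCL.id' F).zsmul n G

theorem zsmul_cmul2 (n : ℤ) (F G : Series2 K I) : cmul2 deg (n • F) G = n • cmul2 deg F G :=
  (isCL_cmul2_left (K := K) deg IsCL.id' G).zsmul n F

theorem cmul2_add (F G H : Series2 K I) : cmul2 deg F (G + H) = cmul2 deg F G + cmul2 deg F H :=
  (isCL_cmul2_right (K := K) deg IsCL.id' F).add G H

theorem add_cmul2 (F G H : Series2 K I) : cmul2 deg (F + G) H = cmul2 deg F H + cmul2 deg G H :=
  (isCL_cmul2_left (K := K) deg IsCL.id' H).add F G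

theorem tens_zsmul (n : ℤ) (f g : Series K I) : tens f (n • g) = n • tens f g :=
  (isCL_tens_right (K := K) IsCL.id' f).zsmul n g

theorem zsmul_tens (n : ℤ) (f g : Series K I) : tens (n • f) g = n • tens f g :=
  (isCL_tens_left (K := K) IsCL.id' g).zsmul n f

variable [DecidableEq I]

theorem mon_pair (p q : List I) : mon K (p, q) = tens (mon K p) (mon K q) := by
  funext x
  obtain ⟨u, v⟩ := x
  by_cases h : u = p <;> by_cases h' : v = q <;> simp [mon_apply, tens, h, h']

theorem cmul2_mon (p q p' q' : List I) : cmul2 deg (mon K (p, q)) (mon K (p', q')) =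
    sgn (wdeg deg q * wdeg deg p') • mon K (p ++ p', q ++ q') := by
  funext x
  obtain ⟨u, v⟩ := x
  have h1 : (sgn (wdeg deg q * wdeg deg p') • mon K (p ++ p', q ++ q') : Series2 K I) (u, v) =
      sgn (wdeg deg q * wdeg deg p') • (cmul (mon K p) (mon K p') u *
        cmul (mon K q) (mon K q') v) := by
    rw [mon_pair, cmul_mon, cmul_mon]; rfl
  rw [h1, cmul, cmul, Finset.sum_mul_sum, Finset.smul_sum]
  refine Finset.sum_congr rfl fun k _ => ?_
  rw [Finset.smul_sum]
  refine Finset.sum_congr rfl fun l _ => ?_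
  simp only [mon_pair, tens]
  by_cases h : v.take l = q
  · by_cases h' : u.drop k = p'
    · rw [h, h']
      congr 1
      ring
    · simp [mon_apply, h']
  · simp [mon_apply, h]

theorem mulMap_mon (p q : List I) : mulMap (mon K (p, q)) = mon K (p ++ q) := by
  rw [mon_pair, mulMap_tens, cmul_mon]

theorem swap_mon (p q : List I) : swap deg (mon K (p, q)) =
    sgn (wdeg deg p * wdeg deg q) • mon K (q, p) := by
  funext x
  obtain ⟨u, v⟩ := x
  by_cases h : u = q <;> by_cases h' : v = p <;> simp [swap, mon_apply, h, h', mul_comm]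

theorem eps2_mon (n : ℤ) (p q : List I) : eps2 deg n (mon K (p, q)) =
    sgn (n * (wdeg deg p + wdeg deg q)) • mon K (p, q) := by
  funext x
  obtain ⟨u, v⟩ := x
  by_cases h : u = p <;> by_cases h' : v = q <;> simp [eps2, mon_apply, h, h']

/-- A continuous linear map on the tensor square is determined by its values on monomials. -/
theorem ext2 {N : Type*} [AddCommGroup N] [Module K N] [TopologicalSpace N] [T2Space N]
    {φ ψ : Series2 K I → N} (hφ : IsCL K φ) (hψ : IsCL K ψ)
    (h : ∀ p q, φ (mon K (p, q)) = ψ (mon K (p, q))) (F : Series2 K I) : φ F = ψ F :=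
  hφ.ext hψ (fun x => h x.1 x.2) F

theorem cmul2_assoc (F G H : Series2 K I) :
    cmul2 deg (cmul2 deg F G) H = cmul2 deg F (cmul2 deg G H) := by
  refine ext2 (φ := fun F => cmul2 deg (cmul2 deg F G) H)
    (ψ := fun F => cmul2 deg F (cmul2 deg G H)) (by fun_prop) (by fun_prop) (fun p q => ?_) F
  refine ext2 (φ := fun G => cmul2 deg (cmul2 deg _ G) H)
    (ψ := fun G => cmul2 deg _ (cmul2 deg G H)) (by fun_prop) (by fun_prop) (fun p' q' => ?_) G
  refine ext2 (φ := fun H => cmul2 deg (cmul2 deg _ _) H)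
    (ψ := fun H => cmul2 deg _ (cmul2 deg _ H)) (by fun_prop) (by fun_prop) (fun p'' q'' => ?_) H
  simp only [cmul2_mon, cmul2_zsmul, zsmul_cmul2, smul_smul, wdeg_append, add_mul, mul_add, sgn_add,
    List.append_assoc]
  congr 1
  ring

theorem one_cmul2 (G : Series2 K I) : cmul2 deg (mon K ([], [])) G = G := by
  refine ext2 (φ := fun G => cmul2 deg (mon K ([], [])) G) (ψ := fun G => G) (by fun_prop)
    (by fun_prop) (fun p q => ?_) G
  simp [cmul2_mon, wdeg_nil, sgn_zero]

theorem cmul2_one (G : Series2 K I) : cmul2 deg G (mon K ([], [])) = G := by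
  refine ext2 (φ := fun G => cmul2 deg G (mon K ([], []))) (ψ := fun G => G) (by fun_prop)
    (by fun_prop) (fun p q => ?_) G
  simp [cmul2_mon, wdeg_nil, sgn_zero]

theorem cmul2_tens {r : ℤ} {g : Series K I} (hg : Par deg r g) (f f' g' : Series K I) :
    cmul2 deg (tens f g) (tens f' g') = tens (cmul f (eps deg r f')) (cmul g g') := by
  refine Par.ext (φ := fun g => cmul2 deg (tens f g) (tens f' g'))
    (ψ := fun g => tens (cmul f (eps deg r f')) (cmul g g')) (by fun_prop) (by fun_prop)
    (fun q hq => ?_) hg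
  refine IsCL.ext (φ := fun f => cmul2 deg (tens f _) (tens f' g'))
    (ψ := fun f => tens (cmul f (eps deg r f')) (cmul _ g')) (by fun_prop) (by fun_prop)
    (fun p => ?_) f
  refine IsCL.ext (φ := fun f' => cmul2 deg (tens _ _) (tens f' g'))
    (ψ := fun f' => tens (cmul _ (eps deg r f')) (cmul _ g')) (by fun_prop) (by fun_prop)
    (fun p' => ?_) f'
  refine IsCL.ext (φ := fun g' => cmul2 deg (tens _ _) (tens _ g'))
    (ψ := fun g' => tens (cmul _ (eps deg r _)) (cmul _ g')) (by fun_prop) (by fun_prop)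
    (fun q' => ?_) g'
  simp only [← mon_pair, cmul2_mon, eps_mon, cmul_zsmul, zsmul_tens, cmul_mon, sgn_congr hq]

/-- The element `l ⊗ 1 + 1 ⊗ l`; the series `l` is primitive if `copr deg l = prim l`. -/
def prim (l : Series K I) : Series2 K I := tens l (mon K []) + tens (mon K []) l

@[fun_prop] theorem isCL_prim {f : M → Series K I} (hf : IsCL K f) :
    IsCL K fun x => prim (f x) := by
  unfold prim; fun_prop

theorem prim_mon (w : List I) : prim (mon K w) = mon K (w, []) + mon K ([], w) := by
  rw [prim, mon_pair, mon_pair]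

theorem cmul2_left_cons (a b : I) (u v : List I) (G : Series2 K I) :
    cmul2 deg (mon K ([a], [])) G (b :: u, v) = if b = a then G (u, v) else 0 := by
  refine ext2 (φ := fun G => cmul2 deg (mon K ([a], [])) G (b :: u, v))
    (ψ := fun G => if b = a then G (u, v) else 0) (isCL_eval _ (by fun_prop)) ?_ (fun p q => ?_) G
  · by_cases h : b = a
    · simpa only [h, if_true] using isCL_eval _ IsCL.id'
    · simp only [h, if_false]; fun_prop
  · by_cases h : b = a <;> simp [cmul2_mon, wdeg_nil, sgn_zero, mon_apply, h]

theorem cmul2_left_nil (a : I) (v : List I) (G : Series2 K I) :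
    cmul2 deg (mon K ([a], [])) G ([], v) = 0 := by
  refine ext2 (φ := fun G => cmul2 deg (mon K ([a], [])) G ([], v))
    (ψ := fun G => 0) (isCL_eval _ (by fun_prop)) (by fun_prop) (fun p q => ?_) G
  simp [cmul2_mon, wdeg_nil, sgn_zero, mon_apply]

theorem cmul2_right_cons (a b : I) (u v : List I) (G : Series2 K I) :
    cmul2 deg (mon K ([], [a])) G (u, b :: v) =
      if b = a then sgn (wdeg deg [a] * wdeg deg u) • G (u, v) else 0 := by
  refine ext2 (φ := fun G => cmul2 deg (mon K ([], [a])) G (u, b :: v))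
    (ψ := fun G => if b = a then sgn (wdeg deg [a] * wdeg deg u) • G (u, v) else 0)
    (isCL_eval _ (by fun_prop)) ?_ (fun p q => ?_) G
  · by_cases h : b = a
    · simp only [h, if_true]
      exact IsCL.zsmul' _ (isCL_eval _ IsCL.id')
    · simp only [h, if_false]; fun_prop
  · by_cases h : b = a
    · by_cases h' : u = p <;> simp [cmul2_mon, mon_apply, h, h']
    · simp [cmul2_mon, mon_apply, h]

theorem cmul2_right_nil (a : I) (u : List I) (G : Series2 K I) :
    cmul2 deg (mon K ([], [a])) G (u, []) = 0 := by
  refine ext2 (φ := fun G => cmul2 deg (mon K ([], [a])) G (u, []))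
    (ψ := fun G => 0) (isCL_eval _ (by fun_prop)) (by fun_prop) (fun p q => ?_) G
  simp [cmul2_mon, mon_apply]

theorem copr_mon (w u v : List I) : copr deg (mon K w) (u, v) = ((shuffle deg u v w : ℤ) : K) := by
  simp only [copr, mon_apply, Finsupp.sum]
  by_cases h : w ∈ (shuffle deg u v).support
  · rw [Finset.sum_eq_single_of_mem w h (fun p _ hp => by simp [hp])]
    simp
  · rw [Finset.sum_eq_zero (fun p hp => by
      have : p ≠ w := by rintro rfl; exact h hp
      simp [this]), Finsupp.notMem_support_iff.1 h]
    simp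

theorem copr_mon_nil : copr deg (mon K []) = mon K (([] : List I), ([] : List I)) := by
  funext x
  obtain ⟨u, v⟩ := x
  by_cases h : u = [] ∧ v = []
  · obtain ⟨rfl, rfl⟩ := h
    simp [copr_mon, shuffle, mon_apply]
  · rw [copr_mon]
    have h1 : shuffle deg u v [] = 0 := by
      by_contra hc
      have := (perm_of_mem_shuffle deg u v _ (Finsupp.mem_support_iff.2 hc)).length_eq
      simp only [List.length_append, List.length_nil] at this
      exact h ⟨List.length_eq_zero_iff.1 (by omega), List.length_eq_zero_iff.1 (by omega)⟩
    rw [h1, mon_apply, if_neg (by simpa using h)]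
    simp

theorem mapDomain_cons_apply (a c : I) (P : List I →₀ ℤ) (w : List I) :
    Finsupp.mapDomain (List.cons a) P (c :: w) = if c = a then P w else 0 := by
  by_cases h : c = a
  · subst h
    rw [if_pos rfl, Finsupp.mapDomain_apply (List.cons_injective)]
  · rw [if_neg h, Finsupp.mapDomain_of_notMem_range]
    rintro ⟨x, hx⟩
    exact h (by simpa using (List.cons.inj hx).1.symm)

/-- The recursion of the shuffle product by first letters says that `Δ(t_a t_w) = Δ(t_a) Δ(t_w)`. -/
theorem copr_mon_cons (a : I) (w : List I) :
    copr deg (mon K (a :: w)) = cmul2 deg (prim (var a)) (copr deg (mon K w)) := by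
  funext x
  obtain ⟨u, v⟩ := x
  rw [var_eq_mon, prim_mon, add_cmul2, Pi.add_apply]
  match u, v with
  | [], [] =>
    rw [cmul2_left_nil, cmul2_right_nil, copr_mon, shuffle]
    simp
  | [], b :: v =>
    rw [cmul2_left_nil, cmul2_right_cons, copr_mon, copr_mon, shuffle, shuffle, wdeg_nil]
    by_cases h : b = a
    · subst h
      by_cases h' : v = w <;> simp [h', sgn_zero]
    · simp [h]
  | b :: u, [] =>
    rw [cmul2_left_cons, cmul2_right_nil, copr_mon, copr_mon, shuffle]
    by_cases h : b = a
    · subst h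
      cases u <;> simp [shuffle, Finsupp.single_apply]
    · simp [h]
  | b :: u, c :: v =>
    rw [cmul2_left_cons, cmul2_right_cons, copr_mon, copr_mon, copr_mon, shuffle, Finsupp.add_apply,
      Finsupp.smul_apply, mapDomain_cons_apply, mapDomain_cons_apply, wdeg_singleton]
    by_cases h : a = b <;> by_cases h' : a = c
    · subst h; subst h'; simp
    · subst h; simp [h', Ne.symm h']
    · subst h'; simp [h, Ne.symm h]
    · simp [h, Ne.symm h, h', Ne.symm h']

theorem copr_var (a : I) : copr deg (var a) = prim (var a : Series K I) := by
  rw [var_eq_mon, copr_mon_cons, copr_mon_nil, cmul2_one, var_eq_mon]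

/-- `Δ` is a homomorphism of algebras. -/
theorem copr_cmul (f g : Series K I) :
    copr deg (cmul f g) = cmul2 deg (copr deg f) (copr deg g) := by
  refine IsCL.ext (φ := fun f => copr deg (cmul f g))
    (ψ := fun f => cmul2 deg (copr deg f) (copr deg g)) (by fun_prop) (by fun_prop)
    (fun u => ?_) f
  refine IsCL.ext (φ := fun g => copr deg (cmul _ g))
    (ψ := fun g => cmul2 deg (copr deg _) (copr deg g)) (by fun_prop) (by fun_prop)
    (fun v => ?_) g
  rw [cmul_mon]
  induction u with
  | nil => rw [copr_mon_nil, one_cmul2, List.nil_append]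
  | cons a u ih => rw [List.cons_append, copr_mon_cons, copr_mon_cons, cmul2_assoc, ih]

theorem swap_zsmul (n : ℤ) (F : Series2 K I) : swap deg (n • F) = n • swap deg F :=
  (isCL_swap (K := K) deg IsCL.id').zsmul n F

theorem swap_cmul2 (F G : Series2 K I) :
    swap deg (cmul2 deg F G) = cmul2 deg (swap deg F) (swap deg G) := by
  refine ext2 (φ := fun F => swap deg (cmul2 deg F G))
    (ψ := fun F => cmul2 deg (swap deg F) (swap deg G)) (by fun_prop) (by fun_prop)
    (fun p q => ?_) F
  refine ext2 (φ := fun G => swap deg (cmul2 deg _ G))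
    (ψ := fun G => cmul2 deg (swap deg _) (swap deg G)) (by fun_prop) (by fun_prop)
    (fun p' q' => ?_) G
  simp only [swap_mon, cmul2_mon, swap_zsmul, cmul2_zsmul, zsmul_cmul2, smul_smul, wdeg_append,
    add_mul, mul_add, sgn_add]
  congr 1
  rw [mul_comm (wdeg deg q) (wdeg deg p')]
  linear_combination (sgn (wdeg deg p * wdeg deg q) * sgn (wdeg deg p * wdeg deg q') *
    sgn (wdeg deg p' * wdeg deg q')) * sgn_mul_self (wdeg deg p' * wdeg deg q)

/-- `Δ` is cocommutative. -/
theorem swap_copr (f : Series K I) : swap deg (copr deg f) = copr deg f := by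
  refine IsCL.ext (φ := fun f => swap deg (copr deg f)) (ψ := fun f => copr deg f)
    (by fun_prop) (by fun_prop) (fun u => ?_) f
  induction u with
  | nil => simp [copr_mon_nil, swap_mon, wdeg_nil, sgn_zero]
  | cons a u ih =>
    have : swap deg (prim (var a)) = prim (var a : Series K I) := by
      rw [var_eq_mon, prim_mon, (isCL_swap (K := K) deg IsCL.id').add, swap_mon, swap_mon, wdeg_nil]
      simp [sgn_zero, add_comm]
    simp only [copr_mon_cons, swap_cmul2, ih, this]

end Coproduct

/-! ### The modified shuffle operator and primitive elements -/

section Primitive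

variable {K I : Type*} [CommRing K] [TopologicalSpace K] [DiscreteTopology K] (deg : I → ℤ)
  [DecidableEq I]

/-- The adjoint action of a primitive element on the tensor square is compatible with the
multiplication. -/
theorem mulMap_prim_commutator {p : ℤ} {l : Series K I} (hl : Par deg p l) (G : Series2 K I) :
    mulMap (cmul2 deg (prim l) G - cmul2 deg (eps2 deg p G) (prim l)) = br deg p l (mulMap G) := by
  refine Par.ext (φ := fun l => mulMap (cmul2 deg (prim l) G - cmul2 deg (eps2 deg p G) (prim l)))
    (ψ := fun l => br deg p l (mulMap G)) (by fun_prop) (by fun_prop) (fun w hw => ?_) hl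
  refine ext2 (φ := fun G => mulMap (cmul2 deg (prim _) G - cmul2 deg (eps2 deg p G) (prim _)))
    (ψ := fun G => br deg p _ (mulMap G)) (by fun_prop) (by fun_prop) (fun u v => ?_) G
  have hsub := (isCL_mulMap (K := K) (I := I) IsCL.id').sub
  have hadd := (isCL_mulMap (K := K) (I := I) IsCL.id').add
  have hsmul := (isCL_mulMap (K := K) (I := I) IsCL.id').zsmul
  rw [hsub]
  simp only [prim_mon, br, add_cmul2, cmul2_add, eps2_mon, zsmul_cmul2, cmul2_mon, mulMap_mon, hadd,
    hsmul, wdeg_nil, mul_zero, zero_mul, sgn_zero, one_smul, eps_mon, cmul_mon, zsmul_cmul,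
    List.append_nil, List.nil_append, smul_smul, List.append_assoc, wdeg_append]
  have h1 : sgn (p * (wdeg deg u + wdeg deg v)) * sgn (wdeg deg v * wdeg deg w) =
      sgn (wdeg deg w * wdeg deg u) := by
    rw [mul_comm p, ← sgn_congr' hw, add_mul, sgn_add, mul_comm (wdeg deg u), mul_assoc,
      sgn_mul_self, mul_one]
  rw [h1]
  abel

variable {deg} in
/-- `s` commutes with the adjoint action of primitive elements. -/
theorem shuffleOp_br {p : ℤ} {l : Series K I} (hl : Par deg p l) (hprim : copr deg l = prim l)
    (y : Series K I) : shuffleOp K deg (br deg p l y) = br deg p l (shuffleOp K deg y) := by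
  rw [shuffleOp_eq, shuffleOp_eq, br, (isCL_copr (K := K) deg IsCL.id').sub, copr_cmul, copr_cmul,
    hprim, ← eps2_copr, mulMap_prim_commutator deg hl]

variable {deg} in
/-- The primitive elements form a Lie algebra. -/
theorem prim_bracket {p q : ℤ} {l l' : Series K I} (hl : Par deg p l) (hl' : Par deg q l')
    (h : copr deg l = prim l) (h' : copr deg l' = prim l') :
    copr deg (bracket p q l l') = prim (bracket p q l l') := by
  rw [← br_eq_bracket deg hl', br, (isCL_copr (K := K) deg IsCL.id').sub, copr_cmul, copr_cmul,
    ← eps2_copr, h, h']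
  clear h h'
  refine Par.ext (φ := fun l => cmul2 deg (prim l) (prim l') -
      cmul2 deg (eps2 deg p (prim l')) (prim l))
    (ψ := fun l => prim (cmul l l' - cmul (eps deg p l') l)) (by fun_prop) (by fun_prop)
    (fun u hu => ?_) hl
  refine IsCL.ext (φ := fun l' => cmul2 deg (prim _) (prim l') -
      cmul2 deg (eps2 deg p (prim l')) (prim _))
    (ψ := fun l' => prim (cmul _ l' - cmul (eps deg p l') _)) (by fun_prop) (by fun_prop)
    (fun v => ?_) l'
  have hadd := (isCL_eps2 (K := K) deg p IsCL.id').add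
  have hsub := (isCL_prim (K := K) (I := I) IsCL.id').sub
  have hsmul := (isCL_prim (K := K) (I := I) IsCL.id').zsmul
  simp only [eps_mon, zsmul_cmul, cmul_mon, hsub, hsmul, prim_mon, hadd, eps2_mon, add_cmul2,
    cmul2_add, zsmul_cmul2, cmul2_mon, wdeg_nil, mul_zero, zero_mul, sgn_zero, one_smul, zero_add,
    add_zero, List.append_nil, List.nil_append, smul_add, smul_smul]
  rw [sgn_congr hu.symm, mul_comm (wdeg deg v) (wdeg deg u), sgn_mul_self, one_smul]
  abel

variable {deg}

theorem par_bracket {p q : ℤ} {l l' : Series K I} (hl : Par deg p l) (hl' : Par deg q l') :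
    Par deg (p + q) (bracket p q l l') := by
  have key : ∀ {p q : ℤ} {f g : Series K I}, Par deg p f → Par deg q g → ∀ w, cmul f g w ≠ 0 →
      sgn (wdeg deg w) = sgn (p + q) := by
    intro p q f g hf hg w hw
    obtain ⟨k, -, h⟩ := Finset.exists_ne_zero_of_sum_ne_zero hw
    rw [sgn_add, ← hf _ (left_ne_zero_of_mul h), ← hg _ (right_ne_zero_of_mul h), ← sgn_add,
      ← wdeg_append, List.take_append_drop]
  intro w hw
  by_cases h : cmul l l' w = 0
  · refine (key hl' hl w fun h' => hw ?_).trans (by rw [add_comm])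
    simp [bracket, h, h']
  · exact key hl hl' w h

theorem IsLieMonomial.par {p : ℤ} {l : Series K I} (h : IsLieMonomial deg p l) : Par deg p l := by
  induction h with
  | var i => rw [← wdeg_singleton]; exact par_mon [i]
  | bracket _ _ h1 h2 => exact par_bracket h1 h2

theorem IsLieMonomial.copr_eq {p : ℤ} {l : Series K I} (h : IsLieMonomial deg p l) :
    copr deg l = prim l := by
  induction h with
  | var i => exact copr_var deg i
  | bracket hf hg h1 h2 => exact prim_bracket hf.par hg.par h1 h2

/-- Continuous linear maps which agree on Lie monomials agree on Lie series. -/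
theorem lieSeries_ext {Y : Type*} {φ ψ : Series K I → Y → K} (hφ : IsCL K φ) (hψ : IsCL K ψ)
    (h : ∀ p l, IsLieMonomial deg p l → φ l = ψ l) {l : Series K I}
    (hl : l ∈ lieSeries (K := K) deg) : φ l = ψ l := by
  have hc : IsCL K fun f => φ f - ψ f := by fun_prop
  funext y
  obtain ⟨F, hF⟩ := hc.exists_finite y
  obtain ⟨g, hg, h2⟩ := hl F
  have h3 : ∀ g ∈ Submodule.span K {f : Series K I | ∃ p, IsLieMonomial deg p f},
      φ g = ψ g := by
    intro g hg
    induction hg using Submodule.span_induction with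
    | mem x hx => obtain ⟨p, hp⟩ := hx; exact h p x hp
    | zero => rw [hφ.zero, hψ.zero]
    | add x y _ _ hx hy => rw [hφ.add, hψ.add, hx, hy]
    | smul a x _ hx => rw [hφ.smul, hψ.smul, hx]
  have h4 := hF (l - g) fun u hu => by simp [h2 u hu]
  rw [hφ.sub, hψ.sub, h3 g hg, sub_sub_sub_cancel_right, Pi.sub_apply, sub_eq_zero] at h4
  exact h4

/-- Lie series are primitive. -/
theorem copr_lieSeries {l : Series K I} (hl : l ∈ lieSeries (K := K) deg) :
    copr deg l = prim l :=
  lieSeries_ext (φ := fun l => copr deg l) (ψ := fun l => prim l) (by fun_prop) (by fun_prop)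
    (fun _ _ h => h.copr_eq) hl

variable (K deg) in
/-- The operator `1 ⊗̂ s` on `W ⊗̂ T̂W`. -/
noncomputable def shuffleTilde : Series K I →ₗ[K] Series K I where
  toFun f
    | [] => 0
    | a :: w => shuffleOp K deg (lquot a f) w
  map_add' f g := by
    funext w
    cases w <;> simp
  map_smul' c f := by
    funext w
    cases w <;> simp

variable {M : Type*} [TopologicalSpace M] [AddCommGroup M] [Module K M]

@[fun_prop] theorem isCL_shuffleTilde {f : M → Series K I} (hf : IsCL K f) :
    IsCL K fun x => shuffleTilde K deg (f x) := by
  refine IsCL.of_pi fun w => ?_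
  cases w with
  | nil => exact IsCL.zero'
  | cons a w =>
    exact isCL_eval (f := fun x => shuffleOp K deg (lquot a (f x))) w (by fun_prop)

theorem shuffleTilde_cmul_var (a : I) (y : Series K I) :
    shuffleTilde K deg (cmul (var a) y) = cmul (var a) (shuffleOp K deg y) := by
  funext w
  cases w with
  | nil => simp [cmul_nil, var, shuffleTilde]
  | cons c w =>
    rw [cmul_var_cons]
    change shuffleOp K deg (lquot c (cmul (var a) y)) w = _
    rw [lquot_cmul_var]
    by_cases h : c = a <;> simp [h]

theorem shuffleTilde_mon_nil : shuffleTilde K deg (mon K ([] : List I)) = 0 := by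
  funext w
  cases w with
  | nil => rfl
  | cons c w =>
    change shuffleOp K deg (lquot c (mon K [])) w = _
    rw [lquot_mon_nil, map_zero]
    rfl

/-- `d[l, l'] · y = dl · [l', y] ∓ dl' · [l, y]`, by the Leibniz rule modulo commutators. -/
theorem dmul_bracket {p q : ℤ} {l l' : Series K I} (hl : Par deg p l) (hl' : Par deg q l')
    (y : Series K I) : dmul deg (bracket p q l l') y =
      dmul deg l (br deg q l' y) - sgn (p * q) • dmul deg l' (br deg p l y) := by
  have hsub : ∀ u z z' : Series K I, dmul deg u (z - z') = dmul deg u z - dmul deg u z' :=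
    fun u => (isCL_dmul_right (K := K) deg IsCL.id' u).sub
  rw [bracket, (isCL_dmul_left (K := K) deg IsCL.id' y).sub, dmul_zsmul_left, dmul_cmul deg hl,
    dmul_cmul deg hl', eps_eq_of_par hl, eps_eq_of_par hl', dmul_zsmul_left, dmul_zsmul_left, br,
    br, hsub, hsub, mul_comm q p, smul_add, smul_sub, smul_smul, sgn_mul_self, one_smul]
  abel

theorem IsLieMonomial.shuffleTilde_dmul {p : ℤ} {l : Series K I} (h : IsLieMonomial deg p l)
    (y : Series K I) :
    shuffleTilde K deg (dmul deg l y) = dmul deg l (shuffleOp K deg y) := by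
  induction h generalizing y with
  | var i => rw [dmul_var, dmul_var, shuffleTilde_cmul_var]
  | bracket hf hg h1 h2 =>
    rw [dmul_bracket hf.par hg.par, dmul_bracket hf.par hg.par, map_sub, map_zsmul, h1, h2,
      shuffleOp_br hf.par hf.copr_eq, shuffleOp_br hg.par hg.copr_eq]

/-- The definition of `1 ⊗̂ s` by `dt_a · y ↦ dt_a · s(y)` remains valid with a Lie series `l` in place
of `t_a`, because `s` commutes with the adjoint action of Lie series. -/
theorem shuffleTilde_dmul {l : Series K I} (hl : l ∈ lieSeries (K := K) deg) (y : Series K I) :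
    shuffleTilde K deg (dmul deg l y) = dmul deg l (shuffleOp K deg y) :=
  lieSeries_ext (φ := fun l => shuffleTilde K deg (dmul deg l y))
    (ψ := fun l => dmul deg l (shuffleOp K deg y)) (by fun_prop) (by fun_prop)
    (fun _ _ h => h.shuffleTilde_dmul y) hl

/-- `s` intertwines through `1 - z` with `1 ⊗̂ s`. -/
theorem sub_zOp_shuffleTilde (f : Series K I) :
    shuffleTilde K deg f - zOp K deg (shuffleTilde K deg f) =
      shuffleOp K deg (f - zOp K deg f) := by
  refine ext_dmul_var (deg := deg) (φ := fun f => shuffleTilde K deg f -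
      zOp K deg (shuffleTilde K deg f)) (ψ := fun f => shuffleOp K deg (f - zOp K deg f))
    (by fun_prop) (by fun_prop) ?_ (fun a w => ?_) f
  · simp [shuffleTilde_mon_nil, zOp_mon_nil]
  · have h1 : shuffleTilde K deg (dmul deg (var a) (mon K w)) =
        dmul deg (var a) (shuffleOp K deg (mon K w)) := (IsLieMonomial.var a).shuffleTilde_dmul _
    have h2 : Par deg (wdeg deg [a]) (var a : Series K I) := par_mon [a]
    simp only [h1, dmul_sub_zOp_dmul deg h2]
    rw [shuffleOp_br h2 (copr_var deg a)]

/-! ### The norm operator and the shuffle operator -/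

variable (deg) in
/-- The bilinear operation `(p ⊗ q, y ⊗ y') ↦ (-1)^{|q||y|} dp · y q y'`. -/
def dmul4 (G H : Series2 K I) : Series K I :=
  dmul2 deg fun x => mulMap (cmul2 deg (tens (mon K []) fun v => G (x.1, v)) H) x.2

@[fun_prop] theorem isCL_dmul4_left {f : M → Series2 K I} (hf : IsCL K f) (H : Series2 K I) :
    IsCL K fun x => dmul4 deg (f x) H := by
  refine isCL_dmul2 deg (IsCL.of_pi fun x => isCL_eval _ (isCL_mulMap (isCL_cmul2_left deg
    (isCL_tens_right (IsCL.of_pi fun v => isCL_eval _ hf) _) _)))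

@[fun_prop] theorem isCL_dmul4_right {f : M → Series2 K I} (hf : IsCL K f) (G : Series2 K I) :
    IsCL K fun x => dmul4 deg G (f x) := by
  refine isCL_dmul2 deg (IsCL.of_pi fun x => isCL_eval _ (isCL_mulMap (isCL_cmul2_right deg
    hf _)))

theorem dmul4_mon (p q y y' : List I) : dmul4 deg (mon K (p, q)) (mon K (y, y')) =
    sgn (wdeg deg q * wdeg deg y) • dmul deg (mon K p) (mon K (y ++ q ++ y')) := by
  rw [← dmul_zsmul_right, ← dmul2_tens, dmul4]
  congr 1
  funext x
  obtain ⟨u, v⟩ := x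
  simp only [tens]
  have h1 : (fun v => mon K (p, q) (u, v)) = mon K p u • mon K q := by
    funext v
    simp [mon_pair, tens]
  have h2 := (isCL_tens_right (K := K) (I := I) IsCL.id' (mon K [])).smul
  have h3 := (isCL_cmul2_left (K := K) (I := I) deg IsCL.id' (mon K (y, y'))).smul
  have h4 := (isCL_mulMap (K := K) (I := I) IsCL.id').smul
  rw [h1, h2, h3, h4, ← mon_pair, cmul2_mon, (isCL_mulMap (K := K) (I := I) IsCL.id').zsmul,
    mulMap_mon]
  simp

theorem dmul4_zsmul_left (n : ℤ) (G H : Series2 K I) : dmul4 deg (n • G) H = n • dmul4 deg G H :=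
  (isCL_dmul4_left (K := K) (deg := deg) IsCL.id' H).zsmul n G

theorem dmul4_zsmul_right (n : ℤ) (G H : Series2 K I) : dmul4 deg G (n • H) = n • dmul4 deg G H :=
  (isCL_dmul4_right (K := K) (deg := deg) IsCL.id' G).zsmul n H

/-- The counterpart for `dmul4` of the Leibniz rule `dmul_var_cmul`. -/
theorem dmul4_prim_var (a : I) (G H : Series2 K I) :
    dmul4 deg (cmul2 deg (prim (var a)) G) H = cmul (var a) (mulMap (cmul2 deg G H)) +
      dmul4 deg (eps2 deg (wdeg deg [a]) G)
        (cmul2 deg (eps2 deg (wdeg deg [a]) H) (prim (var a))) := by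
  refine ext2 (φ := fun G => dmul4 deg (cmul2 deg (prim (var a)) G) H)
    (ψ := fun G => cmul (var a) (mulMap (cmul2 deg G H)) +
      dmul4 deg (eps2 deg (wdeg deg [a]) G)
        (cmul2 deg (eps2 deg (wdeg deg [a]) H) (prim (var a)))) (by fun_prop) (by fun_prop)
    (fun p q => ?_) G
  refine ext2 (φ := fun H => dmul4 deg (cmul2 deg (prim (var a)) _) H)
    (ψ := fun H => cmul (var a) (mulMap (cmul2 deg _ H)) +
      dmul4 deg (eps2 deg (wdeg deg [a]) _)
        (cmul2 deg (eps2 deg (wdeg deg [a]) H) (prim (var a)))) (by fun_prop) (by fun_prop)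
    (fun y y' => ?_) H
  have hal := fun H => (isCL_dmul4_left (K := K) (deg := deg) IsCL.id' H).add
  have har := fun G => (isCL_dmul4_right (K := K) (deg := deg) IsCL.id' G).add
  have hsmul := (isCL_mulMap (K := K) (I := I) IsCL.id').zsmul
  have e : ∀ w : List I, ([a] : List I) ++ w = a :: w := fun _ => rfl
  simp only [var_eq_mon, prim_mon, eps2_mon, add_cmul2, cmul2_add, zsmul_cmul2, cmul2_mon, hal, har,
    dmul4_zsmul_left, dmul4_zsmul_right, dmul4_mon, wdeg_nil, mul_zero, zero_mul, sgn_zero, one_smul, List.append_nil, List.nil_append, wdeg_append, hsmul, mulMap_mon,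
    cmul_zsmul, cmul_mon, e, dmul_mon_cons, smul_add, smul_smul, List.append_assoc]
  rw [wdeg_cons deg a q]
  simp only [mul_add, add_mul, sgn_add]
  rw [mul_comm (wdeg deg q) (wdeg deg [a]), mul_comm (wdeg deg y') (wdeg deg [a])]
  generalize sgn (wdeg deg [a] * wdeg deg p) = s₁
  generalize sgn (wdeg deg [a] * wdeg deg y) = s₂
  have h3 := sgn_mul_self (wdeg deg [a] * wdeg deg q)
  have h4 := sgn_mul_self (wdeg deg [a] * wdeg deg y')
  generalize sgn (wdeg deg [a] * wdeg deg q) = s₃ at *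
  generalize sgn (wdeg deg [a] * wdeg deg y') = s₄ at *
  generalize sgn (wdeg deg q * wdeg deg y) = s₅
  have e1 : s₂ * s₄ * s₄ * (s₁ * s₃ * (s₅ * s₃)) = s₁ * (s₂ * s₅) := by
    linear_combination (s₁ * s₂ * s₅ * (s₃ * s₃)) * h4 + s₁ * s₂ * s₅ * h3
  have e2 : s₂ * s₄ * (s₁ * s₃ * s₅) = s₅ * (s₁ * (s₂ * (s₃ * s₄))) := by ring
  rw [e1, e2]
  abel

/-- The extension of `(1 ⊗̂ s)(dt_a · y) = dt_a · s(y)` to `du · y` for arbitrary words `u`, by the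
Leibniz rules on both sides. -/
theorem shuffleTilde_dmul_mon (u : List I) (y : Series K I) :
    shuffleTilde K deg (dmul deg (mon K u) y) =
      dmul4 deg (copr deg (mon K u)) (copr deg y) := by
  induction u generalizing y with
  | nil =>
    have h : dmul4 deg (mon K ([], [])) (copr deg y) = 0 := by
      refine ext2 (φ := fun H => dmul4 deg (mon K ([], [])) H) (ψ := fun _ => 0) (by fun_prop)
        (by fun_prop) (fun p q => ?_) (copr deg y)
      simp [dmul4_mon, dmul_mon_nil]
    rw [dmul_mon_nil, map_zero, copr_mon_nil, h]
  | cons a u ih =>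
    have h1 : (mon K (a :: u) : Series K I) = cmul (var a) (mon K u) := by
      rw [var_eq_mon, cmul_mon]; rfl
    rw [h1, dmul_var_cmul, map_add, shuffleTilde_cmul_var, copr_cmul, copr_var, dmul4_prim_var,
      shuffleOp_eq, copr_cmul, eps2_copr, eps2_copr, ← copr_var deg a, ← copr_cmul, ← copr_cmul,
      eps_mon, dmul_zsmul_left, map_zsmul, ih, (isCL_copr (K := K) deg IsCL.id').zsmul, dmul4_zsmul_left]

theorem dmul4_one (G : Series2 K I) : dmul4 deg G (mon K ([], [])) = dmul2 deg G := by
  refine ext2 (φ := fun G => dmul4 deg G (mon K ([], []))) (ψ := fun G => dmul2 deg G)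
    (by fun_prop) (by fun_prop) (fun p q => ?_) G
  rw [dmul4_mon, mon_pair, dmul2_tens]
  simp [wdeg_nil, sgn_zero]

/-- `d(p q) = dp · q ± dq · p`. -/
theorem normOp_mulMap (G : Series2 K I) :
    normOp K deg (mulMap G) = dmul2 deg G + dmul2 deg (swap deg G) := by
  refine ext2 (φ := fun G => normOp K deg (mulMap G))
    (ψ := fun G => dmul2 deg G + dmul2 deg (swap deg G)) (by fun_prop) (by fun_prop)
    (fun p q => ?_) G
  rw [swap_mon, (isCL_dmul2 (K := K) deg IsCL.id').zsmul, mon_pair, mon_pair, dmul2_tens,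
    dmul2_tens, mulMap_tens, normOp_eq_dmul, dmul_cmul deg (par_mon p), cmul_mon_nil, eps_mon,
    eps_mon, wdeg_nil, mul_zero, sgn_zero, one_smul, mon_nil_cmul, dmul_zsmul_left]

/-- The de Rham differential halves the Hodge weight: `N s = 2 (1 ⊗̂ s) N`. -/
theorem normOp_shuffleOp (f : Series K I) :
    normOp K deg (shuffleOp K deg f) = (2 : ℤ) • shuffleTilde K deg (normOp K deg f) := by
  have h : shuffleTilde K deg (normOp K deg f) = dmul2 deg (copr deg f) := by
    refine IsCL.ext (φ := fun f => shuffleTilde K deg (normOp K deg f))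
      (ψ := fun f => dmul2 deg (copr deg f)) (by fun_prop) (by fun_prop) (fun u => ?_) f
    rw [normOp_eq_dmul, shuffleTilde_dmul_mon, copr_mon_nil, dmul4_one]
  rw [h, shuffleOp_eq, normOp_mulMap, swap_copr, two_smul]

end Primitive

/-! ### Compatibility of a `C_∞`-structure with the shuffle operator -/

section VectorField

variable {K I : Type*} [CommRing K] [Algebra ℚ K] {𝒦 : ℤ → Submodule ℚ K} [GradedAlgebra 𝒦]
  {deg : I → ℤ} [DecidableEq I] [TopologicalSpace K] [DiscreteTopology K]
  (A : AInfStructure 𝒦 deg)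

namespace AInfStructure

/-- The derivation `m ⊗ 1 ± 1 ⊗ m` of the tensor square. -/
def m2 (G : Series2 K I) : Series2 K I := fun x =>
  A.m (fun u => G (u, x.2)) x.1 + sgn (wdeg deg x.1) • A.m (fun v => G (x.1, v)) x.2

variable {M : Type*} [TopologicalSpace M] [AddCommGroup M] [Module K M]

@[fun_prop] theorem isCL_m2 {f : M → Series2 K I} (hf : IsCL K f) :
    IsCL K fun x => A.m2 (f x) := by
  refine IsCL.of_pi fun y => IsCL.add' (isCL_eval _ (isCL_m A (IsCL.of_pi fun u => isCL_eval _ hf)))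
    (IsCL.zsmul' _ (isCL_eval _ (isCL_m A (IsCL.of_pi fun u => isCL_eval _ hf))))

theorem m2_tens_mon (u : List I) (g : Series K I) : A.m2 (tens (mon K u) g) =
    tens (A.m (mon K u)) g + sgn (wdeg deg u) • tens (mon K u) (A.m g) := by
  funext x
  obtain ⟨a, b⟩ := x
  have h1 : (fun u' => tens (mon K u) g (u', b)) = g b • mon K u := by
    funext c; simp [tens, mul_comm]
  have h2 : (fun v' => tens (mon K u) g (a, v')) = mon K u a • g := by
    funext c; simp [tens]
  simp only [m2, h1, h2, map_smul]
  by_cases h : a = u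
  · subst h
    simp [tens, mon_apply, mul_comm]
  · simp [tens, mon_apply, h, mul_comm]

theorem mulMap_m2 (G : Series2 K I) : mulMap (A.m2 G) = A.m (mulMap G) := by
  refine ext2 (φ := fun G => mulMap (A.m2 G)) (ψ := fun G => A.m (mulMap G)) (by fun_prop)
    (by fun_prop) (fun p q => ?_) G
  rw [mon_pair, m2_tens_mon, mulMap_tens, m_cmul, (isCL_mulMap (K := K) IsCL.id').add,
    (isCL_mulMap (K := K) IsCL.id').zsmul, mulMap_tens, mulMap_tens, eps_mon, one_mul, zsmul_cmul]

variable (heven : ∀ n, Odd n → 𝒦 n = ⊥)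

include heven

theorem m2_cmul2 (F G : Series2 K I) :
    A.m2 (cmul2 deg F G) = cmul2 deg (A.m2 F) G + cmul2 deg (eps2 deg 1 F) (A.m2 G) := by
  refine ext2 (φ := fun F => A.m2 (cmul2 deg F G))
    (ψ := fun F => cmul2 deg (A.m2 F) G + cmul2 deg (eps2 deg 1 F) (A.m2 G)) (by fun_prop)
    (by fun_prop) (fun p q => ?_) F
  refine ext2 (φ := fun G => A.m2 (cmul2 deg _ G))
    (ψ := fun G => cmul2 deg (A.m2 _) G + cmul2 deg (eps2 deg 1 _) (A.m2 G)) (by fun_prop)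
    (by fun_prop) (fun p' q' => ?_) G
  have ha := (isCL_tens_left (K := K) (I := I) IsCL.id')
  have hb := (isCL_tens_right (K := K) (I := I) IsCL.id')
  have e1 : cmul2 deg (tens (A.m (mon K p)) (mon K q)) (tens (mon K p') (mon K q')) =
      sgn (wdeg deg q * wdeg deg p') • tens (cmul (A.m (mon K p)) (mon K p')) (mon K (q ++ q')) := by
    rw [cmul2_tens deg (par_mon q), eps_mon, cmul_zsmul, zsmul_tens, cmul_mon]
  have e2 : cmul2 deg (tens (mon K p) (A.m (mon K q))) (tens (mon K p') (mon K q')) =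
      (sgn (wdeg deg q * wdeg deg p') * sgn (wdeg deg p')) •
        tens (mon K (p ++ p')) (cmul (A.m (mon K q)) (mon K q')) := by
    rw [cmul2_tens deg (A.par_m_mon heven q), eps_mon, cmul_zsmul, zsmul_tens, cmul_mon, add_mul,
      one_mul, sgn_add]
  have e3 : cmul2 deg (tens (mon K p) (mon K q)) (tens (A.m (mon K p')) (mon K q')) =
      (sgn (wdeg deg q * wdeg deg p') * sgn (wdeg deg q)) •
        tens (cmul (mon K p) (A.m (mon K p'))) (mon K (q ++ q')) := by
    rw [cmul2_tens deg (par_mon q), eps_eq_of_par (A.par_m_mon heven p'), cmul_zsmul, zsmul_tens,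
      cmul_mon, mul_add, mul_one, sgn_add]
  have e4 : cmul2 deg (tens (mon K p) (mon K q)) (tens (mon K p') (A.m (mon K q'))) =
      sgn (wdeg deg q * wdeg deg p') •
        tens (mon K (p ++ p')) (cmul (mon K q) (A.m (mon K q'))) := by
    rw [cmul2_tens deg (par_mon q), eps_mon, cmul_zsmul, zsmul_tens, cmul_mon]
  rw [cmul2_mon, eps2_mon, (isCL_m2 A IsCL.id').zsmul, mon_pair, mon_pair, mon_pair, m2_tens_mon,
    m2_tens_mon, m2_tens_mon, add_cmul2, zsmul_cmul2, zsmul_cmul2, cmul2_add, cmul2_zsmul, e1, e2,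
    e3, e4, ← cmul_mon p p', ← cmul_mon q q', m_cmul, m_cmul, (ha _).add, (hb _).add, eps_mon,
    eps_mon, zsmul_cmul, zsmul_cmul, zsmul_tens, tens_zsmul, cmul_mon, cmul_mon, wdeg_append,
    one_mul, one_mul, one_mul, sgn_add, sgn_add]
  simp only [smul_add, smul_smul]
  -- both sides are combinations of the same four tensors, whose signs are compared case by case
  rcases sgn_eq_or (wdeg deg p) with h1 | h1 <;> rcases sgn_eq_or (wdeg deg q) with h2 | h2 <;>
    rcases sgn_eq_or (wdeg deg p') with h3 | h3 <;>
    rcases sgn_eq_or (wdeg deg q * wdeg deg p') with h4 | h4 <;>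
    simp only [h1, h2, h3, h4, one_smul, neg_smul, mul_one, mul_neg, neg_neg] <;> abel

omit heven in
theorem m2_prim (a : I) : A.m2 (prim (var a)) = prim (A.m (var a)) := by
  have hb := (isCL_tens_right (K := K) (I := I) IsCL.id' (mon K [a])).zero
  have ha := (isCL_tens_left (K := K) (I := I) IsCL.id' (mon K [a])).zero
  rw [prim, (isCL_m2 A IsCL.id').add, var_eq_mon, m2_tens_mon, m2_tens_mon, m_mon_nil, wdeg_nil,
    sgn_zero, one_smul, hb, ha, smul_zero, add_zero, zero_add, prim]

variable {A} (hC : A.IsCInf)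

include hC

omit heven in
theorem IsCInf.m_var_mem (a : I) : A.m (var a) ∈ lieSeries (K := K) deg := by
  refine hC _ fun F => ⟨var a, Submodule.subset_span ⟨_, .var a⟩, fun _ _ => rfl⟩

/-- Since the series `m(t_a)` are primitive, `m` is a coderivation. -/
theorem IsCInf.copr_m (f : Series K I) : copr deg (A.m f) = A.m2 (copr deg f) := by
  refine IsCL.ext (φ := fun f => copr deg (A.m f)) (ψ := fun f => A.m2 (copr deg f))
    (by fun_prop) (by fun_prop) (fun u => ?_) f
  induction u with
  | nil =>
    rw [m_mon_nil, (isCL_copr (K := K) deg IsCL.id').zero, copr_mon_nil, mon_pair, m2_tens_mon,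
      m_mon_nil]
    funext x
    simp [tens]
  | cons a u ih =>
    have h1 : (mon K (a :: u) : Series K I) = cmul (var a) (mon K u) := by
      rw [var_eq_mon, cmul_mon]; rfl
    rw [h1, m_cmul, (isCL_copr (K := K) deg IsCL.id').add, copr_cmul, copr_cmul, copr_cmul,
      m2_cmul2 A heven, ih, copr_lieSeries (hC.m_var_mem a), copr_var, m2_prim, ← copr_var,
      eps2_copr]

/-- A `C_∞`-structure commutes with the modified shuffle operator. -/
theorem IsCInf.m_shuffleOp (f : Series K I) :
    A.m (shuffleOp K deg f) = shuffleOp K deg (A.m f) := by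
  rw [shuffleOp_eq, shuffleOp_eq, hC.copr_m heven, mulMap_m2]

/-- The Hochschild differential of a `C_∞`-structure commutes with `1 ⊗̂ s`. -/
theorem IsCInf.b_shuffleTilde (f : Series K I) :
    A.b (shuffleTilde K deg f) = shuffleTilde K deg (A.b f) := by
  refine ext_dmul_var (deg := deg) (φ := fun f => A.b (shuffleTilde K deg f))
    (ψ := fun f => shuffleTilde K deg (A.b f)) (by fun_prop) (by fun_prop) ?_ (fun a w => ?_) f
  · simp [shuffleTilde_mon_nil, b_mon_nil]
  · simp only [dmul_var, b_cmul_var, shuffleTilde_cmul_var, map_sub, map_neg, map_zsmul,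
      shuffleTilde_dmul (hC.m_var_mem a), hC.m_shuffleOp heven]

end AInfStructure

end VectorField

/-! ### The eigenvalues of the modified shuffle operator -/

section Filtration

variable (K : Type*) {I : Type*} [CommRing K] (deg : I → ℤ) [DecidableEq I]

/-- The span of the products of fewer than `n` primitive elements. -/
def primFil : ℕ → Submodule K (Series K I)
  | 0 => ⊥
  | n + 1 => Submodule.span K ({mon K []} ∪ {x | ∃ (p : ℤ) (l y : Series K I), Par deg p l ∧
      copr deg l = prim l ∧ y ∈ primFil n ∧ x = cmul l y})

variable {K deg}

theorem mon_nil_mem_primFil (n : ℕ) : (mon K [] : Series K I) ∈ primFil K deg (n + 1) :=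
  Submodule.subset_span (Or.inl rfl)

theorem cmul_mem_primFil_succ {n : ℕ} {p : ℤ} {l y : Series K I} (hl : Par deg p l)
    (hprim : copr deg l = prim l) (hy : y ∈ primFil K deg n) :
    cmul l y ∈ primFil K deg (n + 1) :=
  Submodule.subset_span (Or.inr ⟨p, l, y, hl, hprim, hy, rfl⟩)

/-- Induction over products of primitive elements. -/
theorem primFil_induction {n : ℕ} {P : Series K I → Prop} (h0 : P 0)
    (hadd : ∀ x y, P x → P y → P (x + y)) (hsmul : ∀ (c : K) x, P x → P (c • x))
    (hone : P (mon K []))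
    (hmul : ∀ (p : ℤ) (l y : Series K I), Par deg p l → copr deg l = prim l →
      y ∈ primFil K deg n → P (cmul l y)) {x : Series K I} (hx : x ∈ primFil K deg (n + 1)) :
    P x := by
  induction hx using Submodule.span_induction with
  | mem x hx =>
    rcases hx with rfl | ⟨p, l, y, hl, hprim, hy, rfl⟩
    · exact hone
    · exact hmul p l y hl hprim hy
  | zero => exact h0
  | add x y _ _ hx hy => exact hadd x y hx hy
  | smul c x _ hx => exact hsmul c x hx

theorem primFil_mono : Monotone (primFil K deg) := by
  refine monotone_nat_of_le_succ fun n => ?_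
  induction n with
  | zero => exact bot_le
  | succ n ih =>
    intro x hx
    exact primFil_induction (Submodule.zero_mem _) (fun _ _ => Submodule.add_mem _)
      (fun c _ => Submodule.smul_mem _ c) (mon_nil_mem_primFil _)
      (fun p l y hl hprim hy => cmul_mem_primFil_succ hl hprim (ih hy)) hx

variable [TopologicalSpace K] [DiscreteTopology K]

theorem mon_mem_primFil (w : List I) : (mon K w : Series K I) ∈ primFil K deg (w.length + 1) := by
  induction w with
  | nil => exact mon_nil_mem_primFil 0
  | cons a w ih =>
    have h1 : (mon K (a :: w) : Series K I) = cmul (var a) (mon K w) := by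
      rw [var_eq_mon, cmul_mon]; rfl
    rw [h1]
    exact cmul_mem_primFil_succ (par_mon [a]) (copr_var deg a) ih

theorem eps_mem_primFil (q : ℤ) {n : ℕ} {x : Series K I} (hx : x ∈ primFil K deg n) :
    eps deg q x ∈ primFil K deg n := by
  have he := isCL_eps (K := K) (deg := deg) q IsCL.id'
  induction n generalizing x with
  | zero =>
    rw [(Submodule.mem_bot K).1 hx, he.zero]
    exact Submodule.zero_mem _
  | succ n ih =>
    refine primFil_induction (P := fun x => eps deg q x ∈ primFil K deg (n + 1)) ?_ ?_ ?_ ?_ ?_ hx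
    · rw [he.zero]; exact Submodule.zero_mem _
    · intro x y hx hy; rw [he.add]; exact Submodule.add_mem _ hx hy
    · intro c x hx; rw [he.smul]; exact Submodule.smul_mem _ c hx
    · rw [eps_mon]; exact zsmul_mem (mon_nil_mem_primFil n) _
    · intro p l y hl hprim hy
      rw [eps_cmul, eps_eq_of_par hl, zsmul_cmul]
      exact zsmul_mem (cmul_mem_primFil_succ hl hprim (ih hy)) _

theorem cmul_mem_primFil {i j : ℕ} {x y : Series K I} (hx : x ∈ primFil K deg (i + 1))
    (hy : y ∈ primFil K deg (j + 1)) : cmul x y ∈ primFil K deg (i + j + 1) := by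
  induction i generalizing x with
  | zero =>
    refine primFil_induction (P := fun x => cmul x y ∈ _) ?_ ?_ ?_ ?_ ?_ hx
    · rw [zero_cmul]; exact Submodule.zero_mem _
    · intro x z hx hz; rw [add_cmul]; exact Submodule.add_mem _ hx hz
    · intro c x hx; rw [(isCL_cmul_left (K := K) IsCL.id' y).smul]
      exact Submodule.smul_mem _ c hx
    · rw [mon_nil_cmul, zero_add]; exact hy
    · intro p l z hl hprim hz
      rw [(Submodule.mem_bot K).1 hz, cmul_zero, zero_cmul]; exact Submodule.zero_mem _
  | succ i ih =>
    refine primFil_induction (P := fun x => cmul x y ∈ _) ?_ ?_ ?_ ?_ ?_ hx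
    · rw [zero_cmul]; exact Submodule.zero_mem _
    · intro x z hx hz; rw [add_cmul]; exact Submodule.add_mem _ hx hz
    · intro c x hx; rw [(isCL_cmul_left (K := K) IsCL.id' y).smul]
      exact Submodule.smul_mem _ c hx
    · rw [mon_nil_cmul]; exact primFil_mono (by omega) hy
    · intro p l z hl hprim hz
      rw [cmul_assoc, show i + 1 + j + 1 = (i + j + 1) + 1 by ring]
      exact cmul_mem_primFil_succ hl hprim (ih hz)

theorem br_mem_primFil {n : ℕ} {p : ℤ} {l y : Series K I} (hl : Par deg p l)
    (hprim : copr deg l = prim l) (hy : y ∈ primFil K deg n) :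
    br deg p l y ∈ primFil K deg n := by
  have hb := isCL_br_right (K := K) deg p IsCL.id' l
  induction n generalizing y with
  | zero =>
    rw [(Submodule.mem_bot K).1 hy, hb.zero]
    exact Submodule.zero_mem _
  | succ n ih =>
    refine primFil_induction (P := fun y => br deg p l y ∈ primFil K deg (n + 1)) ?_ ?_ ?_ ?_ ?_ hy
    · rw [hb.zero]; exact Submodule.zero_mem _
    · intro x y hx hy; rw [hb.add]; exact Submodule.add_mem _ hx hy
    · intro c x hx; rw [hb.smul]; exact Submodule.smul_mem _ c hx
    · rw [br, eps_mon, wdeg_nil, mul_zero, sgn_zero, one_smul, mon_nil_cmul, cmul_mon_nil, sub_self]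
      exact Submodule.zero_mem _
    · intro q l' y hl' hprim' hy
      -- `ad l` is a derivation
      have h1 : br deg p l (cmul l' y) = cmul (bracket p q l l') y +
          sgn (p * q) • cmul l' (br deg p l y) := by
        rw [← br_eq_bracket deg hl', br, br, br, eps_cmul, eps_eq_of_par hl']
        simp only [sub_cmul, cmul_sub, zsmul_cmul, cmul_assoc, smul_sub]
        abel
      rw [h1]
      exact Submodule.add_mem _
        (cmul_mem_primFil_succ (par_bracket hl hl') (prim_bracket hl hl' hprim hprim') hy)
        (zsmul_mem (cmul_mem_primFil_succ hl' hprim' (ih hy)) _)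

variable (K deg) in
/-- The filtration of the tensor square induced by `primFil`. -/
def primFil2 (n : ℕ) : Submodule K (Series2 K I) :=
  Submodule.span K {x | ∃ (i j : ℕ) (p q : Series K I), i + j ≤ n ∧ p ∈ primFil K deg (i + 1) ∧
    q ∈ primFil K deg (j + 1) ∧ x = tens p q}

theorem copr_mem_primFil2 {n : ℕ} {y : Series K I} (hy : y ∈ primFil K deg (n + 1)) :
    copr deg y ∈ primFil2 K deg n := by
  have hc := isCL_copr (K := K) deg IsCL.id'
  have hone : ∀ n, copr deg (mon K []) ∈ primFil2 K deg n := fun n => by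
    rw [copr_mon_nil, mon_pair]
    exact Submodule.subset_span ⟨0, 0, _, _, by omega, mon_nil_mem_primFil 0,
      mon_nil_mem_primFil 0, rfl⟩
  induction n generalizing y with
  | zero =>
    refine primFil_induction (P := fun y => copr deg y ∈ primFil2 K deg 0) ?_ ?_ ?_ (hone 0) ?_ hy
    · rw [hc.zero]; exact Submodule.zero_mem _
    · intro x y hx hy; rw [hc.add]; exact Submodule.add_mem _ hx hy
    · intro c x hx; rw [hc.smul]; exact Submodule.smul_mem _ c hx
    · intro p l z hl hprim hz
      rw [(Submodule.mem_bot K).1 hz, cmul_zero, hc.zero]; exact Submodule.zero_mem _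
  | succ n ih =>
    refine primFil_induction (P := fun y => copr deg y ∈ primFil2 K deg (n + 1)) ?_ ?_ ?_
      (hone _) ?_ hy
    · rw [hc.zero]; exact Submodule.zero_mem _
    · intro x y hx hy; rw [hc.add]; exact Submodule.add_mem _ hx hy
    · intro c x hx; rw [hc.smul]; exact Submodule.smul_mem _ c hx
    · intro p l z hl hprim hz
      rw [copr_cmul, hprim]
      have h1 := ih hz
      generalize copr deg z = G at h1
      have hm := isCL_cmul2_right (K := K) deg IsCL.id' (prim l)
      induction h1 using Submodule.span_induction with
      | mem x hx =>
        obtain ⟨i, j, u, v, hij, hu, hv, rfl⟩ := hx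
        rw [prim, add_cmul2, cmul2_tens deg (par_mon []), cmul2_tens deg hl, mon_nil_cmul,
          mon_nil_cmul, wdeg_nil, eps_of_even sgn_zero]
        refine Submodule.add_mem _ (Submodule.subset_span ?_) (Submodule.subset_span ?_)
        · exact ⟨i + 1, j, _, _, by omega, cmul_mem_primFil_succ hl hprim hu, hv, rfl⟩
        · exact ⟨i, j + 1, _, _, by omega, eps_mem_primFil p hu,
            cmul_mem_primFil_succ hl hprim hv, rfl⟩
      | zero => rw [hm.zero]; exact Submodule.zero_mem _
      | add x y _ _ hx hy => rw [hm.add]; exact Submodule.add_mem _ hx hy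
      | smul c x _ hx => rw [hm.smul]; exact Submodule.smul_mem _ c hx

/-- `s` acts as `2^n` on products of `n` primitive elements, modulo shorter products. -/
theorem shuffleOp_sub_mem_primFil {n : ℕ} {x : Series K I} (hx : x ∈ primFil K deg (n + 1)) :
    shuffleOp K deg x - (2 : K) ^ n • x ∈ primFil K deg n := by
  have hone : shuffleOp K deg (mon K ([] : List I)) = mon K [] := by
    rw [shuffleOp_eq, copr_mon_nil, mulMap_mon, List.append_nil]
  induction n generalizing x with
  | zero =>
    refine primFil_induction (P := fun x => shuffleOp K deg x - (2 : K) ^ 0 • x ∈ primFil K deg 0)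
      ?_ ?_ ?_ ?_ ?_ hx
    · simp
    · intro x y hx hy
      rw [map_add, smul_add, add_sub_add_comm]
      exact Submodule.add_mem _ hx hy
    · intro c x hx
      rw [map_smul, smul_comm, ← smul_sub]
      exact Submodule.smul_mem _ c hx
    · simp [hone]
    · intro p l z hl hprim hz
      rw [(Submodule.mem_bot K).1 hz, cmul_zero]; simp
  | succ n ih =>
    refine primFil_induction (P := fun x => shuffleOp K deg x - (2 : K) ^ (n + 1) • x ∈
      primFil K deg (n + 1)) ?_ ?_ ?_ ?_ ?_ hx
    · simp
    · intro x y hx hy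
      rw [map_add, smul_add, add_sub_add_comm]
      exact Submodule.add_mem _ hx hy
    · intro c x hx
      rw [map_smul, smul_comm, ← smul_sub]
      exact Submodule.smul_mem _ c hx
    · rw [hone]
      exact Submodule.sub_mem _ (mon_nil_mem_primFil n)
        (Submodule.smul_mem _ _ (mon_nil_mem_primFil n))
    · intro p l y hl hprim hy
      -- moving `l` to the front of `μ ((1 ⊗ l) Δ y)` costs only shorter products
      have h1 : ∀ G ∈ primFil2 K deg n, mulMap (cmul2 deg (prim l) G) -
          (2 : K) • cmul l (mulMap G) ∈ primFil K deg (n + 1) := by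
        intro G hG
        have hm : IsCL K fun G => mulMap (cmul2 deg (prim l) G) := by fun_prop
        have hm' : IsCL K fun G => cmul l (mulMap G) := by fun_prop
        induction hG using Submodule.span_induction with
        | mem x hx =>
          obtain ⟨i, j, u, v, hij, hu, hv, rfl⟩ := hx
          have h2 : mulMap (cmul2 deg (prim l) (tens u v)) - (2 : K) • cmul l (mulMap (tens u v)) =
              - cmul (br deg p l u) v := by
            rw [prim, add_cmul2, cmul2_tens deg (par_mon []), cmul2_tens deg hl, mon_nil_cmul,
              mon_nil_cmul, wdeg_nil, eps_of_even sgn_zero, (isCL_mulMap IsCL.id').add,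
              mulMap_tens, mulMap_tens, mulMap_tens, two_smul, br, sub_cmul, cmul_assoc, cmul_assoc]
            abel
          rw [h2]
          exact Submodule.neg_mem _ (primFil_mono (by omega)
            (cmul_mem_primFil (br_mem_primFil hl hprim hu) hv))
        | zero => rw [hm.zero, hm'.zero]; simp
        | add x y _ _ hx hy =>
          rw [hm.add, hm'.add, smul_add, add_sub_add_comm]
          exact Submodule.add_mem _ hx hy
        | smul c x _ hx =>
          rw [hm.smul, hm'.smul, smul_comm, ← smul_sub]
          exact Submodule.smul_mem _ c hx
      have h3 : shuffleOp K deg (cmul l y) - (2 : K) ^ (n + 1) • cmul l y =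
          (mulMap (cmul2 deg (prim l) (copr deg y)) - (2 : K) • cmul l (mulMap (copr deg y))) +
            (2 : K) • cmul l (shuffleOp K deg y - (2 : K) ^ n • y) := by
        have hc := isCL_cmul_right (K := K) IsCL.id' l
        rw [cmul_sub, hc.smul, shuffleOp_eq, shuffleOp_eq, copr_cmul, hprim, smul_sub, smul_smul,
          pow_succ']
        abel
      rw [h3]
      exact Submodule.add_mem _ (h1 _ (copr_mem_primFil2 hy))
        (Submodule.smul_mem _ _ (cmul_mem_primFil_succ hl hprim (ih hy)))

end Filtration

/-! ### Polynomials in the shuffle operator and the Hodge idempotents -/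

section Idempotents

open Polynomial

variable {K I : Type*} [CommRing K] [Algebra ℚ K] (deg : I → ℤ)

theorem map_aeval_of_comm {M N : Type*} [AddCommGroup M] [Module K M] [AddCommGroup N] [Module K N]
    [Module ℚ M] [Module ℚ N] [IsScalarTower ℚ K M] [IsScalarTower ℚ K N]
    (φ : M →ₗ[K] N) (s : Module.End K M) (t : Module.End K N) (h : ∀ x, φ (s x) = t (φ x))
    (Q : ℚ[X]) (x : M) : φ (aeval s Q x) = aeval t Q (φ x) := by
  induction Q using Polynomial.induction_on' generalizing x with
  | add p q hp hq => simp [hp, hq]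
  | monomial n c =>
    have hn : ∀ n x, φ ((s ^ n) x) = (t ^ n) (φ x) := by
      intro n
      induction n with
      | zero => intro x; rfl
      | succ n ih => intro x; rw [pow_succ, pow_succ, Module.End.mul_apply, Module.End.mul_apply,
          ih, h]
    simp only [aeval_monomial, Module.End.mul_apply, Module.algebraMap_end_apply]
    rw [map_rat_smul φ, hn]

/-- A property of series which passes to sums, rational multiples and images under `s` passes to
images under polynomials in `s`. -/
theorem aeval_induction {M : Type*} [AddCommGroup M] [Module K M] [Module ℚ M]
    [IsScalarTower ℚ K M] (s : Module.End K M)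
    {P : M → Prop} (hadd : ∀ x y, P x → P y → P (x + y)) (hsmul : ∀ (c : ℚ) x, P x → P (c • x))
    (hs : ∀ x, P x → P (s x)) (Q : ℚ[X]) {x : M} (hx : P x) : P (aeval s Q x) := by
  induction Q using Polynomial.induction_on' with
  | add p q hp hq => rw [map_add]; exact hadd _ _ hp hq
  | monomial n c =>
    have hn : ∀ n, P ((s ^ n) x) := by
      intro n
      induction n with
      | zero => exact hx
      | succ n ih => rw [pow_succ', Module.End.mul_apply]; exact hs _ ih
    simp only [aeval_monomial, Module.End.mul_apply, Module.algebraMap_end_apply]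
    exact hsmul _ _ (hn n)

theorem shuffleOp_mem_homog {𝒦 : ℤ → Submodule ℚ K} [GradedAlgebra 𝒦] {n : ℤ} {f : Series K I}
    (hf : f ∈ homog 𝒦 deg n) : shuffleOp K deg f ∈ homog 𝒦 deg n := by
  intro w
  simp only [shuffleOp, LinearMap.coe_mk, AddHom.coe_mk, Finsupp.sum]
  refine Submodule.sum_mem _ fun k _ => Submodule.sum_mem _ fun p hp => zsmul_mem ?_ _
  have h := hf p
  rwa [wdeg_of_mem_shuffle deg hp, ← wdeg_append, List.take_append_drop] at h

/-- The coefficients of `f` vanish at all words whose length is not `n`. -/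
def LengthSupported (n : ℕ) (f : Series K I) : Prop := ∀ v, v.length ≠ n → f v = 0

theorem LengthSupported.shuffleOp {n : ℕ} {f : Series K I} (hf : LengthSupported n f) :
    LengthSupported n (shuffleOp K deg f) := by
  intro v hv
  simp only [CInfHodge.shuffleOp, LinearMap.coe_mk, AddHom.coe_mk, Finsupp.sum]
  refine Finset.sum_eq_zero fun k _ => Finset.sum_eq_zero fun p hp => ?_
  have h := (perm_of_mem_shuffle deg _ _ p hp).length_eq
  rw [List.take_append_drop] at h
  simp only [hf p (by rw [h]; exact hv), smul_zero]

theorem LengthSupported.aeval {n : ℕ} {f : Series K I} (hf : LengthSupported n f) (Q : ℚ[X]) :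
    LengthSupported n (aeval (CInfHodge.shuffleOp K deg) Q f) :=
  aeval_induction _ (P := LengthSupported n)
    (fun x y hx hy v hv => by simp [hx v hv, hy v hv])
    (fun c x hx v hv => by simp [hx v hv]) (fun x hx => hx.shuffleOp deg) Q hf

variable [DecidableEq I]

theorem lengthSupported_mon (w : List I) : LengthSupported w.length (mon K w) := by
  intro v hv
  have : v ≠ w := by rintro rfl; exact hv rfl
  simp [mon_apply, this]

variable [TopologicalSpace K] [DiscreteTopology K]

/-- Since `s - 2^r` lowers the filtration from level `r + 1` to level `r`, the polynomial
`∏_{r < n} (s - 2^r)` annihilates products of fewer than `n` primitive elements. -/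
theorem aeval_prod_eq_zero {n : ℕ} {x : Series K I} (hx : x ∈ primFil K deg n) :
    aeval (shuffleOp K deg) (∏ r ∈ Finset.range n, (X - C ((2 : ℚ) ^ r))) x = 0 := by
  induction n generalizing x with
  | zero => simpa using (Submodule.mem_bot K).1 hx
  | succ n ih =>
    rw [Finset.prod_range_succ, map_mul, Module.End.mul_apply]
    refine ih ?_
    have h := shuffleOp_sub_mem_primFil hx
    have e : ((2 : ℚ) ^ n) • x = (2 : K) ^ n • x := by
      rw [← algebraMap_smul K ((2 : ℚ) ^ n) x, map_pow, map_ofNat]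
    rw [map_sub, aeval_X, aeval_C, LinearMap.sub_apply, Module.algebraMap_end_apply, e]
    exact h

/-- Polynomials with the same values at `2^0, …, 2^n` differ by a multiple of the polynomial
`∏_{r ≤ n} (X - 2^r)`, which annihilates words of length `n`. -/
theorem aeval_mon_congr {w : List I} {Q R : ℚ[X]}
    (h : ∀ r ≤ w.length, Q.eval ((2 : ℚ) ^ r) = R.eval ((2 : ℚ) ^ r)) :
    aeval (shuffleOp K deg) Q (mon K w) = aeval (shuffleOp K deg) R (mon K w) := by
  have hdvd : ∏ r ∈ Finset.range (w.length + 1), (X - C ((2 : ℚ) ^ r)) ∣ Q - R := by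
    refine Finset.prod_dvd_of_coprime ?_ fun r hr => ?_
    · exact fun a _ b _ hab => pairwise_coprime_X_sub_C
        (pow_right_injective₀ (by norm_num) (by norm_num)) hab
    · rw [dvd_iff_isRoot, IsRoot, eval_sub, h r (by simpa [Nat.lt_succ_iff] using hr), sub_self]
  obtain ⟨S, hS⟩ := hdvd
  rw [← sub_eq_zero, ← LinearMap.sub_apply, ← map_sub, hS, mul_comm, map_mul, Module.End.mul_apply,
    aeval_prod_eq_zero deg (mon_mem_primFil w), map_zero]

variable {M : Type*} [TopologicalSpace M] [AddCommGroup M] [Module K M]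

@[fun_prop] theorem isCL_aeval (Q : ℚ[X]) {f : M → Series K I} (hf : IsCL K f) :
    IsCL K fun x => aeval (shuffleOp K deg) Q (f x) := by
  induction Q using Polynomial.induction_on' with
  | add p q hp hq => simp only [map_add, LinearMap.add_apply]; fun_prop
  | monomial n c =>
    have hn : ∀ n, IsCL K fun x => (shuffleOp K deg ^ n) (f x) := by
      intro n
      induction n with
      | zero => exact hf
      | succ n ih => simp only [pow_succ', Module.End.mul_apply]; fun_prop
    simp only [aeval_monomial, Module.End.mul_apply, Module.algebraMap_end_apply]
    exact IsCL.of_pi fun w => isCL_qsmul _ (isCL_eval w (hn n))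

/-- The action of a polynomial in `s` in a given length depends only on its values at the
eigenvalues. -/
theorem aeval_congr {v : List I} {Q R : ℚ[X]}
    (h : ∀ r ≤ v.length, Q.eval ((2 : ℚ) ^ r) = R.eval ((2 : ℚ) ^ r)) (f : Series K I) :
    aeval (shuffleOp K deg) Q f v = aeval (shuffleOp K deg) R f v := by
  refine IsCL.ext (φ := fun f => aeval (shuffleOp K deg) Q f v)
    (ψ := fun f => aeval (shuffleOp K deg) R f v) (isCL_eval _ (by fun_prop))
    (isCL_eval _ (by fun_prop)) (fun w => ?_) f
  by_cases hvw : v.length = w.length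
  · rw [hvw] at h
    rw [aeval_mon_congr deg h]
  · rw [(lengthSupported_mon w).aeval deg Q v hvw, (lengthSupported_mon w).aeval deg R v hvw]

/-- `Q` interpolates the indicator function of the eigenvalue `2^j` among `2^0, …, 2^n`. -/
def IsHodgePoly (n j : ℕ) (Q : ℚ[X]) : Prop :=
  ∀ r ≤ n, Q.eval ((2 : ℚ) ^ r) = if r = j then 1 else 0

theorem isHodgePoly_lagrangeBasis {n j : ℕ} (hj : j ≤ n) :
    IsHodgePoly n j (Lagrange.basis (Finset.range (n + 1)) (fun r : ℕ => (2 : ℚ) ^ r) j) := by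
  intro r hr
  by_cases h : r = j
  · subst h
    rw [if_pos rfl]
    exact Lagrange.eval_basis_self (pow_right_injective₀ (by norm_num) (by norm_num)).injOn
      (by simpa [Nat.lt_succ_iff] using hr)
  · rw [if_neg h]
    exact Lagrange.eval_basis_of_ne (v := fun r : ℕ => (2 : ℚ) ^ r) (Ne.symm h)
      (by simpa [Nat.lt_succ_iff] using hr)

theorem exists_isHodgePoly (n j : ℕ) : ∃ Q, IsHodgePoly n j Q := by
  by_cases hj : j ≤ n
  · exact ⟨_, isHodgePoly_lagrangeBasis hj⟩
  · exact ⟨0, fun r hr => by rw [if_neg (by omega), eval_zero]⟩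

theorem IsHodgePoly.mono {n n' j : ℕ} {Q : ℚ[X]} (h : IsHodgePoly n j Q) (hn : n' ≤ n) :
    IsHodgePoly n' j Q := fun r hr => h r (hr.trans hn)

/-- The definition of `e(j)` uses an interpolation polynomial depending on the length; any polynomial
interpolating at sufficiently many eigenvalues gives the same coefficient.  The convention `e(j) = 0`
on words of length less than `j` is consistent with this. -/
theorem eOp_apply {j : ℕ} {v : List I} {Q : ℚ[X]} (hQ : IsHodgePoly v.length j Q)
    (f : Series K I) : eOp K deg j f v = aeval (shuffleOp K deg) Q f v := by
  by_cases hj : j ≤ v.length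
  · simp only [eOp, LinearMap.coe_mk, AddHom.coe_mk, hj, if_true]
    refine aeval_congr deg (fun r hr => ?_) f
    rw [hQ r hr, isHodgePoly_lagrangeBasis hj r hr]
  · simp only [eOp, LinearMap.coe_mk, AddHom.coe_mk, hj, if_false]
    have h0 := aeval_congr (K := K) deg (v := v) (Q := Q) (R := 0) (fun r hr => by
      rw [hQ r hr, if_neg (by omega), eval_zero]) f
    rw [h0]
    simp

theorem eOp_mon {j : ℕ} {w : List I} {Q : ℚ[X]} (hQ : IsHodgePoly w.length j Q) :
    eOp K deg j (mon K w) = aeval (shuffleOp K deg) Q (mon K w) := by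
  funext v
  by_cases hvw : v.length = w.length
  · rw [← hvw] at hQ
    exact eOp_apply deg hQ _
  · obtain ⟨R, hR⟩ := exists_isHodgePoly v.length j
    rw [eOp_apply deg hR, (lengthSupported_mon w).aeval deg Q v hvw,
      (lengthSupported_mon w).aeval deg R v hvw]

@[fun_prop] theorem isCL_eOp (j : ℕ) {f : M → Series K I} (hf : IsCL K f) :
    IsCL K fun x => eOp K deg j (f x) := by
  refine IsCL.of_pi fun v => ?_
  obtain ⟨R, hR⟩ := exists_isHodgePoly v.length j
  simp only [eOp_apply deg hR]
  exact isCL_eval _ (by fun_prop)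

theorem lquot_eTilde (j : ℕ) (a : I) (f : Series K I) :
    lquot a (eTilde K deg j f) = eOp K deg j (lquot a f) := rfl

theorem eTilde_nil (j : ℕ) (f : Series K I) : eTilde K deg j f [] = 0 := rfl

theorem eTilde_cons (j : ℕ) (f : Series K I) (a : I) (w : List I) :
    eTilde K deg j f (a :: w) = eOp K deg j (lquot a f) w := rfl

@[fun_prop] theorem isCL_eTilde (j : ℕ) {f : M → Series K I} (hf : IsCL K f) :
    IsCL K fun x => eTilde K deg j (f x) := by
  refine IsCL.of_pi fun v => ?_
  cases v with
  | nil => simp only [eTilde_nil]; fun_prop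
  | cons a v => simp only [eTilde_cons]; exact isCL_eval _ (by fun_prop)

theorem aeval_shuffleTilde_cons (Q : ℚ[X]) (f : Series K I) (a : I) (w : List I) :
    aeval (shuffleTilde K deg) Q f (a :: w) = aeval (shuffleOp K deg) Q (lquot a f) w :=
  congrFun (map_aeval_of_comm (lquot a) (shuffleTilde K deg) (shuffleOp K deg)
    (fun _ => rfl) Q f) w

theorem aeval_shuffleTilde_nil (Q : ℚ[X]) {f : Series K I} (hf : f [] = 0) :
    aeval (shuffleTilde K deg) Q f [] = 0 :=
  aeval_induction (shuffleTilde K deg) (P := fun f => f [] = 0)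
    (fun x y hx hy => by simp [hx, hy]) (fun c x hx => by simp [hx]) (fun _ _ => rfl) Q hf

theorem eTilde_apply {j : ℕ} {a : I} {w : List I} {Q : ℚ[X]} (hQ : IsHodgePoly w.length j Q)
    (f : Series K I) : eTilde K deg j f (a :: w) = aeval (shuffleTilde K deg) Q f (a :: w) := by
  rw [eTilde_cons, eOp_apply deg hQ, aeval_shuffleTilde_cons]

theorem eTilde_mon_nil (j : ℕ) : eTilde K deg j (mon K ([] : List I)) = 0 := by
  funext v
  cases v with
  | nil => rfl
  | cons a v => rw [eTilde_cons, lquot_mon_nil, map_zero]; rfl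

theorem eTilde_mon_cons {j : ℕ} {a : I} {w : List I} {Q : ℚ[X]} (hQ : IsHodgePoly w.length j Q) :
    eTilde K deg j (mon K (a :: w)) = aeval (shuffleTilde K deg) Q (mon K (a :: w)) := by
  funext v
  cases v with
  | nil => rw [aeval_shuffleTilde_nil deg Q (by simp [mon_apply])]; rfl
  | cons b v =>
    rw [eTilde_cons, aeval_shuffleTilde_cons, lquot_mon_cons]
    by_cases h : b = a
    · rw [if_pos h, eOp_mon deg hQ]
    · simp [h]

theorem eOp_eOp (i j : ℕ) (f : Series K I) :
    eOp K deg i (eOp K deg j f) = if i = j then eOp K deg j f else 0 := by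
  refine IsCL.ext (φ := fun f => eOp K deg i (eOp K deg j f))
    (ψ := fun f => if i = j then eOp K deg j f else 0) (by fun_prop) ?_ (fun w => ?_) f
  · by_cases h : i = j <;> simp only [h, if_true, if_false] <;> fun_prop
  · funext v
    obtain ⟨Q, hQ⟩ := exists_isHodgePoly (max v.length w.length) j
    obtain ⟨R, hR⟩ := exists_isHodgePoly (max v.length w.length) i
    rw [eOp_mon deg (hQ.mono (le_max_right _ _)), eOp_apply deg (hR.mono (le_max_left _ _)),
      ← Module.End.mul_apply, ← map_mul]
    by_cases h : i = j
    · rw [if_pos h]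
      refine aeval_congr deg (fun r hr => ?_) _
      have hr' := hr.trans (le_max_left v.length w.length)
      rw [eval_mul, hQ r hr', hR r hr', h]
      split_ifs <;> simp
    · rw [if_neg h]
      have := aeval_congr (K := K) deg (v := v) (Q := R * Q) (R := 0) (fun r hr => by
        have hr' := hr.trans (le_max_left v.length w.length)
        rw [eval_mul, hQ r hr', hR r hr', eval_zero]
        split_ifs <;> simp_all) (mon K w)
      rw [this]
      simp

theorem sum_eOp (f : Series K I) {w : List I} {n : ℕ} (hn : w.length < n) :
    ∑ j ∈ Finset.range n, eOp K deg j f w = f w := by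
  choose Q hQ using exists_isHodgePoly w.length
  have h1 : ∑ j ∈ Finset.range n, eOp K deg j f w =
      aeval (shuffleOp K deg) (∑ j ∈ Finset.range n, Q j) f w := by
    simp [map_sum, fun j => eOp_apply deg (hQ j) f, Finset.sum_apply]
  rw [h1, aeval_congr deg (R := 1)]
  · simp
  · intro r hr
    rw [eval_finsetSum, Finset.sum_eq_single r]
    · rw [hQ r r hr]; simp
    · intro j _ hj
      rw [hQ j r hr, if_neg (Ne.symm hj)]
    · intro h
      exact absurd (Finset.mem_range.2 (by omega)) h

theorem eTilde_eTilde (i j : ℕ) (f : Series K I) :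
    eTilde K deg i (eTilde K deg j f) = if i = j then eTilde K deg j f else 0 := by
  funext v
  cases v with
  | nil => split_ifs <;> rfl
  | cons a v =>
    rw [eTilde_cons, lquot_eTilde, eOp_eOp]
    split_ifs <;> rfl

theorem sum_eTilde (f : Series K I) (hf : f [] = 0) {w : List I} {n : ℕ} (hn : w.length < n) :
    ∑ j ∈ Finset.range n, eTilde K deg j f w = f w := by
  cases w with
  | nil => simp [eTilde_nil, hf]
  | cons a w =>
    simp only [eTilde_cons]
    exact sum_eOp deg (lquot a f) (by simp at hn; omega)

theorem eOp_of_length_lt {j : ℕ} {w : List I} (h : w.length < j) (f : Series K I) :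
    eOp K deg j f w = 0 := by
  simp [eOp, h]

theorem eTilde_of_length_lt {j : ℕ} {w : List I} (h : w.length < j) (f : Series K I) :
    eTilde K deg j f w = 0 := by
  cases w with
  | nil => rfl
  | cons a w => exact eOp_of_length_lt deg (by simp at h; omega) _

theorem sub_zOp_eTilde (j : ℕ) (f : Series K I) :
    eTilde K deg j f - zOp K deg (eTilde K deg j f) = eOp K deg j (f - zOp K deg f) := by
  refine IsCL.ext (φ := fun f => eTilde K deg j f - zOp K deg (eTilde K deg j f))
    (ψ := fun f => eOp K deg j (f - zOp K deg f)) (by fun_prop) (by fun_prop) (fun w => ?_) f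
  cases w with
  | nil => simp [eTilde_mon_nil, zOp_mon_nil]
  | cons a w =>
    funext v
    obtain ⟨Q, hQ⟩ := exists_isHodgePoly (max v.length w.length) j
    rw [eTilde_mon_cons deg (hQ.mono (le_max_right _ _)), eOp_apply deg (hQ.mono (le_max_left _ _))]
    exact congrFun (map_aeval_of_comm (LinearMap.id - zOp K deg) (shuffleTilde K deg)
      (shuffleOp K deg) (fun x => sub_zOp_shuffleTilde x) Q (mon K (a :: w))) v

/-- `N Q(s) = Q(2 s̃) N`. -/
theorem normOp_aeval (Q : ℚ[X]) (f : Series K I) : normOp K deg (aeval (shuffleOp K deg) Q f) =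
    aeval (shuffleTilde K deg) (Q.comp (C 2 * X)) (normOp K deg f) := by
  rw [aeval_comp]
  refine map_aeval_of_comm (normOp K deg) _ _ (fun x => ?_) Q f
  rw [normOp_shuffleOp, map_mul, aeval_C, aeval_X, Module.End.mul_apply,
    Module.algebraMap_end_apply, two_smul, two_smul]

theorem normOp_apply_nil (f : Series K I) : normOp K deg f [] = 0 := by simp [normOp]

/-- If `Q` interpolates the indicator function of `2^{j+1}`, then `Q(2 X)` interpolates the one of `2^j`. -/
theorem normOp_eOp_succ (j : ℕ) (f : Series K I) :
    normOp K deg (eOp K deg (j + 1) f) = eTilde K deg j (normOp K deg f) := by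
  refine IsCL.ext (φ := fun f => normOp K deg (eOp K deg (j + 1) f))
    (ψ := fun f => eTilde K deg j (normOp K deg f)) (by fun_prop) (by fun_prop) (fun w => ?_) f
  funext v
  cases v with
  | nil => rw [normOp_apply_nil]; rfl
  | cons a v =>
    obtain ⟨Q, hQ⟩ := exists_isHodgePoly (max (v.length + 1) w.length) (j + 1)
    have hQ' : IsHodgePoly v.length j (Q.comp (C 2 * X)) := by
      intro r hr
      rw [eval_comp, eval_mul, eval_C, eval_X, ← pow_succ',
        hQ (r + 1) (le_trans (by omega) (le_max_left _ _))]
      simp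
    rw [eOp_mon deg (hQ.mono (le_max_right _ _)), normOp_aeval, eTilde_apply deg hQ']

/-- The eigenvalue `1` of `s` would correspond to the eigenvalue `1/2` of `s̃`, which does not occur. -/
theorem normOp_eOp_zero (f : Series K I) : normOp K deg (eOp K deg 0 f) = 0 := by
  refine IsCL.ext (φ := fun f => normOp K deg (eOp K deg 0 f))
    (ψ := fun _ => 0) (by fun_prop) (by fun_prop) (fun w => ?_) f
  funext v
  cases v with
  | nil => rw [normOp_apply_nil]; rfl
  | cons a v =>
    obtain ⟨Q, hQ⟩ := exists_isHodgePoly (max (v.length + 1) w.length) 0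
    have hQ' : ∀ r ≤ v.length, (Q.comp (C 2 * X)).eval ((2 : ℚ) ^ r) =
        (0 : ℚ[X]).eval ((2 : ℚ) ^ r) := by
      intro r hr
      rw [eval_comp, eval_mul, eval_C, eval_X, ← pow_succ',
        hQ (r + 1) (le_trans (by omega) (le_max_left _ _))]
      simp
    rw [eOp_mon deg (hQ.mono (le_max_right _ _)), normOp_aeval, aeval_shuffleTilde_cons,
      aeval_congr deg hQ']
    simp

theorem eOp_mem_col {𝒦 : ℤ → Submodule ℚ K} [GradedAlgebra 𝒦] (j : ℕ) {n : ℤ} {f : Series K I}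
    (hf : f ∈ col 𝒦 deg n) : eOp K deg j f ∈ col 𝒦 deg n := by
  obtain ⟨hf, h0⟩ := hf
  have hagree : ∀ (Q : ℚ[X]), aeval (shuffleOp K deg) Q f ∈ homog 𝒦 deg n := fun Q =>
    aeval_induction (shuffleOp K deg) (P := fun f => f ∈ homog 𝒦 deg n)
      (fun x y hx hy => Submodule.add_mem _ hx hy) (fun c x hx => qsmul_mem_homog c hx)
      (fun x hx => shuffleOp_mem_homog deg hx) Q hf
  refine ⟨fun w => ?_, ?_⟩
  · obtain ⟨Q, hQ⟩ := exists_isHodgePoly w.length j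
    rw [eOp_apply deg hQ]
    exact hagree Q w
  · obtain ⟨Q, hQ⟩ := exists_isHodgePoly 0 j
    rw [eOp_apply (K := K) (v := []) deg hQ]
    refine aeval_induction (shuffleOp K deg) (P := fun f => f [] = 0)
      (fun x y hx hy => by simp [hx, hy]) (fun c x hx => by simp [hx]) (fun x hx => ?_) Q h0
    simp [shuffleOp, shuffle, hx]

theorem eTilde_mem_col {𝒦 : ℤ → Submodule ℚ K} [GradedAlgebra 𝒦] (j : ℕ) {n : ℤ}
    {f : Series K I} (hf : f ∈ col 𝒦 deg n) : eTilde K deg j f ∈ col 𝒦 deg n := by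
  refine ⟨fun w => ?_, rfl⟩
  cases w with
  | nil => exact Submodule.zero_mem _
  | cons a w =>
    have hagree : ∀ (Q : ℚ[X]), aeval (shuffleOp K deg) Q (lquot a f) ∈
        homog 𝒦 deg (n - wdeg deg [a]) := fun Q =>
      aeval_induction (shuffleOp K deg) (P := fun f => f ∈ homog 𝒦 deg (n - wdeg deg [a]))
        (fun x y hx hy => Submodule.add_mem _ hx hy) (fun c x hx => qsmul_mem_homog c hx)
        (fun x hx => shuffleOp_mem_homog deg hx) Q (lquot_mem_homog a hf.1)
    obtain ⟨Q, hQ⟩ := exists_isHodgePoly w.length j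
    rw [eTilde_cons, eOp_apply deg hQ, wdeg_cons, ← sub_sub]
    exact hagree Q w

namespace AInfStructure

variable {deg} {𝒦 : ℤ → Submodule ℚ K} [GradedAlgebra 𝒦] {A : AInfStructure 𝒦 deg}
  (hC : A.IsCInf) (heven : ∀ n, Odd n → 𝒦 n = ⊥)

include hC heven

theorem IsCInf.m_eOp (j : ℕ) (f : Series K I) : A.m (eOp K deg j f) = eOp K deg j (A.m f) := by
  refine IsCL.ext (φ := fun f => A.m (eOp K deg j f))
    (ψ := fun f => eOp K deg j (A.m f)) (by fun_prop) (by fun_prop) (fun w => ?_) f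
  funext v
  obtain ⟨Q, hQ⟩ := exists_isHodgePoly (max v.length w.length) j
  rw [eOp_mon deg (hQ.mono (le_max_right _ _)), eOp_apply deg (hQ.mono (le_max_left _ _)),
    map_aeval_of_comm A.m (shuffleOp K deg) (shuffleOp K deg) (hC.m_shuffleOp heven)]

theorem IsCInf.b_eTilde (j : ℕ) (f : Series K I) :
    A.b (eTilde K deg j f) = eTilde K deg j (A.b f) := by
  refine IsCL.ext (φ := fun f => A.b (eTilde K deg j f))
    (ψ := fun f => eTilde K deg j (A.b f)) (by fun_prop) (by fun_prop) (fun w => ?_) f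
  cases w with
  | nil => simp [eTilde_mon_nil, b_mon_nil]
  | cons a w =>
    funext v
    cases v with
    | nil => rfl
    | cons c v =>
      obtain ⟨Q, hQ⟩ := exists_isHodgePoly (max v.length w.length) j
      rw [eTilde_mon_cons deg (hQ.mono (le_max_right _ _)),
        eTilde_apply deg (hQ.mono (le_max_left _ _)),
        map_aeval_of_comm A.b (shuffleTilde K deg) (shuffleTilde K deg) (hC.b_shuffleTilde heven)]

end AInfStructure

end Idempotents

/-! ### Cohomology of complexes -/

namespace Cx

variable {R M M' : Type*} [Ring R] [AddCommGroup M] [Module R M] [AddCommGroup M'] [Module R M']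

theorem exists_represents (C : Cx R M) {n : ℤ} (ξ : C.H n) : ∃ x, C.Represents n x ξ := by
  obtain ⟨x, rfl⟩ := Submodule.Quotient.mk_surjective _ ξ
  exact ⟨x, x.2, rfl⟩

theorem exists_class (C : Cx R M) {n : ℤ} {x : M} (hx : x ∈ C.X n) (hd : C.d x = 0) :
    ∃ ξ, C.Represents n x ξ :=
  ⟨_, ⟨hx, hd⟩, rfl⟩

namespace Represents

variable {C : Cx R M} {n : ℤ} {x y : M} {ξ η : C.H n}

theorem mem (h : C.Represents n x ξ) : x ∈ C.X n := h.1.1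

theorem d_eq_zero (h : C.Represents n x ξ) : C.d x = 0 := h.1.2

theorem eq_iff (h : C.Represents n x ξ) (h' : C.Represents n y η) :
    ξ = η ↔ ∃ u ∈ C.X (n - 1), C.d u = x - y := by
  obtain ⟨hx, rfl⟩ := h
  obtain ⟨hy, rfl⟩ := h'
  rw [Submodule.Quotient.eq]
  rfl

theorem unique (h : C.Represents n x ξ) (h' : C.Represents n x η) : ξ = η :=
  (h.eq_iff h').2 ⟨0, Submodule.zero_mem _, by simp⟩

theorem zero : C.Represents n 0 (0 : C.H n) := ⟨Submodule.zero_mem _, rfl⟩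

theorem eq_zero_iff (h : C.Represents n x ξ) : ξ = 0 ↔ ∃ u ∈ C.X (n - 1), C.d u = x := by
  rw [h.eq_iff zero, sub_zero]

theorem add_coboundary (hC : C.IsComplex) (h : C.Represents n x ξ) {u : M}
    (hu : u ∈ C.X (n - 1)) (hy : y = x + C.d u) : C.Represents n y ξ := by
  have h1 := hC _ u hu
  rw [sub_add_cancel] at h1
  obtain ⟨η, hη⟩ := C.exists_class (n := n) (x := y)
    (hy ▸ Submodule.add_mem _ h.mem h1.1) (by rw [hy, map_add, h.d_eq_zero, h1.2, add_zero])
  rw [(h.eq_iff hη).2 ⟨-u, Submodule.neg_mem _ hu, by rw [hy, map_neg]; abel⟩]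
  exact hη

end Represents

/-- The map induced in cohomology by a linear map which preserves cocycles and coboundaries. -/
def mapH (C : Cx R M) (C' : Cx R M') (φ : M →ₗ[R] M') {n n' : ℤ}
    (h1 : ∀ x ∈ C.X n, C.d x = 0 → φ x ∈ C'.X n' ∧ C'.d (φ x) = 0)
    (h2 : ∀ u ∈ C.X (n - 1), ∃ v ∈ C'.X (n' - 1), C'.d v = φ (C.d u)) : C.H n →ₗ[R] C'.H n' :=
  Submodule.mapQ _ _ (φ.restrict fun x (hx : x ∈ C.cocycles n) => h1 x hx.1 hx.2) <| by
    rintro ⟨x, hx⟩ ⟨u, hu, hux⟩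
    obtain ⟨v, hv, h⟩ := h2 u hu
    refine ⟨v, hv, h.trans ?_⟩
    rw [hux]
    rfl

theorem mapH_represents (C : Cx R M) (C' : Cx R M') (φ : M →ₗ[R] M') {n n' : ℤ}
    (h1 : ∀ x ∈ C.X n, C.d x = 0 → φ x ∈ C'.X n' ∧ C'.d (φ x) = 0)
    (h2 : ∀ u ∈ C.X (n - 1), ∃ v ∈ C'.X (n' - 1), C'.d v = φ (C.d u)) {x : M} {ξ : C.H n}
    (h : C.Represents n x ξ) : C'.Represents n' (φ x) (mapH C C' φ h1 h2 ξ) := by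
  obtain ⟨hx, rfl⟩ := h
  exact ⟨h1 x hx.1 hx.2, rfl⟩

/-- Orthogonal projections `p j` of a complex onto subcomplexes `D j` decompose its cohomology as a
product, provided that a cochain is determined by its components and that the components can be
prescribed arbitrarily. -/
theorem exists_productDecomp (C : Cx R M) (hC : C.IsComplex) (D : ℕ → Cx R M)
    (p : ℕ → M →ₗ[R] M) (hDX : ∀ j n, (D j).X n = (C.X n).map (p j)) (hDd : ∀ j, (D j).d = C.d)
    (hX : ∀ j n, ∀ x ∈ C.X n, p j x ∈ C.X n) (hd : ∀ j x, C.d (p j x) = p j (C.d x))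
    (hp : ∀ i j x, p i (p j x) = if i = j then p j x else 0)
    (hglue : ∀ n (x : ℕ → M), (∀ j, x j ∈ C.X n ∧ p j (x j) = x j) →
      ∃ y ∈ C.X n, ∀ j, p j y = x j)
    (hsep : ∀ n, ∀ x ∈ C.X n, (∀ j, p j x = 0) → x = 0) :
    ∃ (ι : ∀ j n, (D j).H n →ₗ[R] C.H n) (π : ∀ j n, C.H n →ₗ[R] (D j).H n),
      IsProductDecomp C D ι π ∧ (∀ j n, Induces (D j) C id (ι j n)) ∧
      ∀ j n, Induces C (D j) (p j) (π j n) := by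
  have hle : ∀ j n, ∀ x ∈ (D j).X n, x ∈ C.X n ∧ p j x = x := by
    intro j n x hx
    rw [hDX] at hx
    obtain ⟨y, hy, rfl⟩ := hx
    exact ⟨hX j n y hy, by rw [hp, if_pos rfl]⟩
  have hmem : ∀ j n, ∀ x ∈ C.X n, p j x ∈ (D j).X n := by
    intro j n x hx
    rw [hDX]
    exact ⟨x, hx, rfl⟩
  let ι : ∀ j n, (D j).H n →ₗ[R] C.H n := fun j n => mapH (D j) C LinearMap.id
    (fun x hx h => ⟨(hle j n x hx).1, by rw [hDd] at h; exact h⟩)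
    (fun u hu => ⟨u, (hle j _ u hu).1, by rw [hDd]; rfl⟩)
  let π : ∀ j n, C.H n →ₗ[R] (D j).H n := fun j n => mapH C (D j) (p j)
    (fun x hx h => ⟨hmem j n x hx, by rw [hDd, hd, h, map_zero]⟩)
    (fun u hu => ⟨p j u, hmem j _ u hu, by rw [hDd, hd]⟩)
  have hι : ∀ j n, Induces (D j) C id (ι j n) := fun j n x ξ h =>
    mapH_represents (D j) C LinearMap.id _ _ h
  have hπ : ∀ j n, Induces C (D j) (p j) (π j n) := fun j n x ξ h => mapH_represents _ _ _ _ _ h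
  refine ⟨ι, π, ⟨fun n => ⟨?_, ?_⟩, ?_, ?_⟩, hι, hπ⟩
  · intro ξ η h
    rw [← sub_eq_zero]
    have h1 : ∀ j, π j n (ξ - η) = 0 := fun j => by
      rw [map_sub, sub_eq_zero]
      exact congrFun h j
    generalize ξ - η = ζ at h1
    obtain ⟨x, hx⟩ := C.exists_represents ζ
    have h2 : ∀ j, ∃ u ∈ (D j).X (n - 1), C.d u = p j x := fun j => by
      have := (hπ j n x ζ hx).eq_zero_iff.1 (h1 j)
      rwa [hDd] at this
    choose u hu hux using h2
    obtain ⟨y, hy, hyu⟩ := hglue (n - 1) u fun j => hle j _ _ (hu j)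
    have h3 := (hC _ y hy).1
    rw [sub_add_cancel] at h3
    refine hx.eq_zero_iff.2 ⟨y, hy, (sub_eq_zero.1 (hsep n _ (Submodule.sub_mem _ hx.mem h3)
      fun j => ?_)).symm⟩
    rw [map_sub, ← hd, hyu, hux, sub_self]
  · intro η
    choose x hx using fun j => (D j).exists_represents (η j)
    obtain ⟨y, hy, hyx⟩ := hglue n x fun j => hle j _ _ (hx j).mem
    have hdy : C.d y = 0 := hsep _ _ (hC n y hy).1 fun j => by
      rw [← hd, hyx, ← hDd j, (hx j).d_eq_zero]
    obtain ⟨ξ, hξ⟩ := C.exists_class hy hdy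
    refine ⟨ξ, funext fun j => ?_⟩
    have h1 := hπ j n y ξ hξ
    rw [hyx] at h1
    exact h1.unique (hx j)
  · intro j n ξ
    obtain ⟨x, hx⟩ := (D j).exists_represents ξ
    have h1 := hπ j n _ _ (hι j n x ξ hx)
    rw [id, (hle j n x hx.mem).2] at h1
    exact h1.unique hx
  · intro i j n ξ hij
    obtain ⟨x, hx⟩ := (D j).exists_represents ξ
    have h1 := hπ i n _ _ (hι j n x ξ hx)
    rw [id, ← (hle j n x hx.mem).2, hp, if_neg hij] at h1
    exact h1.unique .zero

end Cx

/-- Exactness passes to direct summands. -/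
theorem exact_of_retract {R A B C A' B' C' : Type*} [Ring R] [AddCommGroup A] [Module R A]
    [AddCommGroup B] [Module R B] [AddCommGroup C] [Module R C] [AddCommGroup A'] [Module R A']
    [AddCommGroup B'] [Module R B'] [AddCommGroup C'] [Module R C']
    {f : A →ₗ[R] B} {g : B →ₗ[R] C} {f' : A' →ₗ[R] B'} {g' : B' →ₗ[R] C'}
    (h : Function.Exact f g) (iA : A' →ₗ[R] A) (iB : B' →ₗ[R] B) (iC : C' →ₗ[R] C)
    (pA : A →ₗ[R] A') (pB : B →ₗ[R] B') (hB : ∀ x, pB (iB x) = x) (hC : Function.Injective iC)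
    (hfi : ∀ x, f (iA x) = iB (f' x)) (hgi : ∀ x, g (iB x) = iC (g' x))
    (hfp : ∀ x, pB (f x) = f' (pA x)) : Function.Exact f' g' := by
  intro y
  constructor
  · intro hy
    obtain ⟨x, hx⟩ := (h (iB y)).1 (by rw [hgi, hy, map_zero])
    exact ⟨pA x, by rw [← hfp, hx, hB]⟩
  · rintro ⟨x, rfl⟩
    apply hC
    rw [← hgi, ← hfi, map_zero]
    exact (h _).2 ⟨_, rfl⟩

/-! ### The Tsygan complex -/

section Tsygan

variable {K I : Type*} [CommRing K] [Algebra ℚ K] {𝒦 : ℤ → Submodule ℚ K} [GradedAlgebra 𝒦]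
variable {deg : I → ℤ} [DecidableEq I]

/-- The vertical differential of column `i` of the Tsygan bicomplex. -/
noncomputable def vdiff (A : AInfStructure 𝒦 deg) (i : ℕ) : Series K I →ₗ[K] Series K I :=
  if Even i then A.b else A.m

variable (K deg) in
/-- The horizontal differential of the Tsygan bicomplex from column `i` to column `i + 1`. -/
def hdiff (i : ℕ) : Series K I →ₗ[K] Series K I :=
  if Even i then LinearMap.id - zOp K deg else normOp K deg

theorem vdiff_even (A : AInfStructure 𝒦 deg) {i : ℕ} (hi : Even i) : vdiff A i = A.b := if_pos hi

theorem vdiff_odd (A : AInfStructure 𝒦 deg) {i : ℕ} (hi : ¬Even i) : vdiff A i = A.m := if_neg hi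

theorem hdiff_even {i : ℕ} (hi : Even i) (f : Series K I) : hdiff K deg i f = f - zOp K deg f := by
  simp [hdiff, hi]

theorem hdiff_odd {i : ℕ} (hi : ¬Even i) : hdiff K deg i = (normOp K deg : _ →ₗ[K] Series K I) :=
  if_neg hi

theorem hdiff_mem_col (i : ℕ) {n : ℤ} {f : Series K I} (hf : f ∈ col 𝒦 deg n) :
    hdiff K deg i f ∈ col 𝒦 deg n := by
  by_cases hi : Even i
  · rw [hdiff_even hi]
    exact Submodule.sub_mem _ hf (zOp_mem_col hf)
  · rw [hdiff_odd hi]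
    exact normOp_mem_col hf

theorem vdiff_mem_col (A : AInfStructure 𝒦 deg) (i : ℕ) {n : ℤ} {f : Series K I}
    (hf : f ∈ col 𝒦 deg n) : vdiff A i f ∈ col 𝒦 deg (n + 1) := by
  by_cases hi : Even i
  · rw [vdiff_even A hi]
    exact A.b_mem_col hf
  · rw [vdiff_odd A hi]
    exact A.m_mem_col hf

variable (A : AInfStructure 𝒦 deg)

theorem tsyganD_apply_zero (x : ℕ →₀ Series K I) : tsyganD A x 0 = A.b (x 0) := by
  induction x using Finsupp.induction_linear with
  | zero => simp
  | add x y hx hy => simp [hx, hy]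
  | single i f =>
    rcases i with _ | i
    · simp [tsyganD]
    · simp [tsyganD]

theorem tsyganD_apply_succ (x : ℕ →₀ Series K I) (i : ℕ) :
    tsyganD A x (i + 1) = vdiff A (i + 1) (x (i + 1)) + hdiff K deg i (x i) := by
  induction x using Finsupp.induction_linear with
  | zero => simp
  | add x y hx hy =>
    simp only [map_add, Finsupp.add_apply, hx, hy]
    abel
  | single k f =>
    have h : tsyganD A (Finsupp.single k f) =
        Finsupp.single k (vdiff A k f) + Finsupp.single (k + 1) (hdiff K deg k f) := by
      simp [tsyganD, vdiff, hdiff]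
    rw [h]
    simp only [Finsupp.add_apply, Finsupp.single_apply, add_left_inj]
    by_cases h1 : k = i + 1
    · have h2 : k ≠ i := by omega
      subst h1
      simp
    · by_cases h2 : k = i
      · subst h2
        simp
      · simp [h1, h2]

theorem mem_tsyganCx {n : ℤ} {x : ℕ →₀ Series K I} :
    x ∈ (tsyganCx A).X n ↔ ∀ i : ℕ, x i ∈ col 𝒦 deg (n - i + 1) := by
  simp [tsyganCx]

theorem tsyganCx_d (x : ℕ →₀ Series K I) : (tsyganCx A).d x = tsyganD A x := rfl

theorem single_mem_tsyganCx {n : ℤ} {i : ℕ} {f : Series K I} (hf : f ∈ col 𝒦 deg (n - i + 1)) :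
    Finsupp.single i f ∈ (tsyganCx A).X n := by
  rw [mem_tsyganCx]
  intro k
  rw [Finsupp.single_apply]
  split_ifs with h
  · rwa [← h]
  · exact Submodule.zero_mem _

section Shift

theorem shift2_apply_add_two (x : ℕ →₀ Series K I) (i : ℕ) : shift2 x (i + 2) = x i :=
  Finsupp.mapDomain_apply (add_left_injective 2) x i

theorem shift2_apply_zero (x : ℕ →₀ Series K I) : shift2 x 0 = 0 :=
  Finsupp.mapDomain_of_notMem_range x 0 (by simp)

theorem shift2_apply_one (x : ℕ →₀ Series K I) : shift2 x 1 = 0 :=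
  Finsupp.mapDomain_of_notMem_range x 1 (by simp)

theorem shift2_injective : Function.Injective (shift2 : (ℕ →₀ Series K I) → ℕ →₀ Series K I) :=
  Finsupp.mapDomain_injective (add_left_injective 2)

theorem ext_add_two {x y : ℕ →₀ Series K I} (h0 : x 0 = y 0) (h1 : x 1 = y 1)
    (h : ∀ i, x (i + 2) = y (i + 2)) : x = y := by
  ext1 i
  rcases i with _ | _ | i
  exacts [h0, h1, h i]

theorem exists_eq_shift2 {x : ℕ →₀ Series K I} (h0 : x 0 = 0) (h1 : x 1 = 0) :
    ∃ y, x = shift2 y := by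
  refine ⟨x.comapDomain (· + 2) (add_left_injective 2).injOn, ext_add_two ?_ ?_ fun i => ?_⟩
  · rw [h0, shift2_apply_zero]
  · rw [h1, shift2_apply_one]
  · rw [shift2_apply_add_two, Finsupp.comapDomain_apply]

theorem shift2_mem_tsyganCx {n : ℤ} {x : ℕ →₀ Series K I} :
    shift2 x ∈ (tsyganCx A).X (n + 2) ↔ x ∈ (tsyganCx A).X n := by
  have key : ∀ i : ℕ, n + 2 - ((i + 2 : ℕ) : ℤ) + 1 = n - i + 1 := fun i => by push_cast; ring
  simp only [mem_tsyganCx]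
  constructor
  · intro h i
    have h1 := h (i + 2)
    rwa [shift2_apply_add_two, key] at h1
  · intro h i
    rcases i with _ | _ | i
    · rw [shift2_apply_zero]; exact Submodule.zero_mem _
    · rw [shift2_apply_one]; exact Submodule.zero_mem _
    · rw [shift2_apply_add_two, key]; exact h i

theorem vdiff_add_two (i : ℕ) : vdiff A (i + 2) = vdiff A i := by
  simp [vdiff, Nat.even_add]

theorem hdiff_add_two (i : ℕ) : hdiff K deg (i + 2) = (hdiff K deg i : _ →ₗ[K] Series K I) := by
  simp [hdiff, Nat.even_add]

theorem tsyganD_shift2 (x : ℕ →₀ Series K I) : tsyganD A (shift2 x) = shift2 (tsyganD A x) := by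
  refine ext_add_two ?_ ?_ fun i => ?_
  · rw [tsyganD_apply_zero, shift2_apply_zero, shift2_apply_zero, map_zero]
  · rw [tsyganD_apply_succ, shift2_apply_zero, shift2_apply_one, shift2_apply_one, map_zero,
      map_zero, add_zero]
  · rw [shift2_apply_add_two]
    rcases i with _ | i
    · rw [tsyganD_apply_succ, shift2_apply_add_two, shift2_apply_one, vdiff_add_two,
        LinearMap.map_zero, add_zero, tsyganD_apply_zero, vdiff_even A (by simp)]
    · rw [tsyganD_apply_succ A _ (i + 1 + 1), shift2_apply_add_two, hdiff_add_two i, vdiff_add_two,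
        shift2_apply_add_two, tsyganD_apply_succ]

/-- `shift2` as a linear map. -/
noncomputable def shift2Lin : (ℕ →₀ Series K I) →ₗ[𝒦 0] (ℕ →₀ Series K I) where
  toFun := shift2
  map_add' _ _ := Finsupp.mapDomain_add
  map_smul' c x := Finsupp.mapDomain_smul c x

theorem shift2_add (x y : ℕ →₀ Series K I) : shift2 (x + y) = shift2 x + shift2 y :=
  Finsupp.mapDomain_add

theorem shift2_sub (x y : ℕ →₀ Series K I) : shift2 (x - y) = shift2 x - shift2 y := by
  rw [eq_sub_iff_add_eq, ← shift2_add, sub_add_cancel]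

end Shift

section Complex

variable [TopologicalSpace K] [DiscreteTopology K] (heven : ∀ n, Odd n → 𝒦 n = ⊥)
include heven

theorem vdiff_vdiff (i : ℕ) (f : Series K I) : vdiff A i (vdiff A i f) = 0 := by
  by_cases hi : Even i
  · rw [vdiff_even A hi, A.b_b heven]
  · rw [vdiff_odd A hi, A.sq_zero]

theorem vdiff_hdiff (i : ℕ) (f : Series K I) :
    vdiff A (i + 1) (hdiff K deg i f) + hdiff K deg i (vdiff A i f) = 0 := by
  by_cases hi : Even i
  · rw [vdiff_even A hi, vdiff_odd A (by simp [Nat.even_add_one, hi]), hdiff_even hi, hdiff_even hi,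
      A.b_sub_zOp heven, add_neg_cancel]
  · rw [vdiff_odd A hi, vdiff_even A (by simp [Nat.even_add_one, hi]), hdiff_odd hi,
      A.b_normOp heven, neg_add_cancel]

omit heven in
theorem hdiff_hdiff (i : ℕ) (f : Series K I) : hdiff K deg (i + 1) (hdiff K deg i f) = 0 := by
  by_cases hi : Even i
  · rw [hdiff_even hi, hdiff_odd (by simp [Nat.even_add_one, hi]), map_sub, normOp_zOp, sub_self]
  · rw [hdiff_odd hi, hdiff_even (by simp [Nat.even_add_one, hi]), zOp_normOp, sub_self]

theorem tsyganD_tsyganD (x : ℕ →₀ Series K I) : tsyganD A (tsyganD A x) = 0 := by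
  ext1 i
  rcases i with _ | _ | i
  · rw [tsyganD_apply_zero, tsyganD_apply_zero, A.b_b heven, Finsupp.zero_apply]
  · have h := vdiff_hdiff A heven 0 (x 0)
    rw [tsyganD_apply_succ, tsyganD_apply_succ, tsyganD_apply_zero, map_add, vdiff_vdiff A heven,
      zero_add, Finsupp.zero_apply, ← vdiff_even A Even.zero, h]
  · have h := vdiff_hdiff A heven (i + 1) (x (i + 1))
    rw [tsyganD_apply_succ, tsyganD_apply_succ, tsyganD_apply_succ, (vdiff A _).map_add,
      (hdiff K deg _).map_add,
      vdiff_vdiff A heven, hdiff_hdiff, zero_add, add_zero, Finsupp.zero_apply, h]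

theorem tsyganCx_isComplex : (tsyganCx A).IsComplex := by
  refine fun n x hx => ⟨?_, tsyganD_tsyganD A heven x⟩
  rw [mem_tsyganCx] at hx ⊢
  intro i
  rw [tsyganCx_d]
  rcases i with _ | i
  · rw [tsyganD_apply_zero]
    have h := A.b_mem_col (hx 0)
    rwa [show n - ((0 : ℕ) : ℤ) + 1 + 1 = n + 1 - (0 : ℕ) + 1 by ring] at h
  · rw [tsyganD_apply_succ]
    refine Submodule.add_mem _ ?_ ?_
    · have h := vdiff_mem_col A (i + 1) (hx (i + 1))
      rwa [show n - ((i + 1 : ℕ) : ℤ) + 1 + 1 = n + 1 - (i + 1 : ℕ) + 1 by ring] at h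
    · have h := hdiff_mem_col i (hx i)
      rwa [show n - (i : ℤ) + 1 = n + 1 - (i + 1 : ℕ) + 1 by push_cast; ring] at h

omit heven [TopologicalSpace K] [DiscreteTopology K] in
theorem tsyganD_single (i : ℕ) (f : Series K I) : tsyganD A (Finsupp.single i f) =
    Finsupp.single i (vdiff A i f) + Finsupp.single (i + 1) (hdiff K deg i f) := by
  simp [tsyganD, vdiff, hdiff]

/-- Exactness of the rows. -/
theorem exists_hdiff_eq (i : ℕ) {n : ℤ} {f : Series K I} (hf : f ∈ col 𝒦 deg n)
    (h : hdiff K deg (i + 1) f = 0) : ∃ g ∈ col 𝒦 deg n, hdiff K deg i g = f := by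
  by_cases hi : Even i
  · rw [hdiff_odd (by simp [Nat.even_add_one, hi])] at h
    exact ⟨rowHtpy deg f, rowHtpy_mem_col hf,
      by rw [hdiff_even hi, ← eq_sub_zOp_of_normOp_eq_zero deg hf.2 h]⟩
  · rw [hdiff_even (by simp [Nat.even_add_one, hi]), sub_eq_zero] at h
    exact ⟨divLength f, divLength_mem_col hf,
      by rw [hdiff_odd hi, ← eq_normOp_of_zOp_eq deg hf.2 h.symm]⟩

/-- A cochain of the Tsygan complex whose differential is concentrated in the leftmost column is
cohomologous to a norm in the leftmost column: the columns are cleared from the right, using the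
exactness of the rows. -/
theorem exists_reduction {n : ℤ} {x : ℕ →₀ Series K I} (hx : x ∈ (tsyganCx A).X n)
    (hd : ∀ i, tsyganD A x (i + 1) = 0) : ∃ f ∈ col 𝒦 deg (n + 1), ∃ u ∈ (tsyganCx A).X (n - 1),
      x = Finsupp.single 0 (normOp K deg f) + tsyganD A u := by
  obtain ⟨k, hk⟩ : ∃ k, ∀ i, k < i → x i = 0 :=
    ⟨x.support.sup id, fun i hi => by
      by_contra h
      exact absurd (Finset.le_sup (f := id) (Finsupp.mem_support_iff.2 h)) (not_le.2 hi)⟩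
  induction k generalizing x with
  | zero =>
    have hx0 : x = Finsupp.single 0 (x 0) := by
      ext1 i
      rcases i with _ | i
      · simp
      · rw [hk _ (Nat.succ_pos i)]; simp
    have h0 := hd 0
    rw [tsyganD_apply_succ, hk 1 one_pos, map_zero, zero_add] at h0
    have hc := (mem_tsyganCx A).1 hx 0
    rw [Nat.cast_zero, sub_zero] at hc
    obtain ⟨f, hf, hfx⟩ := exists_hdiff_eq heven 1 hc (by rwa [hdiff_add_two 0])
    rw [hdiff_odd (by decide)] at hfx
    exact ⟨f, hf, 0, Submodule.zero_mem _, by rw [map_zero, add_zero, hfx, ← hx0]⟩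
  | succ k ih =>
    have h0 := hd (k + 1)
    rw [tsyganD_apply_succ, hk (k + 1 + 1) (by omega), map_zero, zero_add] at h0
    obtain ⟨g, hg, hgx⟩ := exists_hdiff_eq heven k ((mem_tsyganCx A).1 hx (k + 1)) h0
    have hu : Finsupp.single k g ∈ (tsyganCx A).X (n - 1) := by
      refine single_mem_tsyganCx A ?_
      rwa [show n - 1 - (k : ℤ) + 1 = n - (k + 1 : ℕ) + 1 by push_cast; ring]
    have hdu := (tsyganCx_isComplex A heven _ _ hu).1
    rw [sub_add_cancel] at hdu
    obtain ⟨f, hf, v, hv, h⟩ := ih (Submodule.sub_mem _ hx hdu) (fun i => by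
      rw [tsyganCx_d, map_sub, tsyganD_tsyganD A heven, sub_zero, hd]) (fun i hi => by
      rw [Finsupp.sub_apply, tsyganCx_d, tsyganD_single, hgx, Finsupp.add_apply,
        Finsupp.single_apply, if_neg (by omega), zero_add, Finsupp.single_apply]
      split_ifs with h1
      · rw [h1, sub_self]
      · rw [hk i (by omega), sub_zero])
    refine ⟨f, hf, v + Finsupp.single k g, Submodule.add_mem _ hv hu, ?_⟩
    rw [map_add, ← add_assoc, ← h, tsyganCx_d, sub_add_cancel]

/-- The first two columns are quasi-isomorphic to the leftmost column, since the second one is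
contracted by `unitHtpy`: if the leftmost component of a cocycle of these columns is a Hochschild
coboundary, the cocycle is a coboundary modulo the remaining columns. -/
theorem exists_sub_eq_shift2 {e : I} (hunit : A.IsUnital e) {n : ℤ} {x : ℕ →₀ Series K I}
    (hx : x ∈ (tsyganCx A).X n) {u : Series K I} (hu : u ∈ col 𝒦 deg n) (h0 : x 0 = A.b u)
    (h1 : tsyganD A x 1 = 0) :
    ∃ v ∈ (tsyganCx A).X (n - 1), ∃ w ∈ (tsyganCx A).X (n - 2),
      x - tsyganD A v = shift2 w := by
  set g : Series K I := x 1 - (u - zOp K deg u) with hg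
  have hxc : x 1 ∈ col 𝒦 deg n := by
    have h := (mem_tsyganCx A).1 hx 1
    rwa [show n - ((1 : ℕ) : ℤ) + 1 = n by simp] at h
  have hgc : g ∈ col 𝒦 deg n :=
    Submodule.sub_mem _ hxc (Submodule.sub_mem _ hu (zOp_mem_col hu))
  have hmg : A.m g = 0 := by
    rw [tsyganD_apply_succ, vdiff_odd A (by decide), hdiff_even (by decide), h0,
      A.b_sub_zOp heven] at h1
    rw [hg, map_sub, sub_eq_add_neg]
    exact h1
  have hh := hunit.m_unitHtpy hgc.2
  rw [hmg, map_zero, add_zero] at hh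
  set v : ℕ →₀ Series K I := Finsupp.single 0 u + Finsupp.single 1 (unitHtpy e g) with hv
  have hvm : v ∈ (tsyganCx A).X (n - 1) := by
    refine Submodule.add_mem _ (single_mem_tsyganCx A ?_) (single_mem_tsyganCx A ?_)
    · rwa [show n - 1 - ((0 : ℕ) : ℤ) + 1 = n by simp]
    · rw [show n - 1 - ((1 : ℕ) : ℤ) + 1 = n - 1 by simp]
      exact unitHtpy_mem_col e hunit.1 (by rwa [sub_add_cancel])
  have hdv := (tsyganCx_isComplex A heven _ _ hvm).1
  rw [sub_add_cancel] at hdv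
  obtain ⟨w, hw⟩ := exists_eq_shift2 (x := x - tsyganD A v)
    (by rw [Finsupp.sub_apply, tsyganD_apply_zero, h0, hv]; simp)
    (by
      rw [Finsupp.sub_apply, tsyganD_apply_succ, vdiff_odd A (by decide), hdiff_even (by decide), hv]
      simp only [Finsupp.add_apply, Finsupp.single_apply, one_ne_zero, zero_ne_one, if_true, if_false,
        zero_add, add_zero, hh]
      rw [hg]
      abel)
  refine ⟨v, hvm, w, ?_, hw⟩
  rw [← shift2_mem_tsyganCx, ← hw, sub_add_cancel]
  exact Submodule.sub_mem _ hx hdv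

end Complex

section Hodge

variable (K deg) in
/-- The `j`-th Hodge projection of column `i` of the Tsygan bicomplex: `ẽ(j - k)` for `i = 2k` and
`e(j - k)` for `i = 2k + 1`, where negative indices give `0`. -/
noncomputable def colProj (j i : ℕ) : Series K I →ₗ[K] Series K I :=
  if i / 2 ≤ j then (if Even i then eTilde K deg (j - i / 2) else eOp K deg (j - i / 2)) else 0

variable (K deg) in
/-- The `j`-th Hodge projection of the Tsygan complex. -/
noncomputable def tsyganProj (j : ℕ) : (ℕ →₀ Series K I) →ₗ[K] (ℕ →₀ Series K I) :=
  Finsupp.lsum K fun i => Finsupp.lsingle i ∘ₗ colProj K deg j i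

theorem tsyganProj_apply (j : ℕ) (x : ℕ →₀ Series K I) (i : ℕ) :
    tsyganProj K deg j x i = colProj K deg j i (x i) := by
  induction x using Finsupp.induction_linear with
  | zero => simp
  | add x y hx hy => simp [hx, hy]
  | single k f =>
    simp only [tsyganProj, Finsupp.lsum_single, LinearMap.comp_apply, Finsupp.lsingle_apply,
      Finsupp.single_apply]
    split_ifs with h
    · rw [h]
    · rw [map_zero]

theorem colProj_add_two (j i : ℕ) :
    colProj K deg (j + 1) (i + 2) = (colProj K deg j i : _ →ₗ[K] Series K I) := by
  simp [colProj, Nat.even_add]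

theorem tsyganProj_shift2 (j : ℕ) (x : ℕ →₀ Series K I) :
    tsyganProj K deg (j + 1) (shift2 x) = shift2 (tsyganProj K deg j x) := by
  refine ext_add_two ?_ ?_ fun i => ?_
  · rw [tsyganProj_apply, shift2_apply_zero, shift2_apply_zero, map_zero]
  · rw [tsyganProj_apply, shift2_apply_one, shift2_apply_one, map_zero]
  · rw [tsyganProj_apply, shift2_apply_add_two, shift2_apply_add_two, colProj_add_two,
      tsyganProj_apply]

theorem colProj_two_mul (j k : ℕ) (h : k ≤ j) :
    colProj K deg j (2 * k) = (eTilde K deg (j - k) : _ →ₗ[K] Series K I) := by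
  simp [colProj, h]

theorem colProj_zero (j : ℕ) : colProj K deg j 0 = (eTilde K deg j : _ →ₗ[K] Series K I) :=
  colProj_two_mul j 0 (Nat.zero_le j)

theorem colProj_two_mul_add_one (j k : ℕ) (h : k ≤ j) :
    colProj K deg j (2 * k + 1) = (eOp K deg (j - k) : _ →ₗ[K] Series K I) := by
  have h1 : (2 * k + 1) / 2 = k := by omega
  simp [colProj, h, h1]

theorem colProj_of_lt {j i : ℕ} (h : j < i / 2) :
    colProj K deg j i = (0 : Series K I →ₗ[K] Series K I) := if_neg (not_le.2 h)

theorem tsyganProj_mem {n : ℤ} (j : ℕ) {x : ℕ →₀ Series K I} (hx : x ∈ (tsyganCx A).X n) :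
    tsyganProj K deg j x ∈ (tsyganCx A).X n := by
  rw [mem_tsyganCx] at hx ⊢
  intro i
  rw [tsyganProj_apply, colProj]
  let _ : TopologicalSpace K := ⊥
  have : DiscreteTopology K := ⟨rfl⟩
  split_ifs
  · exact eTilde_mem_col deg _ (hx i)
  · exact eOp_mem_col deg _ (hx i)
  · exact Submodule.zero_mem _

variable [TopologicalSpace K] [DiscreteTopology K] (heven : ∀ n, Odd n → 𝒦 n = ⊥)

theorem hdiff_colProj (j i : ℕ) (f : Series K I) :
    hdiff K deg i (colProj K deg j i f) = colProj K deg j (i + 1) (hdiff K deg i f) := by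
  by_cases h : i / 2 ≤ j
  · rcases Nat.even_or_odd' i with ⟨k, rfl | rfl⟩
    · have hk : k ≤ j := by omega
      rw [colProj_two_mul j k hk, colProj_two_mul_add_one j k hk, hdiff_even (by simp),
        hdiff_even (by simp), sub_zOp_eTilde]
    · have hk : k ≤ j := by omega
      rw [colProj_two_mul_add_one j k hk, hdiff_odd (by simp)]
      rcases hk.eq_or_lt with rfl | hlt
      · rw [Nat.sub_self, normOp_eOp_zero, colProj_of_lt (by omega), LinearMap.zero_apply]
      · rw [show 2 * k + 1 + 1 = 2 * (k + 1) by ring, colProj_two_mul j (k + 1) hlt,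
          ← normOp_eOp_succ, show j - (k + 1) + 1 = j - k by omega]
  · rw [colProj_of_lt (by omega), colProj_of_lt (by omega)]
    simp

include heven in
theorem vdiff_colProj (hC : A.IsCInf) (j i : ℕ) (f : Series K I) :
    vdiff A i (colProj K deg j i f) = colProj K deg j i (vdiff A i f) := by
  rw [colProj]
  split_ifs with h hi
  · rw [vdiff_even A hi, hC.b_eTilde heven]
  · rw [vdiff_odd A hi, hC.m_eOp heven]
  · simp

include heven in
theorem tsyganD_tsyganProj (hC : A.IsCInf) (j : ℕ) (x : ℕ →₀ Series K I) :
    tsyganD A (tsyganProj K deg j x) = tsyganProj K deg j (tsyganD A x) := by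
  ext1 i
  rw [tsyganProj_apply]
  rcases i with _ | i
  · rw [tsyganD_apply_zero, tsyganD_apply_zero, tsyganProj_apply, ← vdiff_even A Even.zero,
      vdiff_colProj A heven hC]
  · rw [tsyganD_apply_succ, tsyganD_apply_succ, tsyganProj_apply, tsyganProj_apply, (colProj K deg j _).map_add,
      vdiff_colProj A heven hC, hdiff_colProj]

end Hodge

end Tsygan

/-! ### Connes periodicity -/

section Periodicity

variable {K I : Type*} [CommRing K] [Algebra ℚ K] {𝒦 : ℤ → Submodule ℚ K} [GradedAlgebra 𝒦]
variable {deg : I → ℤ} [DecidableEq I] (A : AInfStructure 𝒦 deg)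

theorem lieDer_mkQ (f : Series K I) :
    A.lieDer ((commutators 𝒦 deg).mkQ f) = (commutators 𝒦 deg).mkQ (A.m f) := rfl

theorem mem_cyclicCx {n : ℤ} {x : ZeroForms 𝒦 deg} :
    x ∈ (cyclicCx A).X n ↔ ∃ f ∈ col 𝒦 deg (n + 1), (commutators 𝒦 deg).mkQ f = x := Iff.rfl

theorem mkQ_mem_cyclicCx {n : ℤ} {f : Series K I} (hf : f ∈ col 𝒦 deg (n + 1)) :
    (commutators 𝒦 deg).mkQ f ∈ (cyclicCx A).X n := ⟨f, hf, rfl⟩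

theorem cyclicCx_isComplex : (cyclicCx A).IsComplex := by
  rintro n _ ⟨f, hf, rfl⟩
  refine ⟨⟨A.m f, A.m_mem_col hf, rfl⟩, ?_⟩
  change (commutators 𝒦 deg).mkQ (A.m (A.m f)) = 0
  rw [A.sq_zero, map_zero]

variable [TopologicalSpace K] [DiscreteTopology K] (heven : ∀ n, Odd n → 𝒦 n = ⊥)

include heven in
theorem hochCx_isComplex : (hochCx A).IsComplex :=
  fun _ x hx => ⟨A.b_mem_col hx, A.b_b heven x⟩

include heven in
theorem cyclicHodge_isComplex (hC : A.IsCInf) (j : ℕ) : (cyclicHodge A j).IsComplex := by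
  rintro n _ ⟨_, ⟨f, hf, rfl⟩, rfl⟩
  refine ⟨⟨_, ⟨A.m f, A.m_mem_col hf, rfl⟩, ?_⟩, ?_⟩
  · change (commutators 𝒦 deg).mkQ (eOp K deg (j + 1) (A.m f)) =
      (commutators 𝒦 deg).mkQ (A.m (eOp K deg (j + 1) f))
    rw [hC.m_eOp heven]
  · change (commutators 𝒦 deg).mkQ (A.m (A.m (eOp K deg (j + 1) f))) = 0
    rw [A.sq_zero, map_zero]

include heven in
theorem hochHodge_isComplex (hC : A.IsCInf) (j : ℕ) : (hochHodge A j).IsComplex := by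
  rintro n _ ⟨f, hf, rfl⟩
  exact ⟨⟨A.b f, A.b_mem_col hf, (hC.b_eTilde heven j f).symm⟩, A.b_b heven _⟩

include heven in
theorem commutators_le_ker_normOp :
    commutators 𝒦 deg ≤ LinearMap.ker (normOp K deg : Series K I →ₗ[K] Series K I) :=
  fun f hf => ((mem_commutators_iff heven f).1 hf).1

/-- The map induced by `N` from `0`-forms to the leftmost column of the Tsygan complex. -/
noncomputable def normMap : ZeroForms 𝒦 deg →ₗ[𝒦 0] (ℕ →₀ Series K I) :=
  (Finsupp.lsingle 0 ∘ₗ (commutators 𝒦 deg).liftQ (normOp K deg)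
    (commutators_le_ker_normOp heven)).restrictScalars (𝒦 0)

theorem normMap_mkQ (f : Series K I) : normMap heven ((commutators 𝒦 deg).mkQ f) =
    Finsupp.single 0 (normOp K deg f) := rfl

include heven in
theorem tsyganD_single_normOp (f : Series K I) :
    tsyganD A (Finsupp.single 0 (normOp K deg f)) =
      -Finsupp.single 0 (normOp K deg (A.m f)) := by
  rw [tsyganD_single, vdiff_even A Even.zero, hdiff_even Even.zero, zOp_normOp, sub_self,
    Finsupp.single_zero, add_zero, A.b_normOp heven, Finsupp.single_neg]

theorem normMap_mem {n : ℤ} {x : ZeroForms 𝒦 deg} (hx : x ∈ (cyclicCx A).X n) :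
    normMap heven x ∈ (tsyganCx A).X n := by
  obtain ⟨f, hf, rfl⟩ := (mem_cyclicCx A).1 hx
  rw [normMap_mkQ]
  refine single_mem_tsyganCx A ?_
  rw [Nat.cast_zero, sub_zero]
  exact normOp_mem_col hf

/-- `N` anticommutes with the differentials, because `b N = -N m`. -/
theorem tsyganCx_d_normMap (x : ZeroForms 𝒦 deg) :
    (tsyganCx A).d (normMap heven x) = -normMap heven ((cyclicCx A).d x) := by
  obtain ⟨f, rfl⟩ := (commutators 𝒦 deg).mkQ_surjective x
  exact tsyganD_single_normOp A heven f

/-- The map induced by `N` from cyclic Hochschild cohomology to the cohomology of the Tsygan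
complex. -/
noncomputable def toTsygan (n : ℤ) : (cyclicCx A).H n →ₗ[𝒦 0] (tsyganCx A).H n :=
  Cx.mapH (cyclicCx A) (tsyganCx A) (normMap heven)
    (fun x hx h => ⟨normMap_mem A heven hx, by rw [tsyganCx_d_normMap, h, map_zero, neg_zero]⟩)
    (fun u hu => ⟨-normMap heven u, Submodule.neg_mem _ (normMap_mem A heven hu), by
      rw [map_neg, tsyganCx_d_normMap, neg_neg]⟩)

theorem toTsygan_represents {n : ℤ} {f : Series K I} {ξ : (cyclicCx A).H n}
    (h : (cyclicCx A).Represents n ((commutators 𝒦 deg).mkQ f) ξ) :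
    (tsyganCx A).Represents n (Finsupp.single 0 (normOp K deg f)) (toTsygan A heven n ξ) :=
  Cx.mapH_represents (cyclicCx A) (tsyganCx A) (normMap heven) _ _ h

theorem exists_mkQ_represents {n : ℤ} (ξ : (cyclicCx A).H n) :
    ∃ f ∈ col 𝒦 deg (n + 1), (cyclicCx A).Represents n ((commutators 𝒦 deg).mkQ f) ξ := by
  obtain ⟨x, hx⟩ := (cyclicCx A).exists_represents ξ
  obtain ⟨f, hf, rfl⟩ := (mem_cyclicCx A).1 hx.mem
  exact ⟨f, hf, hx⟩

include heven in
theorem mkQ_eq_zero_iff {f : Series K I} (hf : f [] = 0) :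
    (commutators 𝒦 deg).mkQ f = 0 ↔ normOp K deg f = 0 := by
  rw [Submodule.mkQ_apply, Submodule.Quotient.mk_eq_zero, mem_commutators_iff heven]
  exact and_iff_left hf

/-- A class of the Tsygan complex is represented by a norm in the leftmost column, and so is a cochain
bounding such a representative. -/
theorem toTsygan_bijective (n : ℤ) : Function.Bijective (toTsygan A heven n) := by
  constructor
  · rw [injective_iff_map_eq_zero]
    intro ξ h
    obtain ⟨f, hf, hξ⟩ := exists_mkQ_represents A ξ
    obtain ⟨u, hu, hd⟩ := (toTsygan_represents A heven hξ).eq_zero_iff.1 h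
    rw [tsyganCx_d] at hd
    obtain ⟨g, hg, v, -, rfl⟩ := exists_reduction A heven hu fun i => by
      rw [hd, Finsupp.single_apply, if_neg (Nat.succ_ne_zero i).symm]
    rw [sub_add_cancel] at hg
    rw [map_add, tsyganD_tsyganD A heven, add_zero, tsyganD_single_normOp A heven,
      ← Finsupp.single_neg] at hd
    have h1 := Finsupp.single_injective 0 hd
    refine hξ.eq_zero_iff.2 ⟨(commutators 𝒦 deg).mkQ (-g), mkQ_mem_cyclicCx A ?_, ?_⟩
    · rw [sub_add_cancel]
      exact Submodule.neg_mem _ hg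
    · change (commutators 𝒦 deg).mkQ (A.m (-g)) = _
      rw [← sub_eq_zero, ← map_sub, mkQ_eq_zero_iff heven, map_sub, map_neg, map_neg, h1, sub_self]
      rw [Pi.sub_apply, hf.2, map_neg, Pi.neg_apply, A.m_apply_nil hg.2, neg_zero, sub_zero]
  · intro η
    obtain ⟨x, hx⟩ := (tsyganCx A).exists_represents η
    have hdx := hx.d_eq_zero
    rw [tsyganCx_d] at hdx
    obtain ⟨f, hf, u, hu, rfl⟩ := exists_reduction A heven hx.mem fun i => by rw [hdx]; rfl
    have h1 : normOp K deg (A.m f) = 0 := by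
      rw [map_add, tsyganD_tsyganD A heven, add_zero, tsyganD_single_normOp A heven, neg_eq_zero,
        Finsupp.single_eq_zero] at hdx
      exact hdx
    obtain ⟨ξ, hξ⟩ := (cyclicCx A).exists_class (mkQ_mem_cyclicCx A hf)
      ((mkQ_eq_zero_iff heven (A.m_apply_nil hf.2)).2 h1)
    exact ⟨ξ, ((toTsygan_represents A heven hξ).eq_iff hx).2
      ⟨-u, Submodule.neg_mem _ hu, by rw [map_neg, tsyganCx_d]; abel⟩⟩

/-- `N` identifies cyclic Hochschild cohomology with the cohomology of the Tsygan complex. -/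
noncomputable def tsyganEquiv (n : ℤ) : (cyclicCx A).H n ≃ₗ[𝒦 0] (tsyganCx A).H n :=
  LinearEquiv.ofBijective (toTsygan A heven n) (toTsygan_bijective A heven n)

/-- The periodicity map on the cohomology of the Tsygan complex. -/
noncomputable def shiftH (n : ℤ) : (tsyganCx A).H n →ₗ[𝒦 0] (tsyganCx A).H (n + 2) :=
  Cx.mapH (tsyganCx A) (tsyganCx A) shift2Lin
    (fun x hx h => ⟨(shift2_mem_tsyganCx A).2 hx, by
      change tsyganD A (shift2 x) = 0
      rw [tsyganD_shift2, ← tsyganCx_d, h]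
      exact (shift2Lin (𝒦 := 𝒦)).map_zero⟩)
    (fun u hu => ⟨shift2 u, by
      rw [show n + 2 - 1 = n - 1 + 2 by ring]
      exact (shift2_mem_tsyganCx A).2 hu, tsyganD_shift2 A u⟩)

theorem shiftH_represents {n : ℤ} {x : ℕ →₀ Series K I} {ξ : (tsyganCx A).H n}
    (h : (tsyganCx A).Represents n x ξ) :
    (tsyganCx A).Represents (n + 2) (shift2 x) (shiftH A n ξ) :=
  Cx.mapH_represents (tsyganCx A) (tsyganCx A) shift2Lin _ _ h

theorem apply_zero_mem_col {n : ℤ} {x : ℕ →₀ Series K I} (hx : x ∈ (tsyganCx A).X n) :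
    x 0 ∈ col 𝒦 deg (n + 1) := by
  have h := (mem_tsyganCx A).1 hx 0
  rwa [Nat.cast_zero, sub_zero] at h

/-- The map from the cohomology of the Tsygan complex to Hochschild cohomology given by the
projection onto the leftmost column. -/
noncomputable def leftmostH (n : ℤ) : (tsyganCx A).H n →ₗ[𝒦 0] (hochCx A).H n :=
  Cx.mapH (tsyganCx A) (hochCx A)
    ((Finsupp.lapply 0 : (ℕ →₀ Series K I) →ₗ[K] Series K I).restrictScalars (𝒦 0))
    (fun x hx h => ⟨apply_zero_mem_col A hx, by
      change A.b (x 0) = 0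
      rw [← tsyganD_apply_zero, ← tsyganCx_d, h, Finsupp.zero_apply]⟩)
    (fun u hu => ⟨u 0, apply_zero_mem_col A hu, (tsyganD_apply_zero A u).symm⟩)

theorem leftmostH_represents {n : ℤ} {x : ℕ →₀ Series K I} {ξ : (tsyganCx A).H n}
    (h : (tsyganCx A).Represents n x ξ) :
    (hochCx A).Represents n (x 0) (leftmostH A n ξ) :=
  Cx.mapH_represents (tsyganCx A) (hochCx A)
    ((Finsupp.lapply 0 : (ℕ →₀ Series K I) →ₗ[K] Series K I).restrictScalars (𝒦 0)) _ _ h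

variable {e : I}

variable (deg e) in
/-- The Connes operator on the unital Hochschild complex, before applying `N`: it is
`-h (1 - z)`, where `h` is the contraction of the column carrying `b'` given by the unit. -/
def preConnes : Series K I →ₗ[K] Series K I := -(unitHtpy e ∘ₗ (LinearMap.id - zOp K deg))

theorem preConnes_apply (f : Series K I) : preConnes deg e f = -unitHtpy e (f - zOp K deg f) := rfl

theorem preConnes_mem_col (he : deg e = 0) {n : ℤ} {f : Series K I}
    (hf : f ∈ col 𝒦 deg (n + 1)) : preConnes deg e f ∈ col 𝒦 deg n :=
  Submodule.neg_mem _ (unitHtpy_mem_col e he (Submodule.sub_mem _ hf (zOp_mem_col hf)))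

variable {A}

include heven in
theorem AInfStructure.IsUnital.m_preConnes (hunit : A.IsUnital e) (f : Series K I) :
    A.m (preConnes deg e f) = preConnes deg e (A.b f) - (f - zOp K deg f) := by
  have h := hunit.m_unitHtpy (f := f - zOp K deg f) (by rw [Pi.sub_apply, zOp_apply_nil, sub_self])
  rw [preConnes_apply, preConnes_apply, A.b_sub_zOp heven, map_neg, map_neg, neg_neg]
  exact eq_sub_of_add_eq' (by rw [← sub_eq_add_neg, sub_eq_iff_eq_add', h])

variable (A)

include heven in
variable {A} in
theorem AInfStructure.IsUnital.lieDer_preConnes (hunit : A.IsUnital e) (f : Series K I) :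
    A.lieDer ((commutators 𝒦 deg).mkQ (preConnes deg e f)) =
      (commutators 𝒦 deg).mkQ (preConnes deg e (A.b f)) := by
  rw [lieDer_mkQ, hunit.m_preConnes heven, map_sub, sub_eq_self]
  exact (Submodule.Quotient.mk_eq_zero _).2 (sub_zOp_mem_commutators f)

/-- The Connes map `B` from Hochschild cohomology to cyclic Hochschild cohomology. -/
noncomputable def connesH (hunit : A.IsUnital e) (n : ℤ) :
    (hochCx A).H (n + 1) →ₗ[𝒦 0] (cyclicCx A).H n :=
  Cx.mapH (hochCx A) (cyclicCx A)
    (((commutators 𝒦 deg).mkQ ∘ₗ preConnes deg e).restrictScalars (𝒦 0))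
    (fun f hf h => ⟨mkQ_mem_cyclicCx A (preConnes_mem_col hunit.1 hf), by
      change A.b f = 0 at h
      exact (hunit.lieDer_preConnes heven f).trans (by rw [h, map_zero, map_zero])⟩)
    (fun f hf => ⟨_, mkQ_mem_cyclicCx A (preConnes_mem_col hunit.1
      (by rw [sub_add_cancel]; rwa [add_sub_cancel_right] at hf)), hunit.lieDer_preConnes heven f⟩)

theorem connesH_represents (hunit : A.IsUnital e) {n : ℤ} {f : Series K I}
    {ξ : (hochCx A).H (n + 1)} (h : (hochCx A).Represents (n + 1) f ξ) :
    (cyclicCx A).Represents n ((commutators 𝒦 deg).mkQ (preConnes deg e f))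
      (connesH A heven hunit n ξ) :=
  Cx.mapH_represents (hochCx A) (cyclicCx A)
    (((commutators 𝒦 deg).mkQ ∘ₗ preConnes deg e).restrictScalars (𝒦 0)) _ _ h

include heven in
/-- A Hochschild cocycle extends to a cocycle of the first two columns. -/
theorem exists_connes_lift (hunit : A.IsUnital e) {n : ℤ} {f : Series K I}
    (hf : f ∈ col 𝒦 deg (n + 1 + 1)) (h : A.b f = 0) :
    ∃ x ∈ (tsyganCx A).X (n + 1), x 0 = f ∧
      tsyganD A x = shift2 (Finsupp.single 0 (normOp K deg (preConnes deg e f))) := by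
  refine ⟨Finsupp.single 0 f + Finsupp.single 1 (preConnes deg e f), Submodule.add_mem _
    (single_mem_tsyganCx A (by rwa [Nat.cast_zero, sub_zero])) (single_mem_tsyganCx A ?_), ?_, ?_⟩
  · rw [Nat.cast_one, add_sub_cancel_right]
    exact preConnes_mem_col hunit.1 hf
  · simp
  · have h1 : shift2 (Finsupp.single 0 (normOp K deg (preConnes deg e f))) =
        Finsupp.single 2 (normOp K deg (preConnes deg e f)) := Finsupp.mapDomain_single
    rw [map_add, tsyganD_single, tsyganD_single, vdiff_even A Even.zero, vdiff_odd A (by decide),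
      hdiff_even Even.zero, hdiff_odd (by decide), h, hunit.m_preConnes heven, h, map_zero,
      Finsupp.single_zero, zero_add, ← add_assoc, ← Finsupp.single_add, h1]
    simp

theorem isPeriodicity (hunit : A.IsUnital e) :
    IsPeriodicity A (tsyganEquiv A heven)
      (fun n => (tsyganEquiv A heven (n + 2)).symm.toLinearMap ∘ₗ shiftH A n ∘ₗ
        (tsyganEquiv A heven n).toLinearMap)
      (fun n => leftmostH A n ∘ₗ (tsyganEquiv A heven n).toLinearMap)
      (connesH A heven hunit) where
  q_eq n x ξ h := toTsygan_represents A heven h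
  S_eq n x ξ h := by
    simp only [LinearMap.comp_apply, LinearEquiv.coe_coe, LinearEquiv.apply_symm_apply]
    exact shiftH_represents A h
  T_eq n x ξ h := leftmostH_represents A h
  B_lift n ξ := by
    obtain ⟨f, hf⟩ := (hochCx A).exists_represents ξ
    obtain ⟨x, hx, hxf, hdx⟩ := exists_connes_lift A heven hunit hf.mem hf.d_eq_zero
    exact ⟨x, hx, _, hxf ▸ hf, hdx⟩
  B_eq n ξ x hx y hξ hdx := by
    -- `x` is compared with the lift of its leftmost component built from the contraction
    obtain ⟨x', hx', hxf, hdx'⟩ := exists_connes_lift A heven hunit hξ.mem hξ.d_eq_zero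
    rw [tsyganCx_d] at hdx
    obtain ⟨v, -, w, hw, h⟩ := exists_sub_eq_shift2 A heven hunit (Submodule.sub_mem _ hx hx')
      (Submodule.zero_mem _) (by rw [Finsupp.sub_apply, hxf, sub_self, map_zero])
      (by rw [map_sub, hdx, hdx', ← shift2_sub, shift2_apply_one])
    have h1 := congrArg (tsyganD A) h
    rw [map_sub, map_sub, tsyganD_tsyganD A heven, sub_zero, hdx, hdx', ← shift2_sub,
      tsyganD_shift2] at h1
    rw [show n + 1 - 2 = n - 1 by ring] at hw
    refine (toTsygan_represents A heven (connesH_represents A heven hunit hξ)).add_coboundary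
      (tsyganCx_isComplex A heven) hw ?_
    rw [tsyganCx_d, ← shift2_injective h1, add_sub_cancel]

variable {A}

include heven in
/-- The diagram chase for the inclusion of the Tsygan complex into itself by the shift, whose quotient
consists of the first two columns. -/
theorem IsPeriodicity.isLongExact (hunit : A.IsUnital e)
    {q : ∀ n, (cyclicCx A).H n ≃ₗ[𝒦 0] (tsyganCx A).H n}
    {S : ∀ n, (cyclicCx A).H n →ₗ[𝒦 0] (cyclicCx A).H (n + 2)}
    {T : ∀ n, (cyclicCx A).H n →ₗ[𝒦 0] (hochCx A).H n}
    {B : ∀ n, (hochCx A).H (n + 1) →ₗ[𝒦 0] (cyclicCx A).H n}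
    (hP : IsPeriodicity A q S T B) : IsLongExact S T B := by
  have hcx := tsyganCx_isComplex A heven
  have hzero : shift2 (0 : ℕ →₀ Series K I) = 0 := (shift2Lin (𝒦 := 𝒦)).map_zero
  have hclass : ∀ {n : ℤ} {x : ℕ →₀ Series K I}, x ∈ (tsyganCx A).X n → tsyganD A x = 0 →
      ∃ ξ, (tsyganCx A).Represents n x (q n ξ) := fun {n x} hx hd => by
    obtain ⟨ζ, hζ⟩ := (tsyganCx A).exists_class hx hd
    exact ⟨(q n).symm ζ, by rwa [LinearEquiv.apply_symm_apply]⟩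
  refine fun n => ⟨fun η => ⟨fun h => ?_, ?_⟩, fun ζ => ⟨fun h => ?_, ?_⟩, fun ξ => ⟨fun h => ?_, ?_⟩⟩
  · obtain ⟨x, hx⟩ := (tsyganCx A).exists_represents (q (n + 2) η)
    obtain ⟨u, hu, hux⟩ := (hP.T_eq _ _ _ hx).eq_zero_iff.1 h
    obtain ⟨v, hv, w, hw, hvw⟩ := exists_sub_eq_shift2 A heven hunit hx.mem
      (by simpa [hochCx] using hu) hux.symm (by rw [← tsyganCx_d, hx.d_eq_zero]; rfl)
    rw [add_sub_cancel_right] at hw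
    obtain ⟨ξ, hξ⟩ := hclass hw (shift2_injective (by
      rw [← tsyganD_shift2, ← hvw, map_sub, tsyganD_tsyganD A heven, ← tsyganCx_d, hx.d_eq_zero,
        sub_zero, hzero]))
    refine ⟨ξ, (q (n + 2)).injective (((hP.S_eq _ _ _ hξ).add_coboundary hcx hv ?_).unique hx)⟩
    rw [← hvw, tsyganCx_d, sub_add_cancel]
  · rintro ⟨ξ, rfl⟩
    obtain ⟨x, hx⟩ := (tsyganCx A).exists_represents (q n ξ)
    have h := hP.T_eq _ _ _ (hP.S_eq _ _ _ hx)
    rw [shift2_apply_zero] at h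
    exact h.unique .zero
  · obtain ⟨x, hx, y, hζ, hd⟩ := hP.B_lift n ζ
    have hy := hP.B_eq n ζ x hx y hζ hd
    rw [h, map_zero] at hy
    obtain ⟨u, hu, huy⟩ := hy.eq_zero_iff.1 rfl
    have hu' := (shift2_mem_tsyganCx A).2 hu
    rw [show n - 1 + 2 = n + 1 by ring] at hu'
    obtain ⟨ξ, hξ⟩ := hclass (Submodule.sub_mem _ hx hu') (by
      rw [map_sub, tsyganD_shift2, ← tsyganCx_d, hd, ← tsyganCx_d, huy, sub_self])
    have h1 := hP.T_eq _ _ _ hξ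
    rw [Finsupp.sub_apply, shift2_apply_zero, sub_zero] at h1
    exact ⟨ξ, h1.unique hζ⟩
  · rintro ⟨ξ, rfl⟩
    obtain ⟨x, hx⟩ := (tsyganCx A).exists_represents (q (n + 1) ξ)
    have h := hP.B_eq n _ x hx.mem 0 (hP.T_eq _ _ _ hx) (by rw [hx.d_eq_zero, hzero])
    exact (q n).map_eq_zero_iff.1 (h.unique .zero)
  · obtain ⟨y, hy⟩ := (tsyganCx A).exists_represents (q n ξ)
    have h1 := hP.S_eq _ _ _ hy
    rw [h, map_zero] at h1
    obtain ⟨x, hx, hxy⟩ := h1.eq_zero_iff.1 rfl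
    rw [show n + 2 - 1 = n + 1 by ring] at hx
    obtain ⟨ζ, hζ⟩ := (hochCx A).exists_class (n := n + 1) (x := x 0) (apply_zero_mem_col A hx) (by
      change A.b (x 0) = 0
      rw [← tsyganD_apply_zero, ← tsyganCx_d, hxy, shift2_apply_zero])
    exact ⟨ζ, (q n).injective ((hP.B_eq n ζ x hx y hζ hxy).unique hy)⟩
  · rintro ⟨ζ, rfl⟩
    obtain ⟨x, hx, y, hζ, hd⟩ := hP.B_lift n ζ
    have h := hP.S_eq _ _ _ (hP.B_eq n ζ x hx y hζ hd)
    rw [show n + 1 = n + 2 - 1 by ring] at hx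
    exact (q (n + 2)).map_eq_zero_iff.1 (h.eq_zero_iff.2 ⟨x, hx, hd⟩)

end Periodicity

/-! ### The Hodge decomposition -/

section Decomposition

variable {K I : Type*} [CommRing K] [TopologicalSpace K] [DiscreteTopology K] [DecidableEq I]

/-- Components with respect to continuous orthogonal projections, of which only finitely many are
nonzero on words of bounded length, can be prescribed arbitrarily. -/
theorem exists_glue {p : ℕ → Series K I →ₗ[K] Series K I} (hcl : ∀ j, IsCL K (p j))
    (hp : ∀ i j f, p i (p j f) = if i = j then p j f else 0)
    (hlen : ∀ j f (w : List I), w.length < j → p j f w = 0) (x : ℕ → Series K I)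
    (hx : ∀ j, p j (x j) = x j) (k : ℕ) :
    p k (fun w => ∑ j ∈ Finset.range (w.length + 1), x j w) = x k := by
  set y : Series K I := fun w => ∑ j ∈ Finset.range (w.length + 1), x j w with hy
  funext w
  obtain ⟨F, hF⟩ := (hcl k).exists_finite w
  -- the coefficient at `w` depends on the words in `F` only, where all `x j` with `j ≥ n` vanish
  let n := max (F.sup List.length) k + 1
  have h1 : ∀ u ∈ F, (y - ∑ j ∈ Finset.range n, x j) u = 0 := fun u hu => by
    have hu' : u.length + 1 ≤ n :=
      Nat.succ_le_succ ((Finset.le_sup (f := List.length) hu).trans (le_max_left _ _))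
    rw [Pi.sub_apply, Finset.sum_apply, sub_eq_zero]
    refine Finset.sum_subset (f := fun j => x j u) (Finset.range_subset_range.2 hu') fun j _ hj => ?_
    rw [← hx j]
    exact hlen j _ u (by rw [Finset.mem_range] at hj; omega)
  have h2 := hF _ h1
  have h3 : ∑ j ∈ Finset.range n, p k (x j) = x k := by
    rw [Finset.sum_eq_single_of_mem k (Finset.mem_range.2 (Nat.lt_succ_of_le (le_max_right _ _)))
      fun j _ hj => by rw [← hx j, hp, if_neg hj.symm], hx]
  rwa [map_sub, map_sum, h3, Pi.sub_apply, sub_eq_zero] at h2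

variable [Algebra ℚ K] {𝒦 : ℤ → Submodule ℚ K} [GradedAlgebra 𝒦] {deg : I → ℤ}

theorem glue_mem_col {n : ℤ} {x : ℕ → Series K I} (hx : ∀ j, x j ∈ col 𝒦 deg n) :
    (fun w => ∑ j ∈ Finset.range (w.length + 1), x j w) ∈ col 𝒦 deg n :=
  ⟨fun w => Submodule.sum_mem _ fun j _ => (hx j).1 w, Finset.sum_eq_zero fun j _ => (hx j).2⟩

theorem eq_zero_of_eTilde_eq_zero {f : Series K I} (hf : f [] = 0)
    (h : ∀ j, eTilde K deg j f = 0) : f = 0 := by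
  funext w
  rw [← sum_eTilde deg f hf (Nat.lt_succ_self w.length)]
  exact Finset.sum_eq_zero fun j _ => by rw [h]; rfl

variable {A : AInfStructure 𝒦 deg} (hC : A.IsCInf) (heven : ∀ n, Odd n → 𝒦 n = ⊥)
include heven

include hC in
theorem exists_isHochHodgeDecomp : ∃ ιH πH, IsHochHodgeDecomp A ιH πH := by
  obtain ⟨ι, π, h, hι, hπ⟩ := Cx.exists_productDecomp (hochCx A) (hochCx_isComplex A heven)
    (hochHodge A) (fun j => (eTilde K deg j).restrictScalars (𝒦 0)) (fun _ _ => rfl) (fun _ => rfl)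
    (fun j n x hx => eTilde_mem_col deg j hx) (hC.b_eTilde heven) (eTilde_eTilde deg)
    (fun n x hx => ⟨_, glue_mem_col fun j => (hx j).1, exists_glue
      (fun j => isCL_eTilde deg j IsCL.id') (eTilde_eTilde deg)
      (fun j f w h => eTilde_of_length_lt deg h f) x fun j => (hx j).2⟩)
    (fun n x hx h => eq_zero_of_eTilde_eq_zero hx.2 h)
  exact ⟨ι, π, h, hι, hπ⟩

theorem commutators_le_comap_eOp (j : ℕ) :
    commutators 𝒦 deg ≤ (commutators 𝒦 deg).comap (eOp K deg (j + 1)) := fun f hf => by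
  rw [Submodule.mem_comap]
  rw [mem_commutators_iff heven] at hf ⊢
  exact ⟨by rw [normOp_eOp_succ, hf.1, map_zero], eOp_of_length_lt deg j.succ_pos f⟩

/-- The projection induced by `e(j+1)` on `0`-forms. -/
noncomputable def zeroFormProj (j : ℕ) : ZeroForms 𝒦 deg →ₗ[𝒦 0] ZeroForms 𝒦 deg :=
  ((commutators 𝒦 deg).mapQ _ (eOp K deg (j + 1))
    (commutators_le_comap_eOp heven j)).restrictScalars (𝒦 0)

theorem zeroFormProj_mkQ (j : ℕ) (f : Series K I) :
    zeroFormProj heven j ((commutators 𝒦 deg).mkQ f) =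
      (commutators 𝒦 deg).mkQ (eOp K deg (j + 1) f) := rfl

include hC in
theorem exists_isCyclicHodgeDecomp : ∃ ιC πC, IsCyclicHodgeDecomp A ιC πC := by
  suffices ∃ ι π, IsProductDecomp (cyclicCx A) (cyclicHodge A) ι π ∧
      (∀ j n, Cx.Induces (cyclicHodge A j) (cyclicCx A) id (ι j n)) ∧
      ∀ j n, Cx.Induces (cyclicCx A) (cyclicHodge A j) (zeroFormProj heven j) (π j n) by
    obtain ⟨ι, π, h, hι, hπ⟩ := this
    exact ⟨ι, π, h, hι, fun j n x ξ hx => hπ j n _ ξ hx⟩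
  refine Cx.exists_productDecomp (cyclicCx A) (cyclicCx_isComplex A)
    (cyclicHodge A) (zeroFormProj heven) ?_ (fun _ => rfl) ?_ ?_ ?_ ?_ ?_
  · intro j n
    ext x
    constructor
    · rintro ⟨_, ⟨f, hf, rfl⟩, rfl⟩
      exact ⟨_, ⟨f, hf, rfl⟩, rfl⟩
    · rintro ⟨_, ⟨f, hf, rfl⟩, rfl⟩
      exact ⟨_, ⟨f, hf, rfl⟩, rfl⟩
  · rintro j n _ ⟨f, hf, rfl⟩
    exact mkQ_mem_cyclicCx A (eOp_mem_col deg _ hf)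
  · intro j x
    obtain ⟨f, rfl⟩ := (commutators 𝒦 deg).mkQ_surjective x
    change (commutators 𝒦 deg).mkQ (A.m (eOp K deg (j + 1) f)) =
      (commutators 𝒦 deg).mkQ (eOp K deg (j + 1) (A.m f))
    rw [hC.m_eOp heven]
  · intro i j x
    obtain ⟨f, rfl⟩ := (commutators 𝒦 deg).mkQ_surjective x
    rw [zeroFormProj_mkQ, zeroFormProj_mkQ, eOp_eOp]
    simp only [add_left_inj]
    split_ifs
    · rfl
    · exact map_zero _
  · intro n x hx
    have h : ∀ j, ∃ f ∈ col 𝒦 deg (n + 1), eOp K deg (j + 1) f = f ∧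
        (commutators 𝒦 deg).mkQ f = x j := fun j => by
      obtain ⟨f, hf, hfx⟩ := (mem_cyclicCx A).1 (hx j).1
      exact ⟨eOp K deg (j + 1) f, eOp_mem_col deg _ hf, by rw [eOp_eOp, if_pos rfl],
        by rw [← zeroFormProj_mkQ heven, hfx, (hx j).2]⟩
    choose f hf hfp hfx using h
    refine ⟨_, mkQ_mem_cyclicCx A (glue_mem_col hf), fun j => ?_⟩
    rw [zeroFormProj_mkQ, exists_glue (p := fun j => eOp K deg (j + 1))
      (fun j => isCL_eOp deg (j + 1) IsCL.id')
      (fun i j f => by rw [eOp_eOp]; simp only [add_left_inj])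
      (fun j f w h => eOp_of_length_lt deg (h.trans (Nat.lt_succ_self j)) f) f hfp j, hfx]
  · rintro n _ ⟨f, hf, rfl⟩ h
    refine (mkQ_eq_zero_iff heven hf.2).2 (eq_zero_of_eTilde_eq_zero (deg := deg)
      (normOp_apply_nil deg f) fun j => ?_)
    rw [← normOp_eOp_succ]
    exact (mkQ_eq_zero_iff heven (eOp_of_length_lt deg j.succ_pos f)).1 (h j)

end Decomposition

section Compatibility

variable {K I : Type*} [CommRing K] [Algebra ℚ K] {𝒦 : ℤ → Submodule ℚ K} [GradedAlgebra 𝒦]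
variable {deg : I → ℤ} [DecidableEq I] {A : AInfStructure 𝒦 deg}
variable [TopologicalSpace K] [DiscreteTopology K]
  (heven : ∀ n, Odd n → 𝒦 n = ⊥) (hC : A.IsCInf)
  {q : ∀ n, (cyclicCx A).H n ≃ₗ[𝒦 0] (tsyganCx A).H n}
  {S : ∀ n, (cyclicCx A).H n →ₗ[𝒦 0] (cyclicCx A).H (n + 2)}
  {T : ∀ n, (cyclicCx A).H n →ₗ[𝒦 0] (hochCx A).H n}
  {B : ∀ n, (hochCx A).H (n + 1) →ₗ[𝒦 0] (cyclicCx A).H n}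
  {ιC : ∀ j n, (cyclicHodge A j).H n →ₗ[𝒦 0] (cyclicCx A).H n}
  {πC : ∀ j n, (cyclicCx A).H n →ₗ[𝒦 0] (cyclicHodge A j).H n}
  {ιH : ∀ j n, (hochHodge A j).H n →ₗ[𝒦 0] (hochCx A).H n}
  {πH : ∀ j n, (hochCx A).H n →ₗ[𝒦 0] (hochHodge A j).H n}
  (hP : IsPeriodicity A q S T B) (hdC : IsCyclicHodgeDecomp A ιC πC)
  (hdH : IsHochHodgeDecomp A ιH πH)

include heven hC hP hdC in
/-- On the Tsygan complex the Hodge projections of cyclic Hochschild cohomology are induced by the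
maps `tsyganProj`. -/
theorem IsPeriodicity.tsyganProj_represents (j : ℕ) {n : ℤ} {x : ℕ →₀ Series K I}
    {ξ : (cyclicCx A).H n} (hx : (tsyganCx A).Represents n x (q n ξ)) :
    (tsyganCx A).Represents n (tsyganProj K deg j x) (q n (ιC j n (πC j n ξ))) := by
  obtain ⟨f, hf, hξ⟩ := exists_mkQ_represents A ξ
  obtain ⟨u, hu, hux⟩ := (hx.eq_iff (hP.q_eq n f ξ hξ)).1 rfl
  refine (hP.q_eq n _ _ (hdC.ι_eq j n _ _ (hdC.π_eq j n f ξ hξ))).add_coboundary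
    (tsyganCx_isComplex A heven) (tsyganProj_mem A j hu) ?_
  have h : tsyganProj K deg j (Finsupp.single 0 (normOp K deg f)) =
      Finsupp.single 0 (normOp K deg (eOp K deg (j + 1) f)) := by
    ext1 i
    rw [tsyganProj_apply, normOp_eOp_succ]
    rcases i with _ | i
    · rw [Finsupp.single_eq_same, Finsupp.single_eq_same]
      rw [colProj_zero]
    · simp
  rw [tsyganCx_d, tsyganD_tsyganProj A heven hC, ← tsyganCx_d, hux, map_sub, h, add_sub_cancel]

omit [TopologicalSpace K] [DiscreteTopology K] in
theorem tsyganProj_apply_zero (j : ℕ) (x : ℕ →₀ Series K I) :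
    tsyganProj K deg j x 0 = eTilde K deg j (x 0) := by
  rw [tsyganProj_apply, colProj_zero]

include heven hC hP hdC in
theorem IsPeriodicity.S_proj (j : ℕ) (n : ℤ) (ξ : (cyclicCx A).H n) :
    S n (ιC j n (πC j n ξ)) = ιC (j + 1) (n + 2) (πC (j + 1) (n + 2) (S n ξ)) := by
  obtain ⟨x, hx⟩ := (tsyganCx A).exists_represents (q n ξ)
  have h1 := hP.S_eq _ _ _ (hP.tsyganProj_represents heven hC hdC j hx)
  have h2 := hP.tsyganProj_represents heven hC hdC (j + 1) (hP.S_eq _ _ _ hx)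
  rw [tsyganProj_shift2] at h2
  exact (q (n + 2)).injective (h1.unique h2)

include heven hC hP hdC hdH in
theorem IsPeriodicity.T_proj (j : ℕ) (n : ℤ) (ξ : (cyclicCx A).H n) :
    T n (ιC j n (πC j n ξ)) = ιH j n (πH j n (T n ξ)) := by
  obtain ⟨x, hx⟩ := (tsyganCx A).exists_represents (q n ξ)
  have h1 := hP.T_eq _ _ _ (hP.tsyganProj_represents heven hC hdC j hx)
  rw [tsyganProj_apply_zero] at h1
  exact h1.unique (hdH.ι_eq j n _ _ (hdH.π_eq j n _ _ (hP.T_eq _ _ _ hx)))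

include heven hC hP hdC hdH in
theorem IsPeriodicity.B_proj (j : ℕ) (n : ℤ) (ζ : (hochCx A).H (n + 1)) :
    B n (ιH (j + 1) (n + 1) (πH (j + 1) (n + 1) ζ)) = ιC j n (πC j n (B n ζ)) := by
  obtain ⟨x, hx, y, hζ, hd⟩ := hP.B_lift n ζ
  have h1 := hP.tsyganProj_represents heven hC hdC j (hP.B_eq n ζ x hx y hζ hd)
  have h2 := hP.B_eq n (ιH (j + 1) (n + 1) (πH (j + 1) (n + 1) ζ)) _
    (tsyganProj_mem A (j + 1) hx) (tsyganProj K deg j y) (by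
      rw [tsyganProj_apply_zero]
      exact hdH.ι_eq _ _ _ _ (hdH.π_eq _ _ _ _ hζ)) (by
      rw [tsyganCx_d, tsyganD_tsyganProj A heven hC, ← tsyganCx_d, hd, tsyganProj_shift2])
  exact (q n).injective (h2.unique h1)

omit [TopologicalSpace K] [DiscreteTopology K] in
/-- A long exact sequence whose maps commute with the idempotents `ι ∘ π` restricts to a long exact
sequence of the components. -/
theorem exists_hodge_components (hE : IsLongExact S T B) (hdC : IsCyclicHodgeDecomp A ιC πC)
    (hdH : IsHochHodgeDecomp A ιH πH) (j : ℕ)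
    (hS : ∀ n ξ, S n (ιC j n (πC j n ξ)) = ιC (j + 1) (n + 2) (πC (j + 1) (n + 2) (S n ξ)))
    (hT : ∀ n ξ, T n (ιC (j + 1) n (πC (j + 1) n ξ)) = ιH (j + 1) n (πH (j + 1) n (T n ξ)))
    (hB : ∀ n ζ, B n (ιH (j + 1) (n + 1) (πH (j + 1) (n + 1) ζ)) = ιC j n (πC j n (B n ζ))) :
    ∃ (Sj : ∀ n, (cyclicHodge A j).H n →ₗ[𝒦 0] (cyclicHodge A (j + 1)).H (n + 2))
      (Tj : ∀ n, (cyclicHodge A (j + 1)).H n →ₗ[𝒦 0] (hochHodge A (j + 1)).H n)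
      (Bj : ∀ n, (hochHodge A (j + 1)).H (n + 1) →ₗ[𝒦 0] (cyclicHodge A j).H n),
      (∀ n ξ, S n (ιC j n ξ) = ιC (j + 1) (n + 2) (Sj n ξ)) ∧
      (∀ n ξ, T n (ιC (j + 1) n ξ) = ιH (j + 1) n (Tj n ξ)) ∧
      (∀ n ξ, B n (ιH (j + 1) (n + 1) ξ) = ιC j n (Bj n ξ)) ∧
      (∀ n ξ, πC (j + 1) (n + 2) (S n ξ) = Sj n (πC j n ξ)) ∧
      (∀ n ξ, πH (j + 1) n (T n ξ) = Tj n (πC (j + 1) n ξ)) ∧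
      (∀ n ξ, πC j n (B n ξ) = Bj n (πH (j + 1) (n + 1) ξ)) ∧
      IsLongExact Sj Tj Bj := by
  have hCC := hdC.π_ι_self
  have hHH := hdH.π_ι_self
  have hSι (n ξ) : S n (ιC j n ξ) = ιC (j + 1) (n + 2) (πC (j + 1) (n + 2) (S n (ιC j n ξ))) := by
    rw [← hS, hCC]
  have hTι (n ξ) : T n (ιC (j + 1) n ξ) =
      ιH (j + 1) n (πH (j + 1) n (T n (ιC (j + 1) n ξ))) := by
    rw [← hT, hCC]
  have hBι (n ξ) : B n (ιH (j + 1) (n + 1) ξ) =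
      ιC j n (πC j n (B n (ιH (j + 1) (n + 1) ξ))) := by
    rw [← hB, hHH]
  have hSπ (n ξ) : πC (j + 1) (n + 2) (S n ξ) =
      πC (j + 1) (n + 2) (S n (ιC j n (πC j n ξ))) := by rw [hS, hCC]
  have hTπ (n ξ) : πH (j + 1) n (T n ξ) =
      πH (j + 1) n (T n (ιC (j + 1) n (πC (j + 1) n ξ))) := by rw [hT, hHH]
  have hBπ (n ξ) : πC j n (B n ξ) =
      πC j n (B n (ιH (j + 1) (n + 1) (πH (j + 1) (n + 1) ξ))) := by rw [hB, hCC]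
  refine ⟨fun n => πC (j + 1) (n + 2) ∘ₗ S n ∘ₗ ιC j n,
    fun n => πH (j + 1) n ∘ₗ T n ∘ₗ ιC (j + 1) n,
    fun n => πC j n ∘ₗ B n ∘ₗ ιH (j + 1) (n + 1), hSι, hTι, hBι, hSπ, hTπ, hBπ, fun n => ⟨?_, ?_, ?_⟩⟩
  · exact exact_of_retract (hE n).1 (ιC j n) (ιC (j + 1) (n + 2)) (ιH (j + 1) (n + 2)) (πC j n)
      (πC (j + 1) (n + 2)) (hCC _ _) (Function.LeftInverse.injective (hHH _ _)) (hSι n)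
      (hTι (n + 2)) (hSπ n)
  · exact exact_of_retract (hE n).2.1 (ιC (j + 1) (n + 1)) (ιH (j + 1) (n + 1)) (ιC j n)
      (πC (j + 1) (n + 1)) (πH (j + 1) (n + 1)) (hHH _ _)
      (Function.LeftInverse.injective (hCC _ _)) (hTι (n + 1)) (hBι n) (hTπ (n + 1))
  · exact exact_of_retract (hE n).2.2 (ιH (j + 1) (n + 1)) (ιC j n) (ιC (j + 1) (n + 2))
      (πH (j + 1) (n + 1)) (πC j n) (hCC _ _) (Function.LeftInverse.injective (hCC _ _)) (hBι n)
      (hSι n) (hBπ n)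

end Compatibility

end CInfHodge

set_option maxHeartbeats 1000000 in
theorem mainTheorem7 {K I : Type*} [CommRing K] [Algebra ℚ K]
    (𝒦 : ℤ → Submodule ℚ K) [GradedAlgebra 𝒦] (heven : ∀ n, Odd n → 𝒦 n = ⊥)
    [DecidableEq I] (deg : I → ℤ) (A : AInfStructure 𝒦 deg) (hC : A.IsCInf)
    (e : I) (hunit : A.IsUnital e) :
    ((cyclicCx A).IsComplex ∧ (hochCx A).IsComplex ∧ (tsyganCx A).IsComplex ∧
      ∀ j, (cyclicHodge A j).IsComplex ∧ (hochHodge A j).IsComplex) ∧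
    ∃ (q : ∀ n, (cyclicCx A).H n ≃ₗ[𝒦 0] (tsyganCx A).H n)
      (S : ∀ n, (cyclicCx A).H n →ₗ[𝒦 0] (cyclicCx A).H (n + 2))
      (T : ∀ n, (cyclicCx A).H n →ₗ[𝒦 0] (hochCx A).H n)
      (B : ∀ n, (hochCx A).H (n + 1) →ₗ[𝒦 0] (cyclicCx A).H n)
      (ιC : ∀ j n, (cyclicHodge A j).H n →ₗ[𝒦 0] (cyclicCx A).H n)
      (πC : ∀ j n, (cyclicCx A).H n →ₗ[𝒦 0] (cyclicHodge A j).H n)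
      (ιH : ∀ j n, (hochHodge A j).H n →ₗ[𝒦 0] (hochCx A).H n)
      (πH : ∀ j n, (hochCx A).H n →ₗ[𝒦 0] (hochHodge A j).H n),
      IsPeriodicity A q S T B ∧ IsLongExact S T B ∧
      IsCyclicHodgeDecomp A ιC πC ∧ IsHochHodgeDecomp A ιH πH ∧
      ∀ j : ℕ, ∃ (Sj : ∀ n, (cyclicHodge A j).H n →ₗ[𝒦 0] (cyclicHodge A (j + 1)).H (n + 2))
        (Tj : ∀ n, (cyclicHodge A (j + 1)).H n →ₗ[𝒦 0] (hochHodge A (j + 1)).H n)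
        (Bj : ∀ n, (hochHodge A (j + 1)).H (n + 1) →ₗ[𝒦 0] (cyclicHodge A j).H n),
        (∀ n ξ, S n (ιC j n ξ) = ιC (j + 1) (n + 2) (Sj n ξ)) ∧
        (∀ n ξ, T n (ιC (j + 1) n ξ) = ιH (j + 1) n (Tj n ξ)) ∧
        (∀ n ξ, B n (ιH (j + 1) (n + 1) ξ) = ιC j n (Bj n ξ)) ∧
        (∀ n ξ, πC (j + 1) (n + 2) (S n ξ) = Sj n (πC j n ξ)) ∧
        (∀ n ξ, πH (j + 1) n (T n ξ) = Tj n (πC (j + 1) n ξ)) ∧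
        (∀ n ξ, πC j n (B n ξ) = Bj n (πH (j + 1) (n + 1) ξ)) ∧
        IsLongExact Sj Tj Bj := by
  let _ : TopologicalSpace K := ⊥
  have : DiscreteTopology K := ⟨rfl⟩
  refine ⟨⟨cyclicCx_isComplex A, hochCx_isComplex A heven, tsyganCx_isComplex A heven,
    fun j => ⟨cyclicHodge_isComplex A heven hC j, hochHodge_isComplex A heven hC j⟩⟩, ?_⟩
  have hP := isPeriodicity A heven hunit
  have hE := hP.isLongExact heven hunit
  obtain ⟨ιC, πC, hdC⟩ := exists_isCyclicHodgeDecomp hC heven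
  obtain ⟨ιH, πH, hdH⟩ := exists_isHochHodgeDecomp hC heven
  exact ⟨_, _, _, _, ιC, πC, ιH, πH, hP, hE, hdC, hdH, fun j => exists_hodge_components hE hdC hdH j
    (hP.S_proj heven hC hdC j) (hP.T_proj heven hC hdC hdH (j + 1)) (hP.B_proj heven hC hdC hdH j)⟩
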